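/- Let $\Omega$ be the open unit ball of $\mathbb R^3$, with spherical coordinates $(r,\theta,\phi)$ and frame $(e_r,e_\theta,e_\phi)$. Let $V$ be the space of vector fields $u\in H^1(\Omega;\mathbb R^3)$ that are divergence-free and axisymmetric about the $z$-axis (swirl is allowed and no boundary condition is imposed), and for $n=0,1,2,\dots$ let $$\lambda_n=\sup_{W\subset V,\ \dim W=n}\ \inf_{u\in V,\ u\ne 0,\ u\perp W}\frac{\|\nabla u\|_{L^2(\Omega)}^2}{\|u\|_{L^2(\Omega)}^2},$$ where $\perp$ is orthogonality in $L^2(\Omega)$. A field $0\neq u\in V$ is an eigenfunction with eigenvalue $\kappa$ if $\langle\nabla u,\nabla v\rangle_{L^2(\Omega)}=\kappa\langle u,v\rangle_{L^2(\Omega)}$ for all $v\in V$. Let $J_\nu$ be the Bessel function of the first kind, $\tilde j_l(r)=J_{l+1/2}(r)\,r^{-3/2}$, $\mu_l=l(l+1)$, $S_l(\theta)=P_l(\cos\theta)$ with $P_l$ the Legendre polynomial, and $Y_l=S_l(\theta)e_r$, $X_l=S_l'(\theta)e_\theta$, $Z_l=S_l'(\theta)e_\phi$. For every $l\ge1$ the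 positive zeros of each of the two equations $$rJ_{l+\frac12}'(r)-\tfrac12J_{l+\frac12}(r)=0,$$ $$(r^2-l(l-1)(l+2))\,r\,\tilde j_l'(r)+(r^2-l(l-1))(r^2-(l-1)(l+2))\,\tilde j_l(r)=0$$ form an infinite strictly increasing sequence indexed by $m=1,2,\dots$ that contains every positive zero; denote them by $\alpha^Z_{l,m}$ and $\alpha^Y_{l,m}$ respectively. Consider the following fields, indexed by a zero mode and by all $l,m\ge1$ for each of the two types: * $\psi_0=\cos\theta\,e_r-\sin\theta\,e_\theta$, with the value $0$; * $\psi^Z_{ml}=\dfrac{J_{l+1/2}(\alpha r)}{\sqrt r}Z_l(\theta)$ with $\alpha=\alpha^Z_{l,m}$, with the value $\alpha^2$; * $\psi^Y_{ml}=\bigl(B\,\tilde j_l(\alpha r)+l\,A\,r^{l-1}\bigr)Y_l(\theta)+\Bigl(\dfrac{B}{\mu_l}\bigl(r\alpha\,\tilde j_l'(\alpha r)+2\tilde j_l(\alpha r)\bigr)+A\,r^{l-1}\Bigr)X_l(\theta)$ with $\alpha=\alpha^Y_{l,m}$, $A=-(\alpha^2-(l-1)(l+2))\,\tilde j_l(\alpha)$,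 $B=\alpha^2-l(l-1)(l+2)$, with the value $\alpha^2$. Then these fields are eigenfunctions (in particular nonzero and in $V$) with the indicated eigenvalues; they are pairwise orthogonal in $L^2(\Omega)$, and every $u\in V$ is an $L^2$-limit of finite linear combinations of them. For each real $\kappa$, the eigenfunctions with eigenvalue $\kappa$ are exactly the nonzero finite linear combinations of those fields in the list whose value is $\kappa$; in particular there are no other eigenvalues. The sequence $\lambda_0,\lambda_1,\lambda_2,\dots$ is the nondecreasing enumeration of the values of all the fields in the list, each field counted once, starting with $\lambda_0=0$ for $\psi_0$. -/

import Mathlib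

open MeasureTheory
open scoped ContDiff

noncomputable section

namespace BallEig

/-- Euclidean three-space. -/
abbrev E3 : Type := EuclideanSpace ℝ (Fin 3)

/-- Lebesgue measure on the open unit ball `Ω` of `ℝ³`. -/
def ballMeasure : Measure E3 := volume.restrict (Metric.ball 0 1)

/-- The real Hilbert space `L²(Ω; ℝ³)` of square-integrable vector fields. -/
abbrev L2Field : Type := Lp E3 2 ballMeasure

/-! ### Weak derivatives and the space of admissible fields -/

/-- `φ` is a test function on the unit ball: smooth with compact support in the open ball. -/
def IsTestFunction (φ : E3 → ℝ) : Prop :=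
  ContDiff ℝ ∞ φ ∧ HasCompactSupport φ ∧ tsupport φ ⊆ Metric.ball 0 1

/-- `g ∈ L²` is the weak partial derivative `∂ⱼ u` on the unit ball. -/
def IsWeakPartial (j : Fin 3) (u g : L2Field) : Prop :=
  ∀ φ : E3 → ℝ, IsTestFunction φ →
    ∫ x, (fderiv ℝ φ x (EuclideanSpace.single j 1)) • u x ∂ballMeasure
      = -∫ x, φ x • g x ∂ballMeasure

/-- Membership in the Sobolev space `H¹(Ω; ℝ³)`. -/
def MemH1 (u : L2Field) : Prop :=
  ∀ j : Fin 3, ∃ g : L2Field, IsWeakPartial j u g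

open Classical in
/-- The weak partial derivative `∂ⱼ u` (it is unique; it is only used for `u ∈ H¹`). -/
def weakPartial (j : Fin 3) (u : L2Field) : L2Field :=
  if h : ∃ g : L2Field, IsWeakPartial j u g then h.choose else 0

/-- `div u = 0` almost everywhere in the ball. -/
def IsDivFree (u : L2Field) : Prop :=
  ∀ᵐ x ∂ballMeasure, ∑ j : Fin 3, (weakPartial j u x) j = 0

/-- Rotation of angle `t` about the `z`-axis. -/
def rotZ (t : ℝ) (x : E3) : E3 :=
  !₂[Real.cos t * x 0 - Real.sin t * x 1, Real.sin t * x 0 + Real.cos t * x 1, x 2]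

/-- `u` commutes with all rotations about the `z`-axis, that is, its components in the spherical
frame do not depend on the azimuth. -/
def IsAxisymmetric (u : L2Field) : Prop :=
  ∀ t : ℝ, ∀ᵐ x ∂ballMeasure, u (rotZ t x) = rotZ t (u x)

/-- The space `V` of admissible functions: divergence-free axisymmetric `H¹` vector fields on the
unit ball, with no boundary condition imposed. -/
def V : Set L2Field := {u | MemH1 u ∧ IsDivFree u ∧ IsAxisymmetric u}

/-- `⟨∇u, ∇v⟩` in `L²(Ω)`. -/
def gradInner (u v : L2Field) : ℝ :=
  ∑ j : Fin 3, inner ℝ (weakPartial j u) (weakPartial j v)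

/-- The Rayleigh quotient `‖∇u‖² / ‖u‖²`. -/
def rayleigh (u : L2Field) : ℝ := gradInner u u / ‖u‖ ^ 2

/-- The `n`-th min-max value (`n = 0, 1, 2, …`) of the Rayleigh quotient: the supremum over
subspaces `W` of `V` of dimension `n` of the infimum of the quotient over nonzero `u ∈ V`
orthogonal to `W` in `L²`.  It is formed in the extended reals. -/
def minMax (n : ℕ) : EReal :=
  ⨆ W ∈ {W : Submodule ℝ L2Field | (W : Set L2Field) ⊆ V ∧ Module.rank ℝ W = n},
    ⨅ u ∈ {u : L2Field | u ∈ V ∧ u ≠ 0 ∧ ∀ w ∈ W, inner ℝ u w = 0}, ((rayleigh u : ℝ) : EReal)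

/-- `u` is stationary for the Rayleigh quotient on `V` with value `κ`
(so `u` is an eigenfunction for the eigenvalue `κ`, or zero):
`⟨∇u, ∇v⟩ = κ ⟨u, v⟩` for every `v ∈ V`. -/
def IsEigen (κ : ℝ) (u : L2Field) : Prop :=
  u ∈ V ∧ ∀ v ∈ V, gradInner u v = κ * inner ℝ u v

/-! ### Bessel functions and the two characteristic equations -/

/-- The Bessel function of the first kind `J_ν(x)`, for `x > 0`. -/
def besselJ (ν x : ℝ) : ℝ :=
  ∑' k : ℕ, (-1) ^ k / ((k.factorial : ℝ) * Real.Gamma (k + ν + 1)) * (x / 2) ^ (2 * (k : ℝ) + ν)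

/-- `J_{l + 1/2}`. -/
def Jhalf (l : ℕ) (r : ℝ) : ℝ := besselJ ((l : ℝ) + 1 / 2) r

/-- `j̃_l(r) = J_{l + 1/2}(r) / r^{3/2}`. -/
def jt (l : ℕ) (r : ℝ) : ℝ := Jhalf l r / r ^ (3 / 2 : ℝ)

/-- Left side of the characteristic equation of the `Z`-type modes. -/
def charZ (l : ℕ) (r : ℝ) : ℝ := r * deriv (Jhalf l) r - 1 / 2 * Jhalf l r

/-- Left side of the characteristic equation of the `Y/X`-type modes. -/
def charY (l : ℕ) (r : ℝ) : ℝ :=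
  (r ^ 2 - (l : ℝ) * ((l : ℝ) - 1) * ((l : ℝ) + 2)) * r * deriv (jt l) r
    + (r ^ 2 - (l : ℝ) * ((l : ℝ) - 1)) * (r ^ 2 - ((l : ℝ) - 1) * ((l : ℝ) + 2)) * jt l r

/-- `posZero f m`, for `m ≥ 1`, is the `m`-th positive zero of `f` in increasing order
(`posZero f 0 = 0` only starts the recursion). -/
def posZero (f : ℝ → ℝ) : ℕ → ℝ
  | 0 => 0
  | m + 1 => sInf {r : ℝ | posZero f m < r ∧ f r = 0}

/-- `f` has infinitely many positive zeros, and `posZero f 1 < posZero f 2 < …` lists them all. -/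
def PosZerosListed (f : ℝ → ℝ) : Prop :=
  StrictMono (posZero f) ∧ {r : ℝ | 0 < r ∧ f r = 0} = {r : ℝ | ∃ m : ℕ, 1 ≤ m ∧ posZero f m = r}

/-- `α^Z_{l,m}`. -/
def alphaZ (l m : ℕ) : ℝ := posZero (charZ l) m

/-- `α^Y_{l,m}`. -/
def alphaY (l m : ℕ) : ℝ := posZero (charY l) m

/-! ### Spherical coordinates and axisymmetric vector spherical harmonics -/

/-- The polar angle `θ ∈ [0, π]`. -/
def polar (x : E3) : ℝ := Real.arccos (x 2 / ‖x‖)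

/-- The azimuth `φ`. -/
def azimuth (x : E3) : ℝ := Complex.arg ⟨x 0, x 1⟩

/-- The unit vector `e_r`. -/
def eR (x : E3) : E3 :=
  !₂[Real.sin (polar x) * Real.cos (azimuth x), Real.sin (polar x) * Real.sin (azimuth x),
    Real.cos (polar x)]

/-- The unit vector `e_θ`. -/
def eTheta (x : E3) : E3 :=
  !₂[Real.cos (polar x) * Real.cos (azimuth x), Real.cos (polar x) * Real.sin (azimuth x),
    -Real.sin (polar x)]

/-- The unit vector `e_φ`. -/
def ePhi (x : E3) : E3 := !₂[-Real.sin (azimuth x), Real.cos (azimuth x), 0]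

/-- The Legendre polynomial `P_l`, by Rodrigues' formula. -/
def legendreP (l : ℕ) : Polynomial ℝ :=
  Polynomial.C (1 / ((2 : ℝ) ^ l * (l.factorial : ℝ))) *
    Polynomial.derivative^[l] ((Polynomial.X ^ 2 - 1) ^ l)

/-- `S_l(θ) = P_l(cos θ)`. -/
def S (l : ℕ) (θ : ℝ) : ℝ := (legendreP l).eval (Real.cos θ)

/-- `Y_l = S_l(θ) e_r`. -/
def vshY (l : ℕ) (x : E3) : E3 := S l (polar x) • eR x

/-- `X_l = S_l'(θ) e_θ`. -/
def vshX (l : ℕ) (x : E3) : E3 := deriv (S l) (polar x) • eTheta x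

/-- `Z_l = S_l'(θ) e_φ`. -/
def vshZ (l : ℕ) (x : E3) : E3 := deriv (S l) (polar x) • ePhi x

/-! ### The modes -/

/-- The field with spherical components `(cos θ, -sin θ, 0)`. -/
def constField (x : E3) : E3 := Real.cos (polar x) • eR x + (-Real.sin (polar x)) • eTheta x

/-- `ψ^Z_{m,l} = J_{l+1/2}(α r) / √r · Z_l(θ)` with `α = α^Z_{l,m}`. -/
def fieldZ (l m : ℕ) (x : E3) : E3 :=
  (Jhalf l (alphaZ l m * ‖x‖) / Real.sqrt ‖x‖) • vshZ l x

/-- `A_{m,l} = -(α² - (l-1)(l+2)) j̃_l(α)` with `α = α^Y_{l,m}`. -/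
def coefA (l m : ℕ) : ℝ :=
  -((alphaY l m) ^ 2 - ((l : ℝ) - 1) * ((l : ℝ) + 2)) * jt l (alphaY l m)

/-- `B_{m,l} = α² - l(l-1)(l+2)` with `α = α^Y_{l,m}`. -/
def coefB (l m : ℕ) : ℝ := (alphaY l m) ^ 2 - (l : ℝ) * ((l : ℝ) - 1) * ((l : ℝ) + 2)

/-- `ψ^Y_{m,l}`, for `l ≥ 1`, with `μ_l = l(l+1)`. -/
def fieldY (l m : ℕ) (x : E3) : E3 :=
  (coefB l m * jt l (alphaY l m * ‖x‖) + (l : ℝ) * coefA l m * ‖x‖ ^ (l - 1)) • vshY l x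
  + (coefB l m / ((l : ℝ) * ((l : ℝ) + 1))
        * (‖x‖ * alphaY l m * deriv (jt l) (alphaY l m * ‖x‖) + 2 * jt l (alphaY l m * ‖x‖))
      + coefA l m * ‖x‖ ^ (l - 1)) • vshX l x

/-- The index set of the modes: the zero mode and, for all `l, m ≥ 1`, one mode of each type. -/
inductive Mode : Type
  | const : Mode
  | Y (l m : ℕ+) : Mode
  | Z (l m : ℕ+) : Mode

/-- The eigenvalue of a mode. -/
def Mode.eigenvalue : Mode → ℝ
  | .const => 0
  | .Y l m => (alphaY l m) ^ 2
  | .Z l m => (alphaZ l m) ^ 2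

/-- The eigenfunction of a mode. -/
def Mode.field : Mode → E3 → E3
  | .const => constField
  | .Y l m => fieldY l m
  | .Z l m => fieldZ l m

end BallEig

end

open BallEig

/-!
The proof uses only polynomial vector fields, power series and the compactness of the embedding of
`H¹` into `L²`; no boundary traces and no regularity theory.

The admissible space is realised as a closed subspace `HV` of the Hilbert space of jets
`(u, ∂₀u, ∂₁u, ∂₂u)`. Green's formula on the ball (`green`) is obtained from test functions: if the
field `F` has normal component divisible by `1 - r²`, a cut-off by a function of `(1 - r²) / ε` leaves no
boundary term in the limit. Hence the boundary term of a polynomial field depends only on its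
values on the sphere, and it is named by the functional `tr`. For a polynomial field `P` and
`u` in `H¹` this gives `⟨∇P, ∇u⟩ = tr u (x · ∇P) - ⟨ΔP, u⟩`. The same formula, together with
the operator `Δ - (x · ∇)² - 3 x · ∇`, whose eigenvalues on polynomials of degree `n` are
`-n (n + 3)`, bounds the distance of `u` to polynomials of degree `N` by `‖∇u‖ / N`, which proves
Rellich's theorem (`isCompactOperator_embV`).

Let `H` be the zonal harmonic polynomial of degree `l`. The poloidal fields
`pf l k = 2kl r^(2k-2) H x - (2k+l+1) r^(2k) ∇H` and the toroidal fields
`qf l k = r^(2k) x × ∇H` are divergence-free, axisymmetric and homogeneous, and the Laplacian sends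
`pf l k` to `2k (2k+2l+1) pf l (k-1)`, and likewise for `qf`. They are total in the admissible
space (`eq_zero_of_moments`), and different angular momenta are orthogonal. Power series in these
fields, with the coefficients `bc` of the Bessel functions, solve `Δu = -κu`; testing them against
an arbitrary `u` leaves boundary pairings, which cancel for the fields in the list exactly by the
two characteristic equations (`gradInner_modeHV`). Conversely, if `u` is an eigenfunction, then its
moments against `pf l k` satisfy a two-term recursion in `k` driven by a single boundary pairing `t`,
and Green's formula gives `entY l κ * t = 0`. So the moments vanish, and with them `u`, unless `κ` is the
square of a zero, in which case `t` is removed by subtracting a multiple of the mode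
(`eq_zero_of_eigSub`).

The zeros are infinite in number because `x j_l(x)` is asymptotic to `sin (x - lπ/2)`, and locally
finite because the characteristic functions are entire in `r²`. That the fields do not vanish
needs `B ≠ 0`: otherwise `α²` is a positive integer at which the spherical Bessel function vanishes,
which an integrality argument on the recurrence in `l` excludes (`bg_natCast_ne_zero`).

Completeness follows from the spectral theorem for the compact operator that represents the `L²`
product in `HV`, and the min-max values are computed from the density of the modes in
`HV`.
-/

noncomputable section
namespace BallEig

open MvPolynomial (X C pderiv)

/-! ### Polynomial vector fields -/

/-- Real polynomials in the three Cartesian coordinates. -/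
abbrev Poly : Type := MvPolynomial (Fin 3) ℝ

/-- Polynomial vector fields on `ℝ³`, given by their Cartesian components. -/
abbrev VP : Type := Fin 3 → Poly

/-- The value of a polynomial at a point. -/
def pev (p : Poly) (x : E3) : ℝ := MvPolynomial.eval (fun i => x i) p

/-- The value of a polynomial vector field at a point. -/
def vev (P : VP) (x : E3) : E3 := WithLp.toLp 2 fun i => pev (P i) x

@[simp] lemma pev_add (p q : Poly) (x : E3) : pev (p + q) x = pev p x + pev q x := by simp [pev]
@[simp] lemma pev_sub (p q : Poly) (x : E3) : pev (p - q) x = pev p x - pev q x := by simp [pev]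
@[simp] lemma pev_neg (p : Poly) (x : E3) : pev (-p) x = - pev p x := by simp [pev]
@[simp] lemma pev_mul (p q : Poly) (x : E3) : pev (p * q) x = pev p x * pev q x := by simp [pev]
@[simp] lemma pev_pow (p : Poly) (n : ℕ) (x : E3) : pev (p ^ n) x = pev p x ^ n := by simp [pev]
@[simp] lemma pev_C (a : ℝ) (x : E3) : pev (C a) x = a := by simp [pev]
@[simp] lemma pev_X (i : Fin 3) (x : E3) : pev (X i) x = x i := by simp [pev]
@[simp] lemma pev_zero (x : E3) : pev 0 x = 0 := by simp [pev]
@[simp] lemma pev_one (x : E3) : pev 1 x = 1 := by simp [pev]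
@[simp] lemma pev_natCast (n : ℕ) (x : E3) : pev (n : Poly) x = n := by simp [pev]
@[simp] lemma pev_ofNat (n : ℕ) [n.AtLeastTwo] (x : E3) :
    pev (ofNat(n) : Poly) x = ofNat(n) := by simp [pev]
@[simp] lemma pev_smul (a : ℝ) (p : Poly) (x : E3) : pev (a • p) x = a * pev p x := by
  simp [pev, MvPolynomial.smul_eval]
@[simp] lemma pev_sum {ι : Type*} (s : Finset ι) (f : ι → Poly) (x : E3) :
    pev (∑ i ∈ s, f i) x = ∑ i ∈ s, pev (f i) x := by simp [pev]
@[simp] lemma vev_apply (P : VP) (x : E3) (i : Fin 3) : vev P x i = pev (P i) x := rfl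

lemma contDiff_pev (p : Poly) : ContDiff ℝ ∞ (pev p) := by
  induction p using MvPolynomial.induction_on with
  | C a =>
    have : pev (C a) = fun _ => a := by ext; simp
    rw [this]; exact contDiff_const
  | add p q hp hq =>
    have : pev (p + q) = fun x => pev p x + pev q x := by ext; simp
    rw [this]; exact hp.add hq
  | mul_X p n hp =>
    have : pev (p * X n) = fun x => pev p x * x n := by ext; simp
    rw [this]; exact hp.mul (by fun_prop)

@[fun_prop] lemma continuous_pev (p : Poly) : Continuous (pev p) := (contDiff_pev p).continuous

lemma fderiv_pev (p : Poly) (x : E3) (j : Fin 3) :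
    fderiv ℝ (pev p) x (EuclideanSpace.single j 1) = pev (pderiv j p) x := by
  have hd (q : Poly) : DifferentiableAt ℝ (pev q) x :=
    ((contDiff_pev q).differentiable (by simp)).differentiableAt
  induction p using MvPolynomial.induction_on with
  | C a =>
    have : pev (C a) = fun _ => a := by ext; simp
    rw [this]; simp
  | add p q hp hq =>
    have : pev (p + q) = pev p + pev q := by ext; simp
    rw [this, fderiv_add (hd p) (hd q)]
    simp [hp, hq]
  | mul_X p n hp =>
    have : pev (p * X n) = pev p * pev (X n) := by ext; simp
    have h2 : pev (X n) = (EuclideanSpace.proj n : E3 →L[ℝ] ℝ) := by ext; simp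
    rw [this, fderiv_mul (hd p) (hd _), h2, ContinuousLinearMap.fderiv]
    simp only [add_apply, smul_apply, smul_eq_mul, hp]
    simp [MvPolynomial.pderiv_X, Pi.single_apply]
    by_cases h : n = j
    · simp [h]
    · simp [h]

@[fun_prop] lemma continuous_vev (P : VP) : Continuous (vev P) := by
  unfold vev
  exact (PiLp.continuous_toLp 2 _).comp (continuous_pi fun i => continuous_pev (P i))

instance : IsFiniteMeasure ballMeasure := by
  unfold ballMeasure
  exact ⟨by simp⟩

lemma ae_mem_ball : ∀ᵐ x ∂ballMeasure, x ∈ Metric.ball (0 : E3) 1 :=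
  ae_restrict_mem Metric.isOpen_ball.measurableSet

lemma ae_norm_lt_one : ∀ᵐ x ∂ballMeasure, ‖x‖ < 1 := by
  filter_upwards [ae_mem_ball] with x hx using by simpa using hx

/-- A continuous function is bounded on the unit ball. -/
lemma exists_bound_ball {F : Type*} [NormedAddCommGroup F] {f : E3 → F} (hf : Continuous f) :
    ∃ K : ℝ, 0 ≤ K ∧ ∀ᵐ x ∂ballMeasure, ‖f x‖ ≤ K := by
  obtain ⟨K, hK⟩ := (isCompact_closedBall (0 : E3) 1).exists_bound_of_continuousOn hf.continuousOn
  refine ⟨|K|, abs_nonneg _, ?_⟩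
  filter_upwards [ae_mem_ball] with x hx
  exact (hK x (Metric.ball_subset_closedBall hx)).trans (le_abs_self K)

lemma memLp_of_continuous {F : Type*} [NormedAddCommGroup F] [SecondCountableTopologyEither E3 F]
    {f : E3 → F} (hf : Continuous f) (p : ENNReal) : MemLp f p ballMeasure := by
  obtain ⟨K, -, hK⟩ := exists_bound_ball hf
  exact MemLp.of_bound hf.aestronglyMeasurable K hK

lemma memLp_vev (P : VP) : MemLp (vev P) 2 ballMeasure :=
  memLp_of_continuous (continuous_vev P) 2

/-- A polynomial vector field as an element of `L²`. -/
def fld : VP →ₗ[ℝ] L2Field where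
  toFun P := (memLp_vev P).toLp (vev P)
  map_add' P Q := by
    rw [← MemLp.toLp_add]
    refine MemLp.toLp_congr _ _ (Filter.Eventually.of_forall fun x => ?_)
    ext i; simp
  map_smul' a P := by
    rw [RingHom.id_apply, ← MemLp.toLp_const_smul]
    refine MemLp.toLp_congr _ _ (Filter.Eventually.of_forall fun x => ?_)
    ext i; simp

lemma fld_ae (P : VP) : fld P =ᵐ[ballMeasure] vev P := MemLp.coeFn_toLp (memLp_vev P)

lemma inner_fld (P : VP) (u : L2Field) :
    inner ℝ (fld P) u = ∫ x, ∑ i, pev (P i) x * u x i ∂ballMeasure := by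
  rw [L2.inner_def]
  refine integral_congr_ae ?_
  filter_upwards [fld_ae P] with x hx
  rw [hx, PiLp.inner_apply]
  simp [mul_comm]

lemma integrable_of_field (u : L2Field) : Integrable u ballMeasure :=
  (Lp.memLp u).integrable (by norm_num)

lemma integrable_comp (u : L2Field) (i : Fin 3) : Integrable (fun x => u x i) ballMeasure :=
  (integrable_of_field u).eval_piLp i

lemma integrable_mul_comp {f : E3 → ℝ} (hf : Continuous f) (u : L2Field) (i : Fin 3) :
    Integrable (fun x => f x * u x i) ballMeasure := by
  obtain ⟨K, -, hK⟩ := exists_bound_ball hf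
  exact (integrable_comp u i).bdd_mul hf.aestronglyMeasurable hK

lemma inner_fld_sum (P : VP) (u : L2Field) :
    inner ℝ (fld P) u = ∑ i, ∫ x, pev (P i) x * u x i ∂ballMeasure := by
  rw [inner_fld, integral_finsetSum]
  intro i _
  exact integrable_mul_comp (continuous_pev _) u i

lemma inner_fld_single (p : Poly) (i : Fin 3) (u : L2Field) :
    inner ℝ (fld (Pi.single i p)) u = ∫ x, pev p x * u x i ∂ballMeasure := by
  rw [inner_fld]
  congr 1; ext x
  rw [Finset.sum_eq_single i]
  · simp
  · intro j _ hj; simp [hj]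
  · simp

/-- The componentwise partial derivative of a polynomial vector field. -/
def dv (j : Fin 3) : VP →ₗ[ℝ] VP where
  toFun P := fun i => pderiv j (P i)
  map_add' P Q := by ext1; simp
  map_smul' a P := by ext1; simp

@[simp] lemma dv_apply (j : Fin 3) (P : VP) (i : Fin 3) : dv j P i = pderiv j (P i) := rfl

lemma dv_smul (j : Fin 3) (p : Poly) (P : VP) :
    dv j (p • P) = pderiv j p • P + p • dv j P := by
  ext1 i
  simp [mul_comm, add_comm]

lemma pderiv_pderiv_comm (i j : Fin 3) (p : Poly) :
    pderiv i (pderiv j p) = pderiv j (pderiv i p) := by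
  induction p using MvPolynomial.induction_on with
  | C a => simp
  | add p q hp hq => simp [hp, hq]
  | mul_X p n hp =>
    have hz (k i j : Fin 3) : pderiv k ((Pi.single i 1 : Fin 3 → Poly) j) = 0 := by
      by_cases h : j = i
      · subst h; simp
      · simp [h]
    simp only [Derivation.leibniz, smul_eq_mul, map_add, hp, MvPolynomial.pderiv_X, hz]
    ring

lemma isWeakPartial_fld (j : Fin 3) (P : VP) : IsWeakPartial j (fld P) (fld (dv j P)) := by
  intro φ hφ
  obtain ⟨h1, h2, h3⟩ := hφ
  have hdf : Continuous fun x => fderiv ℝ φ x (EuclideanSpace.single j 1) :=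
    (h1.continuous_fderiv (by simp)).clm_apply continuous_const
  have key : ∀ i, ∫ x in Metric.ball (0 : E3) 1,
      fderiv ℝ φ x (EuclideanSpace.single j 1) * pev (P i) x
      = -∫ x in Metric.ball (0 : E3) 1, φ x * pev (pderiv j (P i)) x := by
    intro i
    rw [setIntegral_eq_integral_of_forall_compl_eq_zero,
      setIntegral_eq_integral_of_forall_compl_eq_zero]
    · have hd : Differentiable ℝ φ := h1.differentiable (by simp)
      have hp : Differentiable ℝ (pev (P i)) := (contDiff_pev _).differentiable (by simp)
      have hc : HasCompactSupport fun x => fderiv ℝ φ x (EuclideanSpace.single j 1) :=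
        h2.fderiv_apply ℝ _
      have := integral_mul_fderiv_eq_neg_fderiv_mul_of_integrable (μ := (volume : Measure E3))
        (f := φ) (g := pev (P i)) (v := EuclideanSpace.single j 1)
        ((hdf.mul (continuous_pev (P i))).integrable_of_hasCompactSupport hc.mul_right)
        (by simp_rw [fderiv_pev]
            exact (hd.continuous.mul (continuous_pev _)).integrable_of_hasCompactSupport
              h2.mul_right)
        ((hd.continuous.mul (continuous_pev _)).integrable_of_hasCompactSupport h2.mul_right)
        (fun x _ => hd x) (fun x _ => hp x)
      simp_rw [fderiv_pev] at this
      rw [this, neg_neg]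
    · intro x hx
      have : φ x = 0 := image_eq_zero_of_notMem_tsupport fun h => hx (h3 h)
      simp [this]
    · intro x hx
      have : fderiv ℝ φ x = 0 := image_eq_zero_of_notMem_tsupport
        fun h => hx (h3 (tsupport_fderiv_subset ℝ h))
      simp [this]
  have e1 : ∫ x, (fderiv ℝ φ x (EuclideanSpace.single j 1)) • fld P x ∂ballMeasure
      = ∫ x, (fderiv ℝ φ x (EuclideanSpace.single j 1)) • vev P x ∂ballMeasure := by
    refine integral_congr_ae ?_
    filter_upwards [fld_ae P] with x hx
    rw [hx]
  have e2 : ∫ x, φ x • fld (dv j P) x ∂ballMeasure = ∫ x, φ x • vev (dv j P) x ∂ballMeasure := by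
    refine integral_congr_ae ?_
    filter_upwards [fld_ae (dv j P)] with x hx
    rw [hx]
  rw [e1, e2]
  ext i
  have i1 : Integrable (fun x => fderiv ℝ φ x (EuclideanSpace.single j 1) • vev P x) ballMeasure :=
    (memLp_of_continuous (hdf.smul (continuous_vev P)) 1).integrable le_rfl
  have i2 : Integrable (fun x => φ x • vev (dv j P) x) ballMeasure :=
    (memLp_of_continuous (h1.continuous.smul (continuous_vev _)) 1).integrable le_rfl
  have := key i
  rw [PiLp.neg_apply, eval_integral_piLp fun i => i1.eval_piLp i,
    eval_integral_piLp fun i => i2.eval_piLp i]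
  simpa [ballMeasure] using this

/-! ### Rotations about the axis -/

@[simp] lemma rotZ_zero_apply (t : ℝ) (x : E3) :
    rotZ t x 0 = Real.cos t * x 0 - Real.sin t * x 1 := rfl
@[simp] lemma rotZ_one_apply (t : ℝ) (x : E3) :
    rotZ t x 1 = Real.sin t * x 0 + Real.cos t * x 1 := rfl
@[simp] lemma rotZ_two_apply (t : ℝ) (x : E3) : rotZ t x 2 = x 2 := rfl

lemma norm_sq_eq (x : E3) : ‖x‖ ^ 2 = x 0 ^ 2 + x 1 ^ 2 + x 2 ^ 2 := by
  rw [EuclideanSpace.real_norm_sq_eq, Fin.sum_univ_three]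

lemma E3_ext {x y : E3} (h0 : x 0 = y 0) (h1 : x 1 = y 1) (h2 : x 2 = y 2) : x = y := by
  ext i; fin_cases i <;> assumption

lemma rotZ_neg_rotZ (t : ℝ) (x : E3) : rotZ (-t) (rotZ t x) = x := by
  have := Real.sin_sq_add_cos_sq t
  refine E3_ext ?_ ?_ ?_ <;> simp
  · linear_combination x 0 * this
  · linear_combination x 1 * this

/-- The rotation `rotZ t` as a linear isometry of `ℝ³`. -/
def rotE (t : ℝ) : E3 ≃ₗᵢ[ℝ] E3 where
  toFun := rotZ t
  invFun := rotZ (-t)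
  left_inv := rotZ_neg_rotZ t
  right_inv x := by simpa using rotZ_neg_rotZ (-t) x
  map_add' x y := by refine E3_ext ?_ ?_ ?_ <;> simp <;> ring
  map_smul' a x := by refine E3_ext ?_ ?_ ?_ <;> simp <;> ring
  norm_map' x := by
    refine (sq_eq_sq₀ (norm_nonneg _) (norm_nonneg _)).1 ?_
    have := Real.sin_sq_add_cos_sq t
    simp [norm_sq_eq]
    linear_combination (x 0 ^ 2 + x 1 ^ 2) * this

@[simp] lemma rotE_apply (t : ℝ) (x : E3) : rotE t x = rotZ t x := rfl

lemma measurePreserving_rotE (t : ℝ) : MeasurePreserving (rotE t) ballMeasure ballMeasure := by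
  have h := (rotE t).measurePreserving.restrict_preimage
    (s := Metric.ball (0 : E3) 1) Metric.isOpen_ball.measurableSet
  have : rotE t ⁻¹' Metric.ball (0 : E3) 1 = Metric.ball 0 1 := by
    ext x; simp
  rwa [this] at h

lemma isAxisymmetric_iff (u : L2Field) : IsAxisymmetric u ↔ ∀ t : ℝ,
    Lp.compMeasurePreservingₗᵢ ℝ (rotE t) (measurePreserving_rotE t) u
      = ((rotE t).toContinuousLinearEquiv : E3 →L[ℝ] E3).compLpL 2 ballMeasure u := by
  refine forall_congr' fun t => ?_
  rw [Lp.ext_iff]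
  have h1 : Lp.compMeasurePreservingₗᵢ ℝ (rotE t) (measurePreserving_rotE t) u
      =ᵐ[ballMeasure] u ∘ rotE t := Lp.coeFn_compMeasurePreserving _ _
  have h2 := ((rotE t).toContinuousLinearEquiv : E3 →L[ℝ] E3).coeFn_compLpL (p := 2) u
  constructor
  · intro h
    filter_upwards [h, h1, h2] with x hx hx1 hx2
    rw [hx1, hx2]; exact hx
  · intro h
    filter_upwards [h, h1, h2] with x hx hx1 hx2
    rw [hx1, hx2] at hx; exact hx

/-! ### Weak derivatives -/

/-- The field with `i`-th component `f` and other components zero, for a continuous function `f`. -/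
def cfld (f : C(E3, ℝ)) (i : Fin 3) : L2Field :=
  (memLp_of_continuous (f := fun x => f x • EuclideanSpace.single i (1 : ℝ))
    (f.continuous.smul continuous_const) 2).toLp _

lemma inner_cfld (f : C(E3, ℝ)) (i : Fin 3) (u : L2Field) :
    inner ℝ (cfld f i) u = ∫ x, f x * u x i ∂ballMeasure := by
  rw [L2.inner_def]
  refine integral_congr_ae ?_
  have := MemLp.coeFn_toLp (memLp_of_continuous
    (f := fun x => f x • EuclideanSpace.single i (1 : ℝ)) (f.continuous.smul continuous_const) 2)
  filter_upwards [this] with x hx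
  rw [cfld, hx]
  simp [inner_smul_left, EuclideanSpace.inner_single_left]

/-- The weak partial derivative tested on the components. -/
lemma isWeakPartial_iff (j : Fin 3) (u g : L2Field) : IsWeakPartial j u g ↔
    ∀ φ : E3 → ℝ, IsTestFunction φ → ∀ i,
      ∫ x, fderiv ℝ φ x (EuclideanSpace.single j 1) * u x i ∂ballMeasure
        = -∫ x, φ x * g x i ∂ballMeasure := by
  refine forall₂_congr fun φ hφ => ?_
  have hdf : Continuous fun x => fderiv ℝ φ x (EuclideanSpace.single j 1) :=
    (hφ.1.continuous_fderiv (by simp)).clm_apply continuous_const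
  have i1 (i : Fin 3) : Integrable
      (fun x => (fderiv ℝ φ x (EuclideanSpace.single j 1) • u x) i) ballMeasure :=
    integrable_mul_comp hdf u i
  have i2 (i : Fin 3) : Integrable (fun x => (φ x • g x) i) ballMeasure :=
    integrable_mul_comp hφ.1.continuous g i
  rw [PiLp.ext_iff]
  refine forall_congr' fun i => ?_
  rw [PiLp.neg_apply, eval_integral_piLp i1, eval_integral_piLp i2]
  rfl

lemma isWeakPartial_iff_inner (j : Fin 3) (u g : L2Field) : IsWeakPartial j u g ↔
    ∀ (φ : E3 → ℝ) (hφ : IsTestFunction φ) (i : Fin 3),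
      inner ℝ (cfld ⟨fun x => fderiv ℝ φ x (EuclideanSpace.single j 1),
          (hφ.1.continuous_fderiv (by simp)).clm_apply continuous_const⟩ i) u
        + inner ℝ (cfld ⟨φ, hφ.1.continuous⟩ i) g = 0 := by
  rw [isWeakPartial_iff]
  simp only [inner_cfld, ContinuousMap.coe_mk, eq_neg_iff_add_eq_zero]

lemma IsWeakPartial.unique {j : Fin 3} {u g g' : L2Field} (h : IsWeakPartial j u g)
    (h' : IsWeakPartial j u g') : g = g' := by
  rw [← sub_eq_zero, Lp.eq_zero_iff_ae_eq_zero]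
  have := IsOpen.ae_eq_zero_of_integral_contDiff_smul_eq_zero (f := (g - g' : L2Field))
    (μ := ballMeasure) (U := Metric.ball (0 : E3) 1) Metric.isOpen_ball
    ((integrable_of_field (g - g')).locallyIntegrable.locallyIntegrableOn _) (by
      intro φ h1 h2 h3
      have hint (v : L2Field) : Integrable (fun x => φ x • v x) ballMeasure := by
        obtain ⟨K, -, hK⟩ := exists_bound_ball h1.continuous
        exact (integrable_of_field v).bdd_smul K h1.continuous.aestronglyMeasurable hK
      have e : ∫ x, φ x • (g - g' : L2Field) x ∂ballMeasure
          = ∫ x, (φ x • g x - φ x • g' x) ∂ballMeasure := by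
        refine integral_congr_ae ?_
        filter_upwards [Lp.coeFn_sub g g'] with x hx
        rw [hx, Pi.sub_apply, smul_sub]
      rw [e, integral_sub (hint g) (hint g'), sub_eq_zero]
      have h3' := h φ ⟨h1, h2, h3⟩
      have h4' := h' φ ⟨h1, h2, h3⟩
      rw [h3'] at h4'
      exact neg_injective h4')
  filter_upwards [this, ae_mem_ball] with x hx hb using hx hb

lemma isWeakPartial_weakPartial {u : L2Field} (h : MemH1 u) (j : Fin 3) :
    IsWeakPartial j u (weakPartial j u) := by
  rw [weakPartial, dif_pos (h j)]
  exact (h j).choose_spec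

lemma IsWeakPartial.weakPartial_eq {j : Fin 3} {u g : L2Field} (h : IsWeakPartial j u g) :
    weakPartial j u = g := by
  have h' : ∃ g : L2Field, IsWeakPartial j u g := ⟨g, h⟩
  rw [weakPartial, dif_pos h']
  exact h'.choose_spec.unique h

/-! ### The Hilbert space of admissible fields -/

/-- The ambient Hilbert space for the pairs of a field and its gradient. -/
abbrev Jet : Type := PiLp 2 (fun _ : Fin 4 => L2Field)

/-- The divergence of the gradient part of a jet, as an element of `L²`. -/
def jetDiv : Jet →L[ℝ] Lp ℝ 2 ballMeasure :=
  ∑ j : Fin 3, ((EuclideanSpace.proj j : E3 →L[ℝ] ℝ).compLpL 2 ballMeasure).comp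
    (PiLp.proj 2 (fun _ : Fin 4 => L2Field) j.succ)

lemma jetDiv_eq_zero_iff (w : Jet) :
    jetDiv w = 0 ↔ ∀ᵐ x ∂ballMeasure, ∑ j : Fin 3, (w j.succ x) j = 0 := by
  have h1 (j : Fin 3) := (EuclideanSpace.proj j : E3 →L[ℝ] ℝ).coeFn_compLpL (p := 2) (w j.succ)
  have h2 : jetDiv w =ᵐ[ballMeasure] fun x => ∑ j : Fin 3, (w j.succ x) j := by
    have e : jetDiv w = ∑ j : Fin 3,
        (EuclideanSpace.proj j : E3 →L[ℝ] ℝ).compLpL 2 ballMeasure (w j.succ) := by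
      simp [jetDiv]
    rw [e]
    filter_upwards [Lp.coeFn_finsetSum Finset.univ fun j : Fin 3 =>
      (EuclideanSpace.proj j : E3 →L[ℝ] ℝ).compLpL 2 ballMeasure (w j.succ), h1 0, h1 1, h1 2]
      with x hx k0 k1 k2
    rw [hx, Finset.sum_apply, Fin.sum_univ_three, Fin.sum_univ_three, k0, k1, k2]
    rfl
  rw [Lp.eq_zero_iff_ae_eq_zero]
  exact ⟨fun h => by filter_upwards [h, h2] with x a b; rw [← b, a]; rfl,
    fun h => by filter_upwards [h, h2] with x a b; rw [b, a]; rfl⟩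

/-- The space `V` with its `H¹` inner product, realised as the graph `u ↦ (u, ∇u)` inside a
Hilbert space. -/
def HV : Submodule ℝ Jet where
  carrier := {w | (∀ j : Fin 3, IsWeakPartial j (w 0) (w j.succ)) ∧ jetDiv w = 0 ∧
    IsAxisymmetric (w 0)}
  zero_mem' := by
    refine ⟨fun j => ?_, map_zero _, ?_⟩
    · rw [isWeakPartial_iff_inner]; simp
    · rw [isAxisymmetric_iff]; simp
  add_mem' := by
    rintro v w ⟨h1, h2, h3⟩ ⟨k1, k2, k3⟩
    refine ⟨fun j => ?_, by rw [map_add, h2, k2, add_zero], ?_⟩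
    · rw [isWeakPartial_iff_inner]
      intro φ hφ i
      have a := (isWeakPartial_iff_inner _ _ _).1 (h1 j) φ hφ i
      have b := (isWeakPartial_iff_inner _ _ _).1 (k1 j) φ hφ i
      rw [PiLp.add_apply, PiLp.add_apply, inner_add_right, inner_add_right]
      linear_combination a + b
    · rw [isAxisymmetric_iff] at h3 k3 ⊢
      intro t
      rw [PiLp.add_apply, map_add, map_add, h3 t, k3 t]
  smul_mem' := by
    rintro c w ⟨h1, h2, h3⟩
    refine ⟨fun j => ?_, by rw [map_smul, h2, smul_zero], ?_⟩
    · rw [isWeakPartial_iff_inner]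
      intro φ hφ i
      have a := (isWeakPartial_iff_inner _ _ _).1 (h1 j) φ hφ i
      rw [PiLp.smul_apply, PiLp.smul_apply, inner_smul_right, inner_smul_right]
      linear_combination c * a
    · rw [isAxisymmetric_iff] at h3 ⊢
      intro t
      rw [PiLp.smul_apply, map_smul, map_smul, h3 t]

lemma mem_HV {w : Jet} : w ∈ HV ↔ (∀ j : Fin 3, IsWeakPartial j (w 0) (w j.succ)) ∧
    jetDiv w = 0 ∧ IsAxisymmetric (w 0) := Iff.rfl

lemma isClosed_HV : IsClosed (HV : Set Jet) := by
  have hc (i : Fin 4) : Continuous fun w : Jet => w i := PiLp.continuous_apply 2 _ i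
  have : (HV : Set Jet) = (⋂ j : Fin 3, {w | IsWeakPartial j (w 0) (w j.succ)}) ∩
      ({w | jetDiv w = 0} ∩ {w | IsAxisymmetric (w 0)}) := by
    ext w; simp [mem_HV]
  rw [this]
  refine (isClosed_iInter fun j => ?_).inter (IsClosed.inter ?_ ?_)
  · simp only [isWeakPartial_iff_inner, Set.ofPred_forall]
    refine isClosed_iInter fun φ => isClosed_iInter fun hφ => isClosed_iInter fun i => ?_
    exact isClosed_eq ((continuous_const.inner (hc 0)).add (continuous_const.inner (hc _)))
      continuous_const
  · exact isClosed_eq jetDiv.continuous continuous_const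
  · simp only [isAxisymmetric_iff, Set.ofPred_forall]
    refine isClosed_iInter fun t => isClosed_eq ?_ ?_
    · exact (LinearIsometry.continuous _).comp (hc 0)
    · exact (ContinuousLinearMap.continuous _).comp (hc 0)

instance : CompleteSpace HV := isClosed_HV.completeSpace_coe

/-- The embedding of `V` with its `H¹` norm into `L²`. -/
def embV : HV →L[ℝ] L2Field :=
  (PiLp.proj 2 (fun _ : Fin 4 => L2Field) 0 : Jet →L[ℝ] L2Field).comp HV.subtypeL

@[simp] lemma embV_apply (w : HV) : embV w = (w : Jet) 0 := rfl

lemma HV.weakPartial_eq (w : HV) (j : Fin 3) : weakPartial j (embV w) = (w : Jet) j.succ :=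
  (w.2.1 j).weakPartial_eq

lemma embV_mem (w : HV) : embV w ∈ V := by
  refine ⟨fun j => ⟨_, w.2.1 j⟩, ?_, w.2.2.2⟩
  have := (jetDiv_eq_zero_iff _).1 w.2.2.1
  unfold IsDivFree
  simpa only [HV.weakPartial_eq] using this

lemma exists_embV {u : L2Field} (hu : u ∈ V) : ∃ w : HV, embV w = u := by
  obtain ⟨h1, h2, h3⟩ := hu
  refine ⟨⟨WithLp.toLp 2 (Fin.cons u fun j => weakPartial j u), ?_, ?_, ?_⟩, rfl⟩
  · exact fun j => isWeakPartial_weakPartial h1 j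
  · rw [jetDiv_eq_zero_iff]; exact h2
  · exact h3

lemma embV_injective : Function.Injective embV := by
  intro v w h
  ext1
  refine PiLp.ext fun i => ?_
  refine Fin.cases h (fun j => ?_) i
  rw [← HV.weakPartial_eq, ← HV.weakPartial_eq, h]

lemma gradInner_embV (v w : HV) :
    gradInner (embV v) (embV w) = inner ℝ v w - inner ℝ (embV v) (embV w) := by
  unfold gradInner
  simp only [HV.weakPartial_eq]
  rw [Submodule.coe_inner, PiLp.inner_apply, Fin.sum_univ_succ (n := 3)]
  simp only [embV_apply]
  ring

/-! ### Green's formula on the ball without traces -/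

/-- The squared distance to the origin, as a polynomial. -/
def R2 : Poly := X 0 ^ 2 + X 1 ^ 2 + X 2 ^ 2

@[simp] lemma pev_R2 (x : E3) : pev R2 x = ‖x‖ ^ 2 := by simp [R2, norm_sq_eq]

/-- A smooth step function: `0` on `(-∞, 1]` and `1` on `[2, ∞)`. -/
def stepFn (t : ℝ) : ℝ := Real.smoothTransition (t - 1)

lemma contDiff_stepFn : ContDiff ℝ ∞ stepFn :=
  (Real.smoothTransition.contDiff (n := ⊤)).comp (contDiff_id.sub contDiff_const)

lemma stepFn_of_le {t : ℝ} (h : t ≤ 1) : stepFn t = 0 :=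
  Real.smoothTransition.zero_of_nonpos (by linarith)

lemma stepFn_of_ge {t : ℝ} (h : 2 ≤ t) : stepFn t = 1 :=
  Real.smoothTransition.one_of_one_le (by linarith)

lemma abs_stepFn_le (t : ℝ) : |stepFn t| ≤ 1 := by
  rw [stepFn, abs_of_nonneg (Real.smoothTransition.nonneg _)]
  exact Real.smoothTransition.le_one _

lemma deriv_stepFn_of_gt {t : ℝ} (h : 2 < t) : deriv stepFn t = 0 := by
  have : stepFn =ᶠ[nhds t] fun _ => 1 := by
    filter_upwards [lt_mem_nhds h] with s hs using stepFn_of_ge hs.le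
  rw [this.deriv_eq, deriv_const]

lemma exists_bound_mul_deriv_stepFn : ∃ K : ℝ, 0 ≤ K ∧ ∀ t, 0 ≤ t → |t * deriv stepFn t| ≤ K := by
  have hc : Continuous fun t => t * deriv stepFn t :=
    continuous_id.mul (contDiff_stepFn.continuous_deriv (by simp))
  obtain ⟨K, hK⟩ := (isCompact_Icc (a := (0 : ℝ)) (b := 2)).exists_bound_of_continuousOn
    hc.continuousOn
  refine ⟨|K|, abs_nonneg _, fun t ht => ?_⟩
  rcases le_or_gt t 2 with h | h
  · exact (hK t ⟨ht, h⟩).trans (le_abs_self K)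
  · simp [deriv_stepFn_of_gt h]

/-- The radial cutoff functions exhausting the unit ball. -/
def cutoff (n : ℕ) (x : E3) : ℝ := stepFn ((n + 1) * (1 - ‖x‖ ^ 2))

lemma cutoff_eq (n : ℕ) : cutoff n = stepFn ∘ pev (C ((n : ℝ) + 1) * (1 - R2)) := by
  ext x; simp [cutoff]

lemma contDiff_cutoff (n : ℕ) : ContDiff ℝ ∞ (cutoff n) := by
  rw [cutoff_eq]; exact contDiff_stepFn.comp (contDiff_pev _)

lemma isTestFunction_cutoff_mul (n : ℕ) (p : Poly) :
    IsTestFunction (fun x => cutoff n x * pev p x) := by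
  have hsub : tsupport (fun x => cutoff n x * pev p x) ⊆
      {x | (n + 1) * (1 - ‖x‖ ^ 2) ≥ 1} := by
    refine closure_minimal (fun x hx => ?_)
      (isClosed_le continuous_const (by fun_prop))
    by_contra h
    simp only [ge_iff_le, Set.mem_ofPred_eq, not_le] at h
    exact hx (by simp [cutoff, stepFn_of_le h.le])
  have hball : {x : E3 | (n + 1) * (1 - ‖x‖ ^ 2) ≥ 1} ⊆ Metric.ball 0 1 := by
    intro x hx
    simp only [Set.mem_ofPred_eq] at hx
    rw [mem_ball_zero_iff]
    by_contra h
    have : 1 - ‖x‖ ^ 2 ≤ 0 := by nlinarith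
    have : ((n : ℝ) + 1) * (1 - ‖x‖ ^ 2) ≤ 0 := mul_nonpos_of_nonneg_of_nonpos (by positivity) this
    linarith
  refine ⟨(contDiff_cutoff n).mul (contDiff_pev p), ?_, hsub.trans hball⟩
  exact HasCompactSupport.of_support_subset_isCompact (isCompact_closedBall (0 : E3) 1)
    ((subset_tsupport _).trans ((hsub.trans hball).trans Metric.ball_subset_closedBall))

lemma fderiv_cutoff_mul (n : ℕ) (p : Poly) (j : Fin 3) (x : E3) :
    fderiv ℝ (fun x => cutoff n x * pev p x) x (EuclideanSpace.single j 1)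
      = cutoff n x * pev (pderiv j p) x
        - 2 * ((n + 1) * deriv stepFn ((n + 1) * (1 - ‖x‖ ^ 2))) * pev (X j * p) x := by
  have hd (q : Poly) : DifferentiableAt ℝ (pev q) x :=
    ((contDiff_pev q).differentiable (by simp)).differentiableAt
  have hc : DifferentiableAt ℝ (cutoff n) x :=
    ((contDiff_cutoff n).differentiable (by simp)).differentiableAt
  have hs : DifferentiableAt ℝ stepFn (pev (C ((n : ℝ) + 1) * (1 - R2)) x) :=
    (contDiff_stepFn.differentiable (by simp)).differentiableAt
  have e : fderiv ℝ (cutoff n) x (EuclideanSpace.single j 1)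
      = - 2 * ((n + 1) * deriv stepFn ((n + 1) * (1 - ‖x‖ ^ 2))) * x j := by
    rw [cutoff_eq, fderiv_comp x hs (hd _), ContinuousLinearMap.comp_apply, fderiv_pev,
      fderiv_eq_smul_deriv]
    have : pderiv j (R2 : Poly) = 2 * X j := by
      fin_cases j <;> simp [R2, MvPolynomial.pderiv_X]
    simp [this]
    ring
  rw [show (fun x => cutoff n x * pev p x) = cutoff n * pev p from rfl, fderiv_mul hc (hd p)]
  simp only [add_apply, smul_apply, smul_eq_mul, e, fderiv_pev, pev_mul, pev_X]
  ring

/-- The flux of a polynomial field through the unit sphere vanishes if its normal component is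
divisible by `1 - |x|²`: then integration by parts against an `H¹` field has no boundary term.
The cutoff contributes `t ↦ t θ'(t)` at `t = n (1 - |x|²)`, which stays bounded and tends to `0`
pointwise, so no trace theorem is needed. -/
theorem green_of_flux_eq_zero {u : L2Field} {g : Fin 3 → L2Field}
    (h : ∀ j, IsWeakPartial j u (g j)) (F : Fin 3 → VP) (k : VP)
    (hF : ∑ j, (X j : Poly) • F j = (1 - R2) • k) :
    ∑ j, inner ℝ (fld (F j)) (g j) + inner ℝ (fld (∑ j, dv j (F j))) u = 0 := by
  obtain ⟨K, hK0, hK⟩ := exists_bound_mul_deriv_stepFn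
  have main : ∀ i, ∫ x, (pev (∑ j, pderiv j (F j i)) x * u x i
      + ∑ j, pev (F j i) x * g j x i) ∂ballMeasure = 0 := by
    intro i
    let t : ℕ → E3 → ℝ := fun n x => (n + 1) * (1 - ‖x‖ ^ 2)
    let D : Poly := ∑ j, pderiv j (F j i)
    let Φ : ℕ → E3 → ℝ := fun n x =>
      (cutoff n x * pev D x - 2 * (t n x * deriv stepFn (t n x)) * pev (k i) x) * u x i
        + ∑ j, cutoff n x * pev (F j i) x * g j x i
    have hcont (n : ℕ) : Continuous (cutoff n) := (contDiff_cutoff n).continuous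
    have hds : Continuous (deriv stepFn) := contDiff_stepFn.continuous_deriv (by simp)
    have htc (n : ℕ) : Continuous (t n) := by fun_prop
    have hΦ0 (n : ℕ) : ∫ x, Φ n x ∂ballMeasure = 0 := by
      have h1 (j : Fin 3) := (isWeakPartial_iff j u (g j)).1 (h j) _
        (isTestFunction_cutoff_mul n (F j i)) i
      simp_rw [fderiv_cutoff_mul] at h1
      have hk (x : E3) : ∑ j, pev (X j * F j i) x = (1 - ‖x‖ ^ 2) * pev (k i) x := by
        have := congrArg (fun P : VP => pev (P i) x) hF
        simpa [Finset.sum_apply] using this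
      have e (x : E3) : Φ n x = ∑ j, ((cutoff n x * pev (pderiv j (F j i)) x
          - 2 * ((n + 1) * deriv stepFn ((n + 1) * (1 - ‖x‖ ^ 2))) * pev (X j * F j i) x) * u x i
          + cutoff n x * pev (F j i) x * g j x i) := by
        rw [Finset.sum_add_distrib, ← Finset.sum_mul, Finset.sum_sub_distrib, ← Finset.mul_sum,
          ← Finset.mul_sum, hk]
        simp only [Φ, t, D, pev_sum]
        ring
      have i1 (j : Fin 3) : Integrable (fun x => (cutoff n x * pev (pderiv j (F j i)) x
          - 2 * ((n + 1) * deriv stepFn ((n + 1) * (1 - ‖x‖ ^ 2))) * pev (X j * F j i) x)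
          * u x i) ballMeasure := integrable_mul_comp (by fun_prop) u i
      have i2 (j : Fin 3) : Integrable (fun x => cutoff n x * pev (F j i) x * g j x i)
          ballMeasure := integrable_mul_comp (by fun_prop) (g j) i
      simp_rw [e]
      refine (integral_finsetSum _ fun j _ => (i1 j).add (i2 j)).trans
        (Finset.sum_eq_zero fun j _ => ?_)
      refine (integral_add (i1 j) (i2 j)).trans ?_
      rw [h1 j, neg_add_cancel]
    have hbase (p : Poly) (v : L2Field) : Integrable (fun x => |pev p x| * |v x i|) ballMeasure := by
      simpa [abs_mul] using (integrable_mul_comp (continuous_pev p) v i).abs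
    have hlim := tendsto_integral_of_dominated_convergence (μ := ballMeasure) (F := Φ)
      (f := fun x => pev D x * u x i + ∑ j, pev (F j i) x * g j x i)
      (fun x => (|pev D x| * |u x i| + 2 * K * (|pev (k i) x| * |u x i|))
        + ∑ j, |pev (F j i) x| * |g j x i|)
      (fun n => by
        refine Integrable.aestronglyMeasurable (Integrable.add ?_ ?_)
        · exact integrable_mul_comp (by fun_prop) u i
        · exact integrable_finsetSum _ fun j _ => integrable_mul_comp (by fun_prop) (g j) i)
      (by
        refine ((hbase D u).add ((hbase (k i) u).const_mul _)).add ?_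
        exact integrable_finsetSum _ fun j _ => hbase _ _)
      (fun n => by
        filter_upwards [ae_norm_lt_one] with x hx
        have ht : 0 ≤ t n x := mul_nonneg (by positivity) (by nlinarith [norm_nonneg x])
        have hc : |cutoff n x| ≤ 1 := abs_stepFn_le _
        have hb := hK _ ht
        refine (norm_add_le _ _).trans (add_le_add ?_ ((norm_sum_le _ _).trans
          (Finset.sum_le_sum fun j _ => ?_)))
        · rw [Real.norm_eq_abs, abs_mul]
          have : |cutoff n x * pev D x - 2 * (t n x * deriv stepFn (t n x)) * pev (k i) x|
              ≤ |pev D x| + 2 * K * |pev (k i) x| := by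
            refine (abs_sub _ _).trans (add_le_add ?_ ?_)
            · rw [abs_mul]; exact mul_le_of_le_one_left (abs_nonneg _) hc
            · rw [abs_mul, abs_mul, abs_two]; gcongr
          calc _ ≤ (|pev D x| + 2 * K * |pev (k i) x|) * |u x i| := by gcongr
            _ = _ := by ring
        · rw [Real.norm_eq_abs, abs_mul, abs_mul]
          gcongr
          exact mul_le_of_le_one_left (abs_nonneg _) hc)
      (by
        filter_upwards [ae_norm_lt_one] with x hx
        have hpos : 0 < 1 - ‖x‖ ^ 2 := by nlinarith [norm_nonneg x]
        have htend : Filter.Tendsto (fun n => t n x) Filter.atTop Filter.atTop := by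
          refine Filter.Tendsto.atTop_mul_const hpos ?_
          exact Filter.tendsto_atTop_add_const_right _ _ tendsto_natCast_atTop_atTop
        refine tendsto_const_nhds.congr' ?_
        filter_upwards [htend.eventually_gt_atTop 2] with n hn
        have h1 : cutoff n x = 1 := stepFn_of_ge hn.le
        have h2 : deriv stepFn (t n x) = 0 := deriv_stepFn_of_gt hn
        simp only [Φ, h1, h2]
        ring_nf)
    simp_rw [hΦ0] at hlim
    exact (tendsto_nhds_unique hlim tendsto_const_nhds)
  have key : ∀ i, ∑ j, ∫ x, pev (F j i) x * g j x i ∂ballMeasure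
      + ∫ x, pev (∑ j, pderiv j (F j i)) x * u x i ∂ballMeasure = 0 := by
    intro i
    rw [← main i, integral_add (integrable_mul_comp (continuous_pev _) u i)
      (integrable_finsetSum _ fun j _ => integrable_mul_comp (continuous_pev _) (g j) i),
      integral_finsetSum _ fun j _ => integrable_mul_comp (continuous_pev _) (g j) i, add_comm]
  simp_rw [inner_fld_sum]
  rw [Finset.sum_comm, ← Finset.sum_add_distrib]
  refine Finset.sum_eq_zero fun i _ => ?_
  rw [← key i]
  simp [Finset.sum_apply]

/-- The componentwise Laplacian. -/
def lap (P : VP) : VP := ∑ j, dv j (dv j P)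

/-- The Euler operator `x · ∇`, acting componentwise. -/
def eul (P : VP) : VP := ∑ j, (X j : Poly) • dv j P

/-- The gradient of a polynomial. -/
def pgrad (p : Poly) : VP := fun i => pderiv i p

/-- The position field. -/
def xvec : VP := fun i => X i

lemma lap_add (P Q : VP) : lap (P + Q) = lap P + lap Q := by
  simp [lap, Finset.sum_add_distrib]

lemma lap_smul (a : ℝ) (P : VP) : lap (a • P) = a • lap P := by
  simp [lap, Finset.smul_sum]

lemma eul_add (P Q : VP) : eul (P + Q) = eul P + eul Q := by
  simp [eul, Finset.sum_add_distrib]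

lemma eul_smul (a : ℝ) (P : VP) : eul (a • P) = a • eul P := by
  simp only [eul, map_smul, Finset.smul_sum]
  exact Finset.sum_congr rfl fun j _ => smul_comm _ _ _

/-- The boundary functional `P ↦ ∫_{∂Ω} P · u` of an `H¹` field `u`, defined through the divergence
theorem from volume integrals of `u` and its gradient. -/
def tr (w : Jet) : VP →ₗ[ℝ] ℝ where
  toFun P := ∑ j, inner ℝ (fld ((X j : Poly) • P)) (w j.succ)
    + inner ℝ (fld (∑ j, dv j ((X j : Poly) • P))) (w 0)
  map_add' P Q := by
    simp only [smul_add, map_add, inner_add_left, Finset.sum_add_distrib]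
    ring
  map_smul' a P := by
    have h (j : Fin 3) : (X j : Poly) • a • P = a • (X j : Poly) • P := smul_comm _ _ _
    simp only [h, LinearMap.map_smul fld, LinearMap.map_smul (dv _), ← Finset.smul_sum,
      inner_smul_left, RingHom.id_apply, smul_eq_mul, ← Finset.mul_sum, conj_trivial]
    ring

lemma R2_eq_sum : R2 = ∑ j, (X j : Poly) * X j := by
  rw [R2, Fin.sum_univ_three]; ring

theorem green {w : Jet} (hw : ∀ j : Fin 3, IsWeakPartial j (w 0) (w j.succ)) (F : Fin 3 → VP) :
    ∑ j, inner ℝ (fld (F j)) (w j.succ) + inner ℝ (fld (∑ j, dv j (F j))) (w 0)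
      = tr w (∑ j, (X j : Poly) • F j) := by
  set Q : VP := ∑ j, (X j : Poly) • F j with hQ
  have h := green_of_flux_eq_zero hw (fun j => F j - (X j : Poly) • Q) Q (by
    simp only [smul_sub, Finset.sum_sub_distrib, ← hQ, sub_smul, one_smul, smul_smul,
      ← Finset.sum_smul, R2_eq_sum])
  simp only [map_sub, inner_sub_left, Finset.sum_sub_distrib] at h
  have e : tr w Q = ∑ j, inner ℝ (fld ((X j : Poly) • Q)) (w j.succ)
    + inner ℝ (fld (∑ j, dv j ((X j : Poly) • Q))) (w 0) := rfl
  rw [e]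
  linear_combination h

lemma tr_R2_smul {w : Jet} (hw : ∀ j : Fin 3, IsWeakPartial j (w 0) (w j.succ)) (P : VP) :
    tr w (R2 • P) = tr w P := by
  have h := green_of_flux_eq_zero hw (fun j => (X j : Poly) • ((1 - R2) • P)) (R2 • P) (by
    simp only [smul_smul, ← Finset.sum_smul, R2_eq_sum]
    congr 1
    rw [mul_comm (1 - _), Finset.sum_mul]
    exact Finset.sum_congr rfl fun _ _ => by ring)
  change tr w ((1 - R2) • P) = 0 at h
  rw [sub_smul, one_smul, map_sub, sub_eq_zero] at h
  exact h.symm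

lemma tr_R2_pow_smul {w : Jet} (hw : ∀ j : Fin 3, IsWeakPartial j (w 0) (w j.succ)) (k : ℕ)
    (P : VP) : tr w (R2 ^ k • P) = tr w P := by
  induction k with
  | zero => simp
  | succ k ih => rw [pow_succ', mul_smul, tr_R2_smul hw, ih]

/-- `⟨∇P, ∇u⟩ = -⟨ΔP, u⟩ + ∫_{∂Ω} ∂_r P · u`. -/
lemma sum_inner_dv {w : Jet} (hw : ∀ j : Fin 3, IsWeakPartial j (w 0) (w j.succ)) (P : VP) :
    ∑ j, inner ℝ (fld (dv j P)) (w j.succ) = tr w (eul P) - inner ℝ (fld (lap P)) (w 0) := by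
  have := green hw fun j => dv j P
  rw [lap, eul]
  linarith

/-- For divergence-free `u`, `⟨∇π, u⟩ = ∫_{∂Ω} π x · u`. -/
lemma inner_pgrad {w : Jet} (hw : ∀ j : Fin 3, IsWeakPartial j (w 0) (w j.succ))
    (hd : jetDiv w = 0) (p : Poly) :
    inner ℝ (fld (pgrad p)) (w 0) = tr w (p • xvec) := by
  have h := green hw fun j => Pi.single j p
  have h1 : ∑ j, inner ℝ (fld (Pi.single j p)) (w j.succ) = 0 := by
    simp_rw [inner_fld_single]
    rw [← integral_finsetSum _ fun j _ => integrable_mul_comp (continuous_pev p) _ j]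
    refine integral_eq_zero_of_ae ?_
    filter_upwards [(jetDiv_eq_zero_iff w).1 hd] with x hx
    rw [← Finset.mul_sum, hx]; simp
  have h2 : ∑ j, dv j (Pi.single j p : VP) = pgrad p := by
    ext1 i
    rw [Finset.sum_apply, Finset.sum_eq_single i]
    · simp [pgrad]
    · intro j _ hj; simp [hj.symm]
    · simp
  have h3 : ∑ j, (X j : Poly) • (Pi.single j p : VP) = p • xvec := by
    ext1 i
    rw [Finset.sum_apply, Finset.sum_eq_single i]
    · simp [xvec, mul_comm]
    · intro j _ hj; simp [hj.symm]
    · simp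
  rw [h1, h2, h3, zero_add] at h
  exact h

/-- The jet of a polynomial vector field. -/
def jet : VP →ₗ[ℝ] Jet where
  toFun P := WithLp.toLp 2 (Fin.cons (fld P) fun j => fld (dv j P))
  map_add' P Q := by
    refine PiLp.ext fun i => ?_
    refine Fin.cases ?_ (fun j => ?_) i <;> simp
  map_smul' a P := by
    refine PiLp.ext fun i => ?_
    refine Fin.cases ?_ (fun j => ?_) i <;> simp

@[simp] lemma jet_zero_apply (P : VP) : jet P 0 = fld P := rfl
@[simp] lemma jet_succ_apply (P : VP) (j : Fin 3) : jet P j.succ = fld (dv j P) := rfl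

lemma isWeakPartial_jet (P : VP) (j : Fin 3) : IsWeakPartial j (jet P 0) (jet P j.succ) :=
  isWeakPartial_fld j P

/-- A divergence-free axisymmetric polynomial field is admissible. -/
lemma jet_mem_HV {P : VP} (hd : ∑ i, pderiv i (P i) = 0)
    (ha : ∀ t x, vev P (rotZ t x) = rotZ t (vev P x)) : jet P ∈ HV := by
  refine ⟨isWeakPartial_jet P, ?_, fun t => ?_⟩
  · rw [jetDiv_eq_zero_iff]
    have h (j : Fin 3) := fld_ae (dv j P)
    filter_upwards [h 0, h 1, h 2] with x h0 h1 h2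
    have := congrArg (fun p => pev p x) hd
    simp only [Fin.sum_univ_three, pev_add, pev_zero] at this
    rw [Fin.sum_univ_three, jet_succ_apply, jet_succ_apply, jet_succ_apply, h0, h1, h2]
    simpa using this
  · have h1 := fld_ae P
    have h2 := (measurePreserving_rotE t).quasiMeasurePreserving.ae_eq_comp h1
    filter_upwards [h1, h2] with x k1 k2
    rw [jet_zero_apply, k1, ← ha]
    exact k2

/-! ### Integrals of polynomials over the ball -/

/-- The integral of a polynomial over the unit ball. -/
def pint : Poly →ₗ[ℝ] ℝ where
  toFun p := ∫ x, pev p x ∂ballMeasure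
  map_add' p q := by
    have h (p : Poly) : Integrable (pev p) ballMeasure :=
      (memLp_of_continuous (continuous_pev p) 1).integrable le_rfl
    simpa using integral_add (h p) (h q)
  map_smul' a p := by simp [integral_const_mul]

lemma inner_fld_fld (P Q : VP) : inner ℝ (fld P) (fld Q) = pint (∑ i, P i * Q i) := by
  rw [inner_fld]
  refine integral_congr_ae ?_
  filter_upwards [fld_ae Q] with x hx
  simp [hx]

/-- The integral of a polynomial over the unit sphere, obtained from the divergence theorem. -/
def sint (p : Poly) : ℝ := tr (jet (Pi.single 2 1)) (Pi.single 2 p)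

lemma sint_R2_pow_mul (k : ℕ) (p : Poly) : sint (R2 ^ k * p) = sint p := by
  refine Eq.trans ?_ (tr_R2_pow_smul (isWeakPartial_jet _) k _)
  rw [sint]
  congr 1
  ext1 i
  by_cases h : i = 2
  · subst h; simp
  · simp [h]

lemma pint_div (F : VP) : pint (∑ j, pderiv j (F j)) = sint (∑ j, X j * F j) := by
  have h := green (isWeakPartial_jet (Pi.single 2 1)) fun j => Pi.single 2 (F j)
  have hz (j : Fin 3) : dv j (Pi.single 2 1 : VP) = 0 := by
    ext1 i
    by_cases h : i = 2
    · subst h; simp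
    · simp [h]
  have h2 : ∑ j, dv j (Pi.single 2 (F j) : VP) = Pi.single 2 (∑ j, pderiv j (F j) : Poly) := by
    ext1 i
    by_cases h : i = 2
    · subst h; simp
    · simp [h]
  have h3 : ∑ j, (X j : Poly) • (Pi.single 2 (F j) : VP) = Pi.single 2 (∑ j, X j * F j) := by
    ext1 i
    by_cases h : i = 2
    · subst h; simp
    · simp [h]
  rw [h2, h3] at h
  simp only [jet_succ_apply, hz, map_zero, inner_zero_right, Finset.sum_const_zero, zero_add,
    jet_zero_apply, inner_fld_fld] at h
  rw [sint, ← h]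
  refine congrArg pint ?_
  rw [Fin.sum_univ_three (fun i => (Pi.single 2 _ : VP) i * (Pi.single 2 1 : VP) i)]
  simp

/-- The Euler operator on scalar polynomials. -/
def peul (p : Poly) : Poly := ∑ j, X j * pderiv j p

/-- For a homogeneous polynomial of degree `d`, ball and sphere integrals differ by `d + 3`. -/
lemma sint_of_peul {p : Poly} {d : ℝ} (h : peul p = d • p) : sint p = (3 + d) * pint p := by
  have h1 := pint_div fun j => X j * p
  have h2 : ∑ j, (X j : Poly) * (X j * p) = R2 ^ 1 * p := by
    rw [R2_eq_sum, pow_one, Finset.sum_mul]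
    exact Finset.sum_congr rfl fun _ _ => by ring
  have h3 : ∑ j, pderiv j (X j * p) = (3 + d) • p := by
    rw [add_smul, ← h, peul, Fin.sum_univ_three, Fin.sum_univ_three, MvPolynomial.smul_eq_C_mul,
      show (C (3 : ℝ) : Poly) = 3 from rfl]
    simp [Derivation.leibniz]
    ring
  rw [h2, sint_R2_pow_mul, h3, map_smul] at h1
  simpa using h1.symm

/-! ### Density of polynomials -/

/-- An integrable function on the ball all of whose polynomial moments vanish is zero. -/
lemma ae_eq_zero_of_moments {f : E3 → ℝ} (hf : Integrable f ballMeasure)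
    (h : ∀ p : Poly, ∫ x, pev p x * f x ∂ballMeasure = 0) : f =ᵐ[ballMeasure] 0 := by
  have key : ∀ φ : E3 → ℝ, Continuous φ → ∫ x, φ x * f x ∂ballMeasure = 0 := by
    intro φ hφ
    let K := Metric.closedBall (0 : E3) 1
    have : CompactSpace K := isCompact_iff_compactSpace.1 (isCompact_closedBall _ _)
    let co : Fin 3 → C(K, ℝ) := fun i => ⟨fun x => (x : E3) i, by fun_prop⟩
    let A : Subalgebra ℝ C(K, ℝ) := (MvPolynomial.aeval co).range
    have hA : A.SeparatesPoints := by
      intro x y hxy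
      by_contra hcon
      push Not at hcon
      refine hxy (Subtype.ext (PiLp.ext fun i => ?_))
      exact hcon (co i) ⟨co i, ⟨X i, by simp⟩, rfl⟩
    have hev (p : Poly) (x : K) : MvPolynomial.aeval co p x = pev p x := by
      induction p using MvPolynomial.induction_on with
      | C a => simp
      | add p q hp hq => simp [hp, hq]
      | mul_X p n hp => simp [hp, co]
    refine abs_eq_zero.1 (le_antisymm (le_of_forall_pos_le_add fun ε hε => ?_) (abs_nonneg _))
    set I := ∫ x, |f x| ∂ballMeasure
    have hI : 0 ≤ I := integral_nonneg fun _ => abs_nonneg _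
    obtain ⟨⟨g, hg⟩, hgφ⟩ := ContinuousMap.exists_mem_subalgebra_near_continuous_of_separatesPoints
      A hA (fun x : K => φ x) (by fun_prop) (ε / (I + 1)) (by positivity)
    obtain ⟨p, hp⟩ := hg
    have hb : ∀ᵐ x ∂ballMeasure, |φ x - pev p x| ≤ ε / (I + 1) := by
      filter_upwards [ae_mem_ball] with x hx
      have h1 : ‖g ⟨x, Metric.ball_subset_closedBall hx⟩ - φ x‖ < ε / (I + 1) :=
        hgφ ⟨x, Metric.ball_subset_closedBall hx⟩
      have h2 : g ⟨x, Metric.ball_subset_closedBall hx⟩ = pev p x := by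
        rw [← hp]; exact hev p _
      rw [h2, Real.norm_eq_abs, abs_sub_comm] at h1
      exact h1.le
    have hint (ψ : E3 → ℝ) (hψ : Continuous ψ) : Integrable (fun x => ψ x * f x) ballMeasure := by
      obtain ⟨M, -, hM⟩ := exists_bound_ball hψ
      exact hf.bdd_mul hψ.aestronglyMeasurable hM
    have e : ∫ x, φ x * f x ∂ballMeasure = ∫ x, (φ x - pev p x) * f x ∂ballMeasure := by
      have := integral_sub (hint φ hφ) (hint (pev p) (continuous_pev p))
      rw [h p, sub_zero] at this
      simp_rw [sub_mul]
      exact this.symm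
    rw [e, zero_add]
    calc |∫ x, (φ x - pev p x) * f x ∂ballMeasure|
        ≤ ∫ x, |(φ x - pev p x) * f x| ∂ballMeasure :=
          norm_integral_le_integral_norm fun x => (φ x - pev p x) * f x
      _ ≤ ∫ x, ε / (I + 1) * |f x| ∂ballMeasure := by
          refine integral_mono_ae (hint _ (by fun_prop)).abs (hf.abs.const_mul _) ?_
          filter_upwards [hb] with x hx
          rw [abs_mul]
          exact mul_le_mul_of_nonneg_right hx (abs_nonneg _)
      _ = ε / (I + 1) * I := by rw [integral_const_mul]
      _ ≤ ε := by
          rw [div_mul_eq_mul_div, div_le_iff₀ (by positivity)]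
          nlinarith
  have := IsOpen.ae_eq_zero_of_integral_contDiff_smul_eq_zero (f := f)
    (μ := ballMeasure) (U := Metric.ball (0 : E3) 1) Metric.isOpen_ball
    (hf.locallyIntegrable.locallyIntegrableOn _) (fun φ h1 _ _ => key φ h1.continuous)
  filter_upwards [this, ae_mem_ball] with x hx hb using hx hb

/-- `L²` fields orthogonal to all polynomial fields vanish. -/
lemma eq_zero_of_inner_fld {u : L2Field} (h : ∀ P : VP, inner ℝ (fld P) u = 0) : u = 0 := by
  rw [Lp.eq_zero_iff_ae_eq_zero]
  have h1 (i : Fin 3) : (fun x => u x i) =ᵐ[ballMeasure] 0 :=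
    ae_eq_zero_of_moments (integrable_comp u i) fun p => by rw [← inner_fld_single, h]
  filter_upwards [h1 0, h1 1, h1 2] with x k0 k1 k2
  exact E3_ext k0 k1 k2

/-- An axisymmetric integrable function is determined by its moments against the invariant
polynomials `z ^ j (|x|²) ^ k`: the moment against `(x + iy) ^ a (x - iy) ^ b z ^ c` picks up the
phase `exp (i (a - b) t)` under rotation, so that it vanishes unless `a = b`. -/
lemma ae_eq_zero_of_axisymmetric {f : E3 → ℝ} (hf : Integrable f ballMeasure)
    (hrot : ∀ t, ∀ᵐ x ∂ballMeasure, f (rotZ t x) = f x)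
    (h : ∀ j k : ℕ, ∫ x, (x 2) ^ j * (‖x‖ ^ 2) ^ k * f x ∂ballMeasure = 0) :
    f =ᵐ[ballMeasure] 0 := by
  have hintR (ψ : E3 → ℝ) (hψ : Continuous ψ) : Integrable (fun x => ψ x * f x) ballMeasure := by
    obtain ⟨M, -, hM⟩ := exists_bound_ball hψ
    exact hf.bdd_mul hψ.aestronglyMeasurable hM
  have hfC : Integrable (fun x => (f x : ℂ)) ballMeasure := hf.ofReal
  have hint (ψ : E3 → ℂ) (hψ : Continuous ψ) :
      Integrable (fun x => ψ x * (f x : ℂ)) ballMeasure := by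
    obtain ⟨M, -, hM⟩ := exists_bound_ball hψ
    exact hfC.bdd_mul hψ.aestronglyMeasurable hM
  have hdiag : ∀ a c k : ℕ,
      ∫ x, (x 0 ^ 2 + x 1 ^ 2) ^ a * (x 2) ^ c * (‖x‖ ^ 2) ^ k * f x ∂ballMeasure = 0 := by
    intro a
    induction a with
    | zero => intro c k; simpa using h c k
    | succ a ih =>
      intro c k
      have e (x : E3) : (x 0 ^ 2 + x 1 ^ 2) ^ (a + 1) * (x 2) ^ c * (‖x‖ ^ 2) ^ k * f x
          = (x 0 ^ 2 + x 1 ^ 2) ^ a * (x 2) ^ c * (‖x‖ ^ 2) ^ (k + 1) * f x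
            - (x 0 ^ 2 + x 1 ^ 2) ^ a * (x 2) ^ (c + 2) * (‖x‖ ^ 2) ^ k * f x := by
        rw [norm_sq_eq]; ring
      simp_rw [e]
      rw [integral_sub (hintR _ (by fun_prop)) (hintR _ (by fun_prop)), ih, ih, sub_zero]
  let W : E3 → ℂ := fun x => x 0 + Complex.I * x 1
  let W' : E3 → ℂ := fun x => x 0 - Complex.I * x 1
  have hW : Continuous W := by fun_prop
  have hW' : Continuous W' := by fun_prop
  have hWrot (t : ℝ) (x : E3) : W (rotZ t x) = Complex.exp (Complex.I * t) * W x := by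
    simp only [W, rotZ_zero_apply, rotZ_one_apply, mul_comm Complex.I (t : ℂ), Complex.exp_mul_I]
    push_cast
    linear_combination (-(Complex.sin t * x 1)) * Complex.I_mul_I
  have hW'rot (t : ℝ) (x : E3) : W' (rotZ t x) = Complex.exp (-(Complex.I * t)) * W' x := by
    have : -(Complex.I * t) = (-t : ℂ) * Complex.I := by ring
    simp only [W', rotZ_zero_apply, rotZ_one_apply, this, Complex.exp_mul_I, Complex.cos_neg,
      Complex.sin_neg]
    push_cast
    linear_combination (-(Complex.sin t * x 1)) * Complex.I_mul_I
  have hmono : ∀ a b c : ℕ,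
      ∫ x, (W x ^ a * W' x ^ b * (x 2 : ℂ) ^ c) * (f x : ℂ) ∂ballMeasure = 0 := by
    intro a b c
    by_cases hab : a = b
    · subst hab
      have e (x : E3) : (W x ^ a * W' x ^ a * (x 2 : ℂ) ^ c) * (f x : ℂ)
          = (((x 0 ^ 2 + x 1 ^ 2) ^ a * (x 2) ^ c * (‖x‖ ^ 2) ^ 0 * f x : ℝ) : ℂ) := by
        rw [← mul_pow]
        have : W x * W' x = ((x 0 ^ 2 + x 1 ^ 2 : ℝ) : ℂ) := by
          simp only [W, W']; push_cast
          linear_combination (-(x 1 : ℂ) ^ 2) * Complex.I_mul_I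
        rw [this]; push_cast; ring
      simp_rw [e]
      rw [integral_complex_ofReal, hdiag, Complex.ofReal_zero]
    · set t : ℝ := Real.pi / ((a : ℝ) - b)
      have hne : (a : ℂ) - b ≠ 0 := sub_ne_zero.2 (by exact_mod_cast hab)
      set J := ∫ x, (W x ^ a * W' x ^ b * (x 2 : ℂ) ^ c) * (f x : ℂ) ∂ballMeasure with hJ
      have h1 := (measurePreserving_rotE t).integral_comp
        (rotE t).toHomeomorph.measurableEmbedding
        (fun x => (W x ^ a * W' x ^ b * (x 2 : ℂ) ^ c) * (f x : ℂ))
      have h2 : ∫ x, (W (rotE t x) ^ a * W' (rotE t x) ^ b * (rotE t x 2 : ℂ) ^ c)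
          * (f (rotE t x) : ℂ) ∂ballMeasure = -J := by
        rw [hJ, ← integral_neg]
        refine integral_congr_ae ?_
        filter_upwards [hrot t] with x hx
        rw [rotE_apply, hx, hWrot, hW'rot, rotZ_two_apply, mul_pow, mul_pow]
        have : Complex.exp (Complex.I * t) ^ a * Complex.exp (-(Complex.I * t)) ^ b = -1 := by
          rw [← Complex.exp_nat_mul, ← Complex.exp_nat_mul, ← Complex.exp_add,
            ← Complex.exp_pi_mul_I]
          congr 1
          simp only [t]; push_cast
          field_simp
          ring
        linear_combination (W x ^ a * W' x ^ b * (x 2 : ℂ) ^ c * (f x : ℂ)) * this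
      rw [h2] at h1
      have : J + J = 0 := by rw [← hJ] at h1; linear_combination -h1
      exact add_self_eq_zero.1 this
  have hall : ∀ p : Poly, ∀ a b c : ℕ,
      ∫ x, (W x ^ a * W' x ^ b * (x 2 : ℂ) ^ c * (pev p x : ℂ)) * (f x : ℂ) ∂ballMeasure = 0 := by
    intro p
    induction p using MvPolynomial.induction_on with
    | C r =>
      intro a b c
      have e (x : E3) : (W x ^ a * W' x ^ b * (x 2 : ℂ) ^ c * (pev (C r) x : ℂ)) * (f x : ℂ)
          = (r : ℂ) * ((W x ^ a * W' x ^ b * (x 2 : ℂ) ^ c) * (f x : ℂ)) := by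
        rw [pev_C]; ring
      simp_rw [e]
      rw [integral_const_mul, hmono, mul_zero]
    | add p q hp hq =>
      intro a b c
      have e (x : E3) : (W x ^ a * W' x ^ b * (x 2 : ℂ) ^ c * (pev (p + q) x : ℂ)) * (f x : ℂ)
          = (W x ^ a * W' x ^ b * (x 2 : ℂ) ^ c * (pev p x : ℂ)) * (f x : ℂ)
            + (W x ^ a * W' x ^ b * (x 2 : ℂ) ^ c * (pev q x : ℂ)) * (f x : ℂ) := by
        rw [pev_add]; push_cast; ring
      simp_rw [e]
      rw [integral_add (hint _ (by fun_prop)) (hint _ (by fun_prop)), hp, hq, add_zero]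
    | mul_X p n hp =>
      intro a b c
      have e0 (x : E3) : (x 0 : ℂ) = 1 / 2 * W x + 1 / 2 * W' x := by simp only [W, W']; ring
      have e1 (x : E3) : (x 1 : ℂ) = (-Complex.I / 2) * W x + (Complex.I / 2) * W' x := by
        simp only [W, W']
        linear_combination (x 1 : ℂ) * Complex.I_mul_I
      have hlin (s s' : ℂ) (hs : ∀ x : E3, (x n : ℂ) = s * W x + s' * W' x) :
          ∫ x, (W x ^ a * W' x ^ b * (x 2 : ℂ) ^ c * (pev (p * X n) x : ℂ)) * (f x : ℂ)
            ∂ballMeasure = 0 := by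
        have e (x : E3) : (W x ^ a * W' x ^ b * (x 2 : ℂ) ^ c * (pev (p * X n) x : ℂ)) * (f x : ℂ)
            = s * ((W x ^ (a + 1) * W' x ^ b * (x 2 : ℂ) ^ c * (pev p x : ℂ)) * (f x : ℂ))
              + s' * ((W x ^ a * W' x ^ (b + 1) * (x 2 : ℂ) ^ c * (pev p x : ℂ)) * (f x : ℂ)) := by
          rw [pev_mul, pev_X, Complex.ofReal_mul, hs]; ring
        simp_rw [e]
        rw [integral_add ((hint _ (by fun_prop)).const_mul _) ((hint _ (by fun_prop)).const_mul _),
          integral_const_mul, integral_const_mul, hp, hp, mul_zero, mul_zero, add_zero]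
      fin_cases n
      · exact hlin _ _ e0
      · exact hlin _ _ e1
      · have e (x : E3) : (W x ^ a * W' x ^ b * (x 2 : ℂ) ^ c * (pev (p * X 2) x : ℂ)) * (f x : ℂ)
            = (W x ^ a * W' x ^ b * (x 2 : ℂ) ^ (c + 1) * (pev p x : ℂ)) * (f x : ℂ) := by
          rw [pev_mul, pev_X, Complex.ofReal_mul]; ring
        exact (integral_congr_ae (Filter.Eventually.of_forall e)).trans (hp _ _ _)
  refine ae_eq_zero_of_moments hf fun p => ?_
  have := hall p 0 0 0
  have e (x : E3) : (W x ^ 0 * W' x ^ 0 * (x 2 : ℂ) ^ 0 * (pev p x : ℂ)) * (f x : ℂ)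
      = ((pev p x * f x : ℝ) : ℂ) := by push_cast; ring
  simp_rw [e] at this
  rw [integral_complex_ofReal] at this
  exact_mod_cast this

/-! ### Compactness of the embedding into `L²` -/

/-- The operator `Δ - (x·∇)² - 3 x·∇ = div ((1 - x ⊗ x) ∇)`, whose flux through the unit sphere
vanishes identically. Its eigenfunctions on the ball are the orthogonal polynomials. -/
def ballOp : VP →ₗ[ℝ] VP where
  toFun P := lap P - eul (eul P) - (3 : ℝ) • eul P
  map_add' P Q := by
    simp only [lap_add, eul_add, smul_add]; abel
  map_smul' a P := by
    simp only [lap_smul, eul_smul, smul_sub, RingHom.id_apply]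
    rw [smul_comm a (3 : ℝ)]

lemma ballOp_apply (P : VP) : ballOp P = lap P - eul (eul P) - (3 : ℝ) • eul P := rfl

lemma eul_apply (P : VP) (i : Fin 3) : eul P i = peul (P i) := by
  simp [eul, peul, Finset.sum_apply]

lemma sum_inner_ballOp {w : Jet} (hw : ∀ j : Fin 3, IsWeakPartial j (w 0) (w j.succ)) (P : VP) :
    ∑ j, inner ℝ (fld (dv j P - (X j : Poly) • eul P)) (w j.succ)
      = - inner ℝ (fld (ballOp P)) (w 0) := by
  have h := green_of_flux_eq_zero hw (fun j => dv j P - (X j : Poly) • eul P) (eul P) (by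
    simp only [smul_sub, Finset.sum_sub_distrib, sub_smul, one_smul, smul_smul,
      ← Finset.sum_smul, R2_eq_sum]
    rfl)
  have e : ∑ j, dv j (dv j P - (X j : Poly) • eul P) = ballOp P := by
    simp only [map_sub, Finset.sum_sub_distrib, dv_smul, Finset.sum_add_distrib]
    have hE : eul (eul P) = ∑ j, (X j : Poly) • dv j (eul P) := rfl
    rw [ballOp_apply, lap, hE, Fin.sum_univ_three (fun j => pderiv j (X j) • eul P)]
    simp only [MvPolynomial.pderiv_X_self, one_smul]
    module
  rw [e] at h
  linarith

/-- The Dirichlet form of `ballOp` on polynomials, as an integrand. -/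
def ballForm (P Q : VP) : Poly :=
  ∑ i, (∑ j, pderiv j (P i) * pderiv j (Q i) - peul (P i) * peul (Q i))

lemma inner_ballOp_fld (P Q : VP) :
    inner ℝ (fld (ballOp P)) (fld Q) = - pint (ballForm P Q) := by
  have h := sum_inner_ballOp (isWeakPartial_jet Q) P
  simp only [jet_succ_apply, jet_zero_apply, inner_fld_fld (dv _ _ - _)] at h
  rw [← neg_eq_iff_eq_neg, ← h, ← map_sum]
  congr 1
  simp only [ballForm, Fin.sum_univ_three, Pi.sub_apply, Pi.smul_apply, dv_apply, eul_apply,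
    smul_eq_mul, peul]
  ring

lemma inner_ballOp_comm (P Q : VP) :
    inner ℝ (fld (ballOp P)) (fld Q) = inner ℝ (fld P) (fld (ballOp Q)) := by
  have h : ballForm P Q = ballForm Q P := by
    unfold ballForm
    exact Finset.sum_congr rfl fun i _ => by simp only [mul_comm]
  rw [real_inner_comm _ (fld P), inner_ballOp_fld, inner_ballOp_fld, h]

lemma sum_norm_sq_le_ballForm (P : VP) :
    ∑ j, ‖fld (dv j P - (X j : Poly) • eul P)‖ ^ 2 ≤ - inner ℝ (fld (ballOp P)) (fld P) := by
  simp only [← real_inner_self_eq_norm_sq]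
  rw [inner_ballOp_fld, neg_neg]
  simp only [inner_fld_fld]
  rw [← map_sum, ← sub_nonneg, ← map_sub]
  have e : ballForm P P - ∑ j, ∑ i, (dv j P - (X j : Poly) • eul P) i
      * (dv j P - (X j : Poly) • eul P) i = (1 - R2) * ∑ i, peul (P i) ^ 2 := by
    simp only [ballForm, Fin.sum_univ_three, Pi.sub_apply, Pi.smul_apply, dv_apply, eul_apply,
      smul_eq_mul, peul, R2]
    ring
  rw [e]
  refine integral_nonneg_of_ae ?_
  filter_upwards [ae_norm_lt_one] with x hx
  simp only [pev_mul, pev_sub, pev_one, pev_R2, pev_sum, pev_pow, Pi.zero_apply]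
  have : 0 ≤ 1 - ‖x‖ ^ 2 := by nlinarith [norm_nonneg x]
  positivity

/-- Polynomial vector fields of degree at most `N`. -/
def Vd (N : ℕ) : Submodule ℝ VP :=
  Submodule.pi Set.univ fun _ => MvPolynomial.restrictTotalDegree (Fin 3) ℝ N

lemma mem_Vd {N : ℕ} {P : VP} :
    P ∈ Vd N ↔ ∀ i m, N < m.degree → MvPolynomial.coeff m (P i) = 0 := by
  simp only [Vd, Submodule.mem_pi, Set.mem_univ, true_implies,
    MvPolynomial.mem_restrictTotalDegree]
  refine forall_congr' fun i => ⟨fun h m hm => ?_, fun h => ?_⟩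
  · exact MvPolynomial.coeff_eq_zero_of_totalDegree_lt (by
      rw [← Finsupp.degree_apply] ; omega)
  · refine Finset.sup_le fun m hm => ?_
    by_contra hc
    exact MvPolynomial.mem_support_iff.1 hm (h m (by
      rw [Finsupp.degree_apply]; simpa [Finsupp.sum] using hc))

lemma Vd_mono {M N : ℕ} (h : M ≤ N) : Vd M ≤ Vd N := fun _ hP =>
  mem_Vd.2 fun i m hm => mem_Vd.1 hP i m (by omega)

lemma exists_mem_Vd (P : VP) : ∃ N, P ∈ Vd N := by
  refine ⟨∑ i, (P i).totalDegree, ?_⟩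
  simp only [Vd, Submodule.mem_pi, Set.mem_univ, true_implies,
    MvPolynomial.mem_restrictTotalDegree]
  exact fun i => Finset.single_le_sum (f := fun i => (P i).totalDegree)
    (fun _ _ => Nat.zero_le _) (Finset.mem_univ i)

lemma coeff_peul (p : Poly) (m : Fin 3 →₀ ℕ) :
    MvPolynomial.coeff m (peul p) = m.degree * MvPolynomial.coeff m p := by
  induction p using MvPolynomial.induction_on' with
  | monomial k a =>
    simp only [peul, MvPolynomial.X_mul_pderiv_monomial, MvPolynomial.coeff_sum,
      MvPolynomial.coeff_smul, MvPolynomial.coeff_monomial]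
    split_ifs with h
    · subst h
      rw [Finsupp.degree_eq_sum, Fin.sum_univ_three, Fin.sum_univ_three]
      push_cast; simp; ring
    · simp
  | add p q hp hq =>
    have : peul (p + q) = peul p + peul q := by
      simp [peul, mul_add, Finset.sum_add_distrib]
    rw [this, MvPolynomial.coeff_add, hp, hq, MvPolynomial.coeff_add]; ring

lemma coeff_ballOp (P : VP) (i : Fin 3) (m : Fin 3 →₀ ℕ) :
    MvPolynomial.coeff m (ballOp P i) = MvPolynomial.coeff m (lap P i)
      - m.degree * (m.degree + 3) * MvPolynomial.coeff m (P i) := by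
  simp only [ballOp_apply, Pi.sub_apply, Pi.smul_apply, MvPolynomial.coeff_sub,
    MvPolynomial.coeff_smul, eul_apply, coeff_peul, smul_eq_mul]
  ring

lemma coeff_lap_eq_zero {N : ℕ} {P : VP} (hP : P ∈ Vd (N + 1)) (i : Fin 3) (m : Fin 3 →₀ ℕ)
    (hm : N < m.degree) : MvPolynomial.coeff m (lap P i) = 0 := by
  rw [lap, Finset.sum_apply, MvPolynomial.coeff_sum]
  refine Finset.sum_eq_zero fun j _ => ?_
  rw [dv_apply, dv_apply, MvPolynomial.coeff_pderiv, MvPolynomial.coeff_pderiv,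
    mem_Vd.1 hP, zero_mul, zero_mul]
  simp only [map_add, Finsupp.degree_single]
  omega

lemma ballOp_add_mem {N : ℕ} {P : VP} (hP : P ∈ Vd (N + 1)) :
    ballOp P + (((N : ℝ) + 1) * (N + 4)) • P ∈ Vd N := by
  refine mem_Vd.2 fun i m hm => ?_
  rw [Pi.add_apply, Pi.smul_apply, MvPolynomial.coeff_add, MvPolynomial.coeff_smul, coeff_ballOp,
    coeff_lap_eq_zero hP i m hm, smul_eq_mul]
  rcases Nat.lt_or_ge (N + 1) m.degree with h | h
  · rw [mem_Vd.1 hP i m h]; ring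
  · have : m.degree = N + 1 := by omega
    rw [this]; push_cast; ring

lemma ballOp_mem {N : ℕ} {P : VP} (hP : P ∈ Vd N) : ballOp P ∈ Vd N := by
  refine mem_Vd.2 fun i m hm => ?_
  rw [coeff_ballOp, mem_Vd.1 hP i m hm,
    coeff_lap_eq_zero (Vd_mono (Nat.le_succ N) hP) i m hm]
  ring

/-- The space of polynomial fields of degree at most `N` inside `L²`. -/
def Wd (N : ℕ) : Submodule ℝ L2Field := (Vd N).map fld

instance (N : ℕ) : FiniteDimensional ℝ (Vd N) := by
  have : Module.Finite ℝ (∀ _ : Fin 3, MvPolynomial.restrictTotalDegree (Fin 3) ℝ N) :=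
    inferInstance
  refine Module.Finite.of_injective (M := Vd N)
    (N := ∀ _ : Fin 3, MvPolynomial.restrictTotalDegree (Fin 3) ℝ N)
    (LinearMap.pi fun i => ((LinearMap.proj i).comp (Vd N).subtype).codRestrict _ fun P =>
      P.2 i (Set.mem_univ i)) ?_
  intro P Q h
  refine Subtype.ext (funext fun i => ?_)
  exact congrArg (fun f => ((f i : MvPolynomial.restrictTotalDegree (Fin 3) ℝ N) : Poly)) h

instance (N : ℕ) : FiniteDimensional ℝ (Wd N) := by unfold Wd; infer_instance

lemma fld_mem_Wd {N : ℕ} {P : VP} (hP : P ∈ Vd N) : fld P ∈ Wd N := ⟨P, hP, rfl⟩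

lemma proj_Wd_eq (N : ℕ) (u : L2Field) :
    ∃ P ∈ Vd N, (Wd N).starProjection u = fld P := by
  obtain ⟨P, hP, h⟩ : (Wd N).starProjection u ∈ Wd N := Submodule.starProjection_apply_mem _ _
  exact ⟨P, hP, h.symm⟩

/-- The quadratic form of `-ballOp` is at least `(N + 1) (N + 4)` on the polynomials orthogonal to
those of degree at most `N`, since `ballOp` acts as `-n (n + 3)` on the orthogonal polynomials of
degree `n`. -/
lemma le_inner_ballOp (N M : ℕ) (hNM : N ≤ M) : ∀ P ∈ Vd M,
    (∀ Q ∈ Vd N, inner ℝ (fld P) (fld Q) = 0) →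
      (((N : ℝ) + 1) * (N + 4)) * ‖fld P‖ ^ 2 ≤ - inner ℝ (fld (ballOp P)) (fld P) := by
  induction M, hNM using Nat.le_induction with
  | base =>
    intro P hP h
    have h0 : fld P = 0 := inner_self_eq_zero.1 (h P hP)
    simp [h0]
  | succ M hNM ih =>
    intro P hP h
    obtain ⟨P', hP', hproj⟩ := proj_Wd_eq M (fld P)
    obtain ⟨d, rfl⟩ : ∃ d, P = P' + d := ⟨P - P', by abel⟩
    have hd : d ∈ Vd (M + 1) := by
      have := Submodule.sub_mem _ hP (Vd_mono (Nat.le_succ M) hP')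
      simpa using this
    have hdo : ∀ Q ∈ Vd M, inner ℝ (fld d) (fld Q) = 0 := by
      intro Q hQ
      have := Submodule.starProjection_inner_eq_zero (fld (P' + d)) (fld Q) (fld_mem_Wd hQ)
      rwa [hproj, map_add, add_sub_cancel_left] at this
    set lam : ℝ := ((M : ℝ) + 1) * (M + 4) with hlam
    have he : fld (ballOp d) = -(lam • fld d) := by
      have hm := ballOp_add_mem hd
      have h1 : fld (ballOp d + lam • d) = 0 := by
        rw [← inner_self_eq_zero (𝕜 := ℝ)]
        nth_rewrite 1 [map_add]
        rw [inner_add_left, inner_ballOp_comm, hdo _ (ballOp_mem hm), map_smul, inner_smul_left,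
          hdo _ hm, mul_zero, add_zero]
      rw [map_add, map_smul] at h1
      exact eq_neg_of_add_eq_zero_left h1
    have hP'o : ∀ Q ∈ Vd N, inner ℝ (fld P') (fld Q) = 0 := by
      intro Q hQ
      have := h Q hQ
      rwa [map_add, inner_add_left, hdo Q (Vd_mono hNM hQ), add_zero] at this
    have h1 := ih P' hP' hP'o
    have h2 : inner ℝ (fld P') (fld d) = 0 := by rw [real_inner_comm]; exact hdo _ hP'
    have h3 : inner ℝ (fld (ballOp P')) (fld d) = 0 := by
      rw [real_inner_comm]; exact hdo _ (ballOp_mem hP')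
    have h4 : ‖fld (P' + d)‖ ^ 2 = ‖fld P'‖ ^ 2 + ‖fld d‖ ^ 2 := by
      rw [map_add, norm_add_sq_real, h2]; ring
    have h5 : inner ℝ (fld (ballOp (P' + d))) (fld (P' + d))
        = inner ℝ (fld (ballOp P')) (fld P') - lam * ‖fld d‖ ^ 2 := by
      rw [map_add, map_add, map_add, inner_add_left, inner_add_right, inner_add_right, h3, he,
        inner_neg_left, inner_neg_left, inner_smul_left, inner_smul_left, hdo _ hP',
        real_inner_self_eq_norm_sq]
      simp
      ring
    rw [h4, h5]
    have h6 : ((N : ℝ) + 1) * (N + 4) ≤ lam := by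
      have : (N : ℝ) ≤ M := by exact_mod_cast hNM
      rw [hlam]; gcongr
    nlinarith [sq_nonneg ‖fld d‖]

lemma exists_fld_near (u : L2Field) {ε : ℝ} (hε : 0 < ε) : ∃ P : VP, ‖u - fld P‖ < ε := by
  have h : (LinearMap.range fld)ᗮ = ⊥ := by
    rw [Submodule.eq_bot_iff]
    intro u hu
    exact eq_zero_of_inner_fld fun P => (Submodule.mem_orthogonal _ _).1 hu _ ⟨P, rfl⟩
  rw [← Submodule.topologicalClosure_eq_top_iff] at h
  have hu : u ∈ (LinearMap.range fld).topologicalClosure := h ▸ Submodule.mem_top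
  obtain ⟨v, ⟨P, rfl⟩, hv⟩ := Metric.mem_closure_iff.1 hu ε hε
  exact ⟨P, by rwa [dist_eq_norm] at hv⟩

/-- A Poincaré inequality: the distance of an `H¹` field to the polynomials of degree `N` is
controlled by its gradient, with a constant tending to zero. -/
theorem norm_sub_proj_sq_le {w : Jet} (hw : ∀ j : Fin 3, IsWeakPartial j (w 0) (w j.succ))
    (N : ℕ) : (((N : ℝ) + 1) * (N + 4)) * ‖w 0 - (Wd N).starProjection (w 0)‖ ^ 2
      ≤ ∑ j : Fin 3, ‖w j.succ‖ ^ 2 := by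
  set c : ℝ := ((N : ℝ) + 1) * (N + 4) with hc
  have hc0 : 0 < c := by positivity
  set G : ℝ := ∑ j : Fin 3, ‖w j.succ‖ ^ 2
  have hG : 0 ≤ G := Finset.sum_nonneg fun _ _ => sq_nonneg _
  obtain ⟨Q, hQ, hQe⟩ := proj_Wd_eq N (w 0)
  -- the bound for the part of degree at most `M`
  have hM : ∀ M, N ≤ M →
      c * ‖(Wd M).starProjection (w 0) - (Wd N).starProjection (w 0)‖ ^ 2 ≤ G := by
    intro M hNM
    obtain ⟨R, hR, hRe⟩ := proj_Wd_eq M (w 0)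
    set P := R - Q with hPdef
    have hP : P ∈ Vd M := Submodule.sub_mem _ hR (Vd_mono hNM hQ)
    have hPo : ∀ S ∈ Vd N, inner ℝ (fld P) (fld S) = 0 := by
      intro S hS
      have h1 := Submodule.starProjection_inner_eq_zero (K := Wd N) (w 0) (fld S) (fld_mem_Wd hS)
      have h2 := Submodule.starProjection_inner_eq_zero (K := Wd M) (w 0) (fld S)
        (fld_mem_Wd (Vd_mono hNM hS))
      rw [hQe, inner_sub_left] at h1
      rw [hRe, inner_sub_left] at h2
      rw [hPdef, map_sub, inner_sub_left]
      linarith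
    have hlow := le_inner_ballOp N M hNM P hP hPo
    have h1 : inner ℝ (fld (ballOp P)) (w 0) = inner ℝ (fld (ballOp P)) (fld P) := by
      have h2 := Submodule.starProjection_inner_eq_zero (K := Wd M) (w 0) (fld (ballOp P))
        (fld_mem_Wd (ballOp_mem hP))
      have h3 : inner ℝ (fld (ballOp P)) (fld Q) = 0 := by
        rw [inner_ballOp_comm]; exact hPo _ (ballOp_mem hQ)
      rw [hRe, inner_sub_left, real_inner_comm, real_inner_comm _ (fld R)] at h2
      rw [hPdef, map_sub fld R Q, inner_sub_right, ← hPdef, h3]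
      linarith
    have h2 := sum_inner_ballOp hw P
    have h3 := sum_norm_sq_le_ballForm P
    rw [h1] at h2
    set a := - inner ℝ (fld (ballOp P)) (fld P) with ha
    have h4 : a ≤ ∑ j : Fin 3, ‖fld (dv j P - (X j : Poly) • eul P)‖ * ‖w j.succ‖ := by
      rw [← h2]
      exact Finset.sum_le_sum fun j _ => real_inner_le_norm _ _
    have h5 := Finset.sum_mul_sq_le_sq_mul_sq Finset.univ
      (fun j => ‖fld (dv j P - (X j : Poly) • eul P)‖) (fun j : Fin 3 => ‖w j.succ‖)
    have ha0 : 0 ≤ a := le_trans (Finset.sum_nonneg fun _ _ => sq_nonneg _) h3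
    have h6 : a ≤ G := by
      have : a ^ 2 ≤ a * G := by
        calc a ^ 2 ≤ _ := pow_le_pow_left₀ ha0 h4 2
          _ ≤ _ := h5
          _ ≤ a * G := by gcongr
      by_contra hcon
      push Not at hcon
      nlinarith
    rw [hRe, hQe, ← map_sub]
    linarith
  -- polynomials are dense
  have hfin : ∀ ε : ℝ, 0 < ε → ‖w 0 - (Wd N).starProjection (w 0)‖ ≤ ε + Real.sqrt (G / c) := by
    intro ε hε
    obtain ⟨P, hP⟩ := exists_fld_near (w 0) hε
    obtain ⟨M', hM'⟩ := exists_mem_Vd P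
    set M := max N M'
    have h1 : ‖w 0 - (Wd M).starProjection (w 0)‖ ≤ ‖w 0 - fld P‖ := by
      rw [Submodule.starProjection_minimal]
      exact ciInf_le ⟨0, by rintro _ ⟨_, rfl⟩; exact norm_nonneg _⟩
        (⟨fld P, fld_mem_Wd (Vd_mono (le_max_right _ _) hM')⟩ : Wd M)
    have h2 : ‖(Wd M).starProjection (w 0) - (Wd N).starProjection (w 0)‖ ≤ Real.sqrt (G / c) := by
      refine Real.le_sqrt_of_sq_le ?_
      rw [le_div_iff₀ hc0]
      linarith [hM M (le_max_left _ _)]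
    calc _ = ‖(w 0 - (Wd M).starProjection (w 0))
          + ((Wd M).starProjection (w 0) - (Wd N).starProjection (w 0))‖ := by congr 1; abel
      _ ≤ _ := norm_add_le _ _
      _ ≤ _ := by linarith
  have hle : ‖w 0 - (Wd N).starProjection (w 0)‖ ≤ Real.sqrt (G / c) :=
    le_of_forall_pos_le_add fun ε hε => by linarith [hfin ε hε]
  have := pow_le_pow_left₀ (norm_nonneg _) hle 2
  rw [Real.sq_sqrt (by positivity), le_div_iff₀ hc0] at this
  linarith

/-- The embedding of `V` with its `H¹` norm into `L²` is compact. -/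
theorem isCompactOperator_embV : IsCompactOperator embV := by
  let F : ℕ → HV →L[ℝ] L2Field := fun N => (Wd N).starProjection.comp embV
  have hF (N : ℕ) : IsCompactOperator (F N) := by
    have h1 : IsCompactOperator ((Wd N).orthogonalProjectionOnto.comp embV) :=
      have := FiniteDimensional.proper_real (Wd N)
      isCompactOperator_of_locallyCompactSpace_dom _
    exact h1.clm_comp (Wd N).subtypeL
  suffices h : Filter.Tendsto (fun N => ‖F N - embV‖) Filter.atTop (nhds 0) from
    isCompactOperator_of_tendsto (F := F) (l := Filter.atTop)
      (tendsto_iff_norm_sub_tendsto_zero (E := HV →L[ℝ] L2Field).2 h)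
      (Filter.Eventually.of_forall hF)
  refine squeeze_zero (g := fun N : ℕ => 1 / ((N : ℝ) + 1)) (fun N => (F N - embV).opNorm_nonneg) (fun N => ?_)
    tendsto_one_div_add_atTop_nhds_zero_nat
  refine ContinuousLinearMap.opNorm_le_bound _ (by positivity) fun w => ?_
  have h := norm_sub_proj_sq_le w.2.1 N
  have h2 : ∑ j : Fin 3, ‖(w : Jet) j.succ‖ ^ 2 ≤ ‖w‖ ^ 2 := by
    rw [Submodule.coe_norm, PiLp.norm_sq_eq_of_L2, Fin.sum_univ_succ (n := 3)]
    linarith [sq_nonneg ‖(w : Jet) 0‖]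
  have e : ‖(F N - embV) w‖ = ‖(w : Jet) 0 - (Wd N).starProjection ((w : Jet) 0)‖ := by
    rw [norm_sub_rev]; rfl
  rw [e]
  refine abs_le_of_sq_le_sq' ?_ (by positivity) |>.2
  rw [mul_pow, div_pow, one_pow, div_mul_eq_mul_div, one_mul, le_div_iff₀ (by positivity)]
  have h3 : ((N : ℝ) + 1) ^ 2 ≤ ((N : ℝ) + 1) * (N + 4) := by
    rw [sq]; gcongr; norm_num
  nlinarith [sq_nonneg ‖(w : Jet) 0 - (Wd N).starProjection ((w : Jet) 0)‖]

/-! ### Coefficients of the Legendre polynomials -/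

lemma coeff_X_sq_sub_one_pow_rec (l n : ℕ) :
    ((n : ℝ) + 2) * ((Polynomial.X ^ 2 - 1 : Polynomial ℝ) ^ l).coeff (n + 2)
      = (n - 2 * l) * ((Polynomial.X ^ 2 - 1 : Polynomial ℝ) ^ l).coeff n := by
  set w : Polynomial ℝ := (Polynomial.X ^ 2 - 1) ^ l with hw
  have hode : Polynomial.X ^ 2 * Polynomial.derivative w - Polynomial.derivative w
      = Polynomial.C (2 * (l : ℝ)) * (Polynomial.X * w) := by
    rcases l with _ | l
    · simp [hw]
    · rw [hw, Polynomial.derivative_pow]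
      simp only [Nat.cast_add, Nat.cast_one, map_add, map_mul, map_natCast, map_one, map_ofNat,
        Nat.add_sub_cancel, Polynomial.derivative_sub, Polynomial.derivative_X_pow,
        Polynomial.derivative_one]
      push_cast
      ring
  have h := congrArg (fun p => Polynomial.coeff p (n + 1)) hode
  simp only [Polynomial.coeff_sub, Polynomial.coeff_C_mul, Polynomial.coeff_X_mul,
    Polynomial.coeff_derivative] at h
  have h2 : (Polynomial.X ^ 2 * Polynomial.derivative w).coeff (n + 1) = n * w.coeff n := by
    rcases n with _ | n
    · rw [Polynomial.coeff_X_pow_mul']; simp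
    · rw [show n + 1 + 1 = n + 2 from rfl, Polynomial.coeff_X_pow_mul, Polynomial.coeff_derivative]
      push_cast; ring
  rw [h2] at h
  push_cast at h
  linear_combination -h

lemma coeff_X_sq_sub_one_pow_odd (l i : ℕ) :
    ((Polynomial.X ^ 2 - 1 : Polynomial ℝ) ^ l).coeff (2 * i + 1) = 0 := by
  induction i with
  | zero =>
    have : (Polynomial.X ^ 2 - 1 : Polynomial ℝ) ^ l
        = Polynomial.expand ℝ 2 ((Polynomial.X - 1) ^ l) := by simp
    rw [this, Polynomial.coeff_expand (by norm_num)]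
    simp
  | succ i ih =>
    have h := coeff_X_sq_sub_one_pow_rec l (2 * i + 1)
    rw [ih, mul_zero] at h
    have : (((2 * i + 1 : ℕ) : ℝ) + 2) ≠ 0 := by positivity
    exact (mul_eq_zero.1 h).resolve_left this

/-- The coefficients of the Legendre polynomials. -/
def legc (l j : ℕ) : ℝ := (legendreP l).coeff j

lemma legc_eq (l j : ℕ) : legc l j = 1 / ((2 : ℝ) ^ l * l.factorial) *
    ((j + l).descFactorial l * ((Polynomial.X ^ 2 - 1 : Polynomial ℝ) ^ l).coeff (j + l)) := by
  rw [legc, legendreP, Polynomial.coeff_C_mul, Polynomial.coeff_iterate_derivative, nsmul_eq_mul]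

/-- Legendre's differential equation in terms of coefficients. -/
lemma legc_rec (l j : ℕ) : ((j : ℝ) + 2) * (j + 1) * legc l (j + 2)
    = -(((l : ℝ) - j) * (l + j + 1)) * legc l j := by
  have h := coeff_X_sq_sub_one_pow_rec l (j + l)
  have h2 : ((j : ℝ) + 2) * (j + 1) * ((j + 2 + l).descFactorial l)
      = (j + l + 2) * (j + l + 1) * ((j + l).descFactorial l) := by
    have e1 := Nat.factorial_mul_descFactorial (n := j + 2 + l) (k := l) (by omega)
    have e2 := Nat.factorial_mul_descFactorial (n := j + l) (k := l) (by omega)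
    rw [show j + 2 + l - l = j + 2 by omega, show j + 2 + l = (j + l) + 2 by omega,
      Nat.factorial_succ, Nat.factorial_succ, Nat.factorial_succ, Nat.factorial_succ] at e1
    rw [show j + l - l = j by omega] at e2
    rw [← e2] at e1
    have hj : (j.factorial : ℝ) ≠ 0 := by exact_mod_cast j.factorial_ne_zero
    apply mul_left_cancel₀ hj
    have e3 := congrArg (fun n : ℕ => (n : ℝ)) e1
    push_cast at e3
    rw [show j + 2 + l = (j + l) + 2 by omega]
    linear_combination e3
  rw [legc_eq, legc_eq, show j + 2 + l = (j + l) + 2 by omega]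
  rw [show j + 2 + l = (j + l) + 2 by omega] at h2
  push_cast at h
  set c := 1 / ((2 : ℝ) ^ l * l.factorial)
  set b2 := ((Polynomial.X ^ 2 - 1 : Polynomial ℝ) ^ l).coeff (j + l + 2)
  linear_combination c * b2 * h2 + c * (j + l + 1) * ((j + l).descFactorial l) * h

lemma legc_odd {l j : ℕ} (h : Odd (j + l)) : legc l j = 0 := by
  obtain ⟨i, hi⟩ := h
  rw [legc_eq, hi, coeff_X_sq_sub_one_pow_odd]; ring

lemma monic_X_sq_sub_one_pow (l : ℕ) :
    ((Polynomial.X ^ 2 - 1 : Polynomial ℝ) ^ l).Monic :=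
  (Polynomial.monic_X_pow_sub_C (1 : ℝ) (n := 2) (by norm_num)).pow l

lemma natDegree_X_sq_sub_one_pow (l : ℕ) :
    ((Polynomial.X ^ 2 - 1 : Polynomial ℝ) ^ l).natDegree = 2 * l := by
  rw [Polynomial.natDegree_pow,
    show (Polynomial.X ^ 2 - 1 : Polynomial ℝ) = Polynomial.X ^ 2 - Polynomial.C 1 by simp,
    Polynomial.natDegree_X_pow_sub_C, mul_comm]

lemma legc_of_lt {l j : ℕ} (h : l < j) : legc l j = 0 := by
  rw [legc_eq, Polynomial.coeff_eq_zero_of_natDegree_lt (by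
    rw [natDegree_X_sq_sub_one_pow]; omega)]; ring

lemma legc_self_pos (l : ℕ) : 0 < legc l l := by
  have h := (monic_X_sq_sub_one_pow l).coeff_natDegree
  rw [natDegree_X_sq_sub_one_pow, two_mul] at h
  rw [legc_eq, h]
  have : 0 < (l + l).descFactorial l := Nat.descFactorial_pos.2 (by omega)
  positivity

lemma legendreP_eval (l : ℕ) (t : ℝ) :
    (legendreP l).eval t = ∑ j ∈ Finset.range (l + 1), legc l j * t ^ j := by
  refine Polynomial.eval_eq_sum_range' (Nat.lt_succ_of_le ?_) t
  rw [Polynomial.natDegree_le_iff_coeff_eq_zero]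
  exact fun j hj => legc_of_lt hj

lemma legendreP_derivative_eval (l : ℕ) (t : ℝ) : (Polynomial.derivative (legendreP l)).eval t
    = ∑ j ∈ Finset.range (l + 1), j * legc l j * t ^ (j - 1) := by
  have h : (legendreP l).natDegree < l + 1 := by
    refine Nat.lt_succ_of_le ?_
    rw [Polynomial.natDegree_le_iff_coeff_eq_zero]
    exact fun j hj => legc_of_lt hj
  rw [Polynomial.derivative_eval, Polynomial.sum_over_range' _ (by simp) _ h]
  exact Finset.sum_congr rfl fun j _ => by rw [legc]; ring

/-! ### Differential operators on scalar polynomials -/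

@[simp] lemma pderiv_ofNat (j : Fin 3) (n : ℕ) [n.AtLeastTwo] :
    pderiv j (ofNat(n) : Poly) = 0 := by
  rw [← map_ofNat (C : ℝ →+* Poly) n, MvPolynomial.pderiv_C]

/-- The Laplacian of a polynomial. -/
def plap (p : Poly) : Poly := ∑ j, pderiv j (pderiv j p)

lemma lap_apply (P : VP) (i : Fin 3) : lap P i = plap (P i) := by
  simp [lap, plap, Finset.sum_apply]

lemma plap_C_mul (a : ℝ) (q : Poly) : plap (C a * q) = C a * plap q := by
  simp [plap, Finset.mul_sum]

lemma peul_add (p q : Poly) : peul (p + q) = peul p + peul q := by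
  simp [peul, mul_add, Finset.sum_add_distrib]

lemma peul_mul (p q : Poly) : peul (p * q) = peul p * q + p * peul q := by
  simp only [peul, Derivation.leibniz, smul_eq_mul, Fin.sum_univ_three]; ring

lemma peul_C (a : ℝ) : peul (C a) = 0 := by simp [peul]

lemma peul_natCast (n : ℕ) : peul (n : Poly) = 0 := by simp [peul]

lemma peul_X (i : Fin 3) : peul (X i) = X i := by
  fin_cases i <;> simp [peul, Fin.sum_univ_three, MvPolynomial.pderiv_X]

lemma pderiv_R2 (i : Fin 3) : pderiv i R2 = 2 * X i := by
  fin_cases i <;> simp [R2, MvPolynomial.pderiv_X]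

lemma peul_R2 : peul R2 = 2 * R2 := by
  rw [peul]
  simp only [pderiv_R2, Fin.sum_univ_three]
  rw [R2]; ring

lemma peul_pow_of {p d : Poly} (h : peul p = d * p) (k : ℕ) : peul (p ^ k) = k * d * p ^ k := by
  induction k with
  | zero => simp [peul]
  | succ k ih => rw [pow_succ, peul_mul, ih, h]; push_cast; ring

lemma peul_R2_pow_mul {q d : Poly} (h : peul q = d * q) (k : ℕ) :
    peul (R2 ^ k * q) = (2 * k + d) * (R2 ^ k * q) := by
  rw [peul_mul, peul_pow_of peul_R2, h]; ring

lemma peul_pderiv (i : Fin 3) (p : Poly) : peul (pderiv i p) = pderiv i (peul p) - pderiv i p := by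
  simp only [peul, map_sum, Derivation.leibniz, smul_eq_mul, Finset.sum_add_distrib,
    pderiv_pderiv_comm i]
  have : ∑ j, pderiv j p * pderiv i (X j) = pderiv i p := by
    rw [Finset.sum_eq_single i]
    · simp
    · intro j _ hj; simp [MvPolynomial.pderiv_X, hj]
    · simp
  rw [this]; ring

lemma plap_pderiv (i : Fin 3) (p : Poly) : plap (pderiv i p) = pderiv i (plap p) := by
  simp only [plap, map_sum, pderiv_pderiv_comm i]

lemma plap_mul (p q : Poly) :
    plap (p * q) = plap p * q + 2 * (∑ j, pderiv j p * pderiv j q) + p * plap q := by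
  simp only [plap, Fin.sum_univ_three, Derivation.leibniz, smul_eq_mul, map_add]; ring

lemma pderiv_R2_pow_succ (i : Fin 3) (k : ℕ) :
    pderiv i (R2 ^ (k + 1)) = 2 * ((k : Poly) + 1) * R2 ^ k * X i := by
  rw [Derivation.leibniz_pow, pderiv_R2]
  simp only [Nat.add_sub_cancel, smul_eq_mul, nsmul_eq_mul]
  push_cast
  ring

lemma plap_R2_pow_succ (k : ℕ) :
    plap (R2 ^ (k + 1)) = 2 * ((k : Poly) + 1) * (2 * (k + 1) + 1) * R2 ^ k := by
  have h (j : Fin 3) : pderiv j (pderiv j (R2 ^ (k + 1)))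
      = 2 * ((k : Poly) + 1) * (R2 ^ k + X j * pderiv j (R2 ^ k)) := by
    rw [pderiv_R2_pow_succ]
    have : pderiv j (2 * ((k : Poly) + 1)) = 0 := by simp
    rw [mul_assoc (2 * _), Derivation.leibniz, this, Derivation.leibniz]
    simp
  have h2 : ∑ j, X j * pderiv j (R2 ^ k) = 2 * (k : Poly) * R2 ^ k := by
    have := peul_pow_of peul_R2 k
    rw [peul] at this; rw [this]; ring
  rw [plap]
  simp only [h]
  rw [← Finset.mul_sum, Finset.sum_add_distrib, h2]
  simp
  ring

lemma plap_R2_pow_succ_mul {q d : Poly} (h : peul q = d * q) (k : ℕ) :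
    plap (R2 ^ (k + 1) * q)
      = 2 * ((k : Poly) + 1) * (2 * (k + 1) + 1 + 2 * d) * (R2 ^ k * q) + R2 ^ (k + 1) * plap q := by
  have h2 : ∑ j, pderiv j (R2 ^ (k + 1)) * pderiv j q = 2 * ((k : Poly) + 1) * R2 ^ k * peul q := by
    simp only [pderiv_R2_pow_succ, peul, Finset.mul_sum]
    exact Finset.sum_congr rfl fun _ _ => by ring
  rw [plap_mul, plap_R2_pow_succ, h2, h]; ring

/-! ### Zonal solid harmonics -/

/-- The solid harmonic `r ^ l P_l (cos θ)` as a polynomial in `z` and `r²`. -/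
def harm (l : ℕ) : Poly :=
  ∑ j ∈ Finset.range (l + 1), C (legc l j) * (R2 ^ ((l - j) / 2) * X 2 ^ j)

/-- The polynomial `r ^ (l - 1) P_l' (cos θ)`, which is the derivative of `harm l` in `z` at
constant `r²`. -/
def harmZ (l : ℕ) : Poly :=
  ∑ j ∈ Finset.range (l + 1), C (j * legc l j) * (R2 ^ ((l - j) / 2) * X 2 ^ (j - 1))

/-- Twice the derivative of `harm l` in `r²` at constant `z`. -/
def harmR (l : ℕ) : Poly :=
  ∑ j ∈ Finset.range (l + 1), C (((l : ℝ) - j) * legc l j) * (R2 ^ ((l - j) / 2 - 1) * X 2 ^ j)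

lemma exists_two_mul_of_legc_ne_zero {l j : ℕ} (hj : j ≤ l) (h : legc l j ≠ 0) :
    ∃ k, l = j + 2 * k ∧ (l - j) / 2 = k := by
  have : ¬ Odd (j + l) := fun ho => h (legc_odd ho)
  rw [Nat.not_odd_iff_even] at this
  obtain ⟨m, hm⟩ := this
  exact ⟨m - j, by omega, by omega⟩

lemma peul_X2_pow (j : ℕ) : peul (X 2 ^ j) = (j : Poly) * X 2 ^ j := by
  rw [peul_pow_of (d := 1) (by rw [peul_X, one_mul])]; ring

lemma peul_harm (l : ℕ) : peul (harm l) = l * harm l := by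
  have hs : peul (harm l) = ∑ j ∈ Finset.range (l + 1),
      peul (C (legc l j) * (R2 ^ ((l - j) / 2) * X 2 ^ j)) := by
    simp only [peul, harm, map_sum, Finset.mul_sum]
    exact Finset.sum_comm
  rw [hs, harm, Finset.mul_sum]
  refine Finset.sum_congr rfl fun j hj => ?_
  by_cases h : legc l j = 0
  · simp [h, peul]
  · obtain ⟨k, hk, hk'⟩ := exists_two_mul_of_legc_ne_zero
      (Nat.lt_succ_iff.1 (Finset.mem_range.1 hj)) h
    rw [hk', peul_mul, peul_C, peul_R2_pow_mul (peul_X2_pow j)]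
    have : (l : Poly) = j + 2 * k := by rw [hk]; push_cast; ring
    rw [this]; ring

lemma pderiv_harm (l : ℕ) (i : Fin 3) :
    pderiv i (harm l) = (if i = 2 then harmZ l else 0) + X i * harmR l := by
  have h1 (j : ℕ) : pderiv i (X 2 ^ j : Poly) = if i = 2 then (j : Poly) * X 2 ^ (j - 1) else 0 := by
    rw [Derivation.leibniz_pow, MvPolynomial.pderiv_X]
    by_cases h : i = 2
    · subst h; simp
    · simp [h]
  have h2 : pderiv i (harm l) = ∑ j ∈ Finset.range (l + 1),
      (if i = 2 then C (j * legc l j) * (R2 ^ ((l - j) / 2) * X 2 ^ (j - 1)) else 0)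
      + ∑ j ∈ Finset.range (l + 1),
        X i * (C (((l : ℝ) - j) * legc l j) * (R2 ^ ((l - j) / 2 - 1) * X 2 ^ j)) := by
    rw [harm, map_sum, ← Finset.sum_add_distrib]
    refine Finset.sum_congr rfl fun j hj => ?_
    by_cases h : legc l j = 0
    · simp [h]
    obtain ⟨k, hk, hk'⟩ := exists_two_mul_of_legc_ne_zero
      (Nat.lt_succ_iff.1 (Finset.mem_range.1 hj)) h
    have hlj : (l : ℝ) - j = ((2 * k : ℕ) : ℝ) := by rw [hk]; push_cast; ring
    rw [hk', hlj, MvPolynomial.pderiv_C_mul, Derivation.leibniz, h1]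
    have h3 : pderiv i (R2 ^ k) = 2 * (k : Poly) * R2 ^ (k - 1) * X i := by
      rcases k with _ | k
      · simp
      · rw [pderiv_R2_pow_succ]; push_cast; simp
    rw [h3]
    simp only [smul_eq_mul, map_mul, map_natCast]
    push_cast
    split_ifs <;> ring
  rw [h2, harmR, Finset.mul_sum, harmZ]
  congr 1
  split_ifs <;> simp

lemma plap_harm (l : ℕ) : plap (harm l) = 0 := by
  have hs : plap (harm l) = ∑ j ∈ Finset.range (l + 3),
      plap (C (legc l j) * (R2 ^ ((l - j) / 2) * X 2 ^ j)) := by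
    rw [Finset.sum_range_succ, Finset.sum_range_succ, legc_of_lt (show l < l + 1 by omega),
      legc_of_lt (show l < l + 1 + 1 by omega)]
    simp only [plap, harm, map_sum, map_zero, zero_mul, Finset.sum_const_zero, add_zero]
    exact Finset.sum_comm
  have hX0 (j : ℕ) : plap (X 2 ^ (j + 2) : Poly) = ((j : Poly) + 2) * ((j : Poly) + 1) * X 2 ^ j := by
    simp only [plap, Fin.sum_univ_three, Derivation.leibniz_pow, MvPolynomial.pderiv_X]
    simp
    ring
  have hX1 : plap (X 2 ^ 0 : Poly) = 0 := by simp [plap]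
  have hX2 : plap (X 2 ^ 1 : Poly) = 0 := by
    simp [plap, Fin.sum_univ_three, MvPolynomial.pderiv_X]
  -- the two parts of the Laplacian of a monomial
  have key : ∀ j ∈ Finset.range (l + 3), plap (C (legc l j) * (R2 ^ ((l - j) / 2) * X 2 ^ j))
      = C (((l : ℝ) - j) * (l + j + 1) * legc l j) * (R2 ^ ((l - j) / 2 - 1) * X 2 ^ j)
        + C (legc l j) * R2 ^ ((l - j) / 2) * plap (X 2 ^ j) := by
    intro j hj
    by_cases h : legc l j = 0
    · simp [h, plap]
    have hjl : j ≤ l := by by_contra hc; exact h (legc_of_lt (by omega))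
    obtain ⟨k, hk, hk'⟩ := exists_two_mul_of_legc_ne_zero hjl h
    rw [hk', plap_C_mul]
    have hlj : ((l : ℝ) - j) * (l + j + 1) = ((2 * k * (2 * k + 1 + 2 * j) : ℕ) : ℝ) := by
      rw [hk]; push_cast; ring
    rw [hlj]
    rcases k with _ | k
    · simp
    · rw [plap_R2_pow_succ_mul (peul_X2_pow j)]
      simp only [map_mul, map_natCast, Nat.add_sub_cancel]
      push_cast; ring
  rw [hs, Finset.sum_congr rfl key, Finset.sum_add_distrib]
  rw [Finset.sum_range_succ' (fun j => C (legc l j) * R2 ^ ((l - j) / 2) * plap (X 2 ^ j)),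
    Finset.sum_range_succ' (fun j => C (legc l (j + 1)) * R2 ^ ((l - (j + 1)) / 2)
      * plap (X 2 ^ (j + 1))), zero_add, hX1, hX2]
  rw [Finset.sum_range_succ (fun j => C (((l : ℝ) - j) * (l + j + 1) * legc l j)
      * (R2 ^ ((l - j) / 2 - 1) * X 2 ^ j)), Finset.sum_range_succ (fun j =>
      C (((l : ℝ) - j) * (l + j + 1) * legc l j) * (R2 ^ ((l - j) / 2 - 1) * X 2 ^ j)),
    legc_of_lt (show l < l + 1 by omega), legc_of_lt (show l < l + 1 + 1 by omega)]
  simp only [mul_zero, map_zero, zero_mul, add_zero]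
  rw [← Finset.sum_add_distrib]
  refine Finset.sum_eq_zero fun j hj => ?_
  have e : (l - (j + 1 + 1)) / 2 = (l - j) / 2 - 1 := by omega
  rw [e, hX0]
  have hr : C (((l : ℝ) - j) * (l + j + 1) * legc l j)
      = -(((j : Poly) + 2) * ((j : Poly) + 1) * C (legc l (j + 1 + 1))) := by
    have h2 : (((j : Poly) + 2) * ((j : Poly) + 1)) = C (((j : ℝ) + 2) * (j + 1)) := by
      simp only [map_mul, map_add, map_natCast, map_one, map_ofNat]
    rw [h2, ← map_mul, legc_rec, ← map_neg]
    congr 1; ring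
  rw [hr]; ring

/-! ### The polynomial fields of one angular momentum -/

/-- The poloidal polynomial fields `2kl r^(2k-2) H x - (2k+l+1) r^(2k) ∇H`, where `H` is the zonal
harmonic of degree `l`; they are divergence-free and for `k = 0` proportional to `∇H`. -/
def pf (l k : ℕ) : VP := fun i =>
  (2 * k * l : Poly) * (R2 ^ (k - 1) * (harm l * X i))
    - (2 * k + l + 1 : Poly) * (R2 ^ k * pderiv i (harm l))

/-- The toroidal field `x × ∇H`. -/
def crossf (l : ℕ) : VP := ![harmZ l * X 1, -(harmZ l * X 0), 0]

/-- The toroidal polynomial fields `r^(2k) x × ∇H`. -/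
def qf (l k : ℕ) : VP := fun i => R2 ^ k * crossf l i

lemma natCast_mul_eq_smul (n : ℕ) (p : Poly) : (n : Poly) * p = (n : ℝ) • p := by
  rw [MvPolynomial.smul_eq_C_mul, map_natCast]

lemma pderiv_harm_zero (l : ℕ) : pderiv 0 (harm l) = X 0 * harmR l := by simp [pderiv_harm]
lemma pderiv_harm_one (l : ℕ) : pderiv 1 (harm l) = X 1 * harmR l := by simp [pderiv_harm]
lemma pderiv_harm_two (l : ℕ) : pderiv 2 (harm l) = harmZ l + X 2 * harmR l := by
  simp [pderiv_harm]

lemma X_mul_pderiv_harm (l : ℕ) : ∑ i, X i * pderiv i (harm l) = (l : Poly) * harm l :=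
  peul_harm l

lemma peul_pderiv_harm (l : ℕ) (i : Fin 3) :
    peul (pderiv i (harm l)) = ((l : Poly) - 1) * pderiv i (harm l) := by
  rw [peul_pderiv, peul_harm, Derivation.leibniz]
  simp
  ring

lemma plap_pderiv_harm (l : ℕ) (i : Fin 3) : plap (pderiv i (harm l)) = 0 := by
  rw [plap_pderiv, plap_harm, map_zero]

lemma peul_harm_mul_X (l : ℕ) (i : Fin 3) :
    peul (harm l * X i) = ((l : Poly) + 1) * (harm l * X i) := by
  rw [peul_mul, peul_harm, peul_X]; ring

lemma plap_X (i : Fin 3) : plap (X i) = 0 := by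
  refine Finset.sum_eq_zero fun j _ => ?_
  rw [MvPolynomial.pderiv_X]
  by_cases h : i = j
  · subst h; simp
  · simp [h]

lemma plap_harm_mul_X (l : ℕ) (i : Fin 3) : plap (harm l * X i) = 2 * pderiv i (harm l) := by
  rw [plap_mul, plap_harm, plap_X, Finset.sum_eq_single i]
  · simp
  · intro j _ hj; simp [MvPolynomial.pderiv_X, hj.symm]
  · simp

lemma plap_natCast_mul (n : ℕ) (q : Poly) : plap ((n : Poly) * q) = n * plap q := by
  rw [← map_natCast (C : ℝ →+* Poly), plap_C_mul]

lemma plap_sub (p q : Poly) : plap (p - q) = plap p - plap q := by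
  simp [plap]

lemma peul_natCast_mul (n : ℕ) (q : Poly) : peul ((n : Poly) * q) = n * peul q := by
  rw [peul_mul, peul_natCast]; ring

lemma peul_sub (p q : Poly) : peul (p - q) = peul p - peul q := by
  simp [peul, mul_sub]

lemma pf_apply (l k : ℕ) (i : Fin 3) : pf l k i =
    ((2 * k * l : ℕ) : Poly) * (R2 ^ (k - 1) * (harm l * X i))
      - ((2 * k + l + 1 : ℕ) : Poly) * (R2 ^ k * pderiv i (harm l)) := by
  rw [pf]; push_cast; rfl

lemma pf_eq (l k : ℕ) : pf l k = (2 * k * l : ℝ) • (R2 ^ (k - 1) • (harm l • xvec))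
    - (2 * k + l + 1 : ℝ) • (R2 ^ k • pgrad (harm l)) := by
  ext1 i
  have h1 := natCast_mul_eq_smul (2 * k * l) (R2 ^ (k - 1) * (harm l * X i))
  have h2 := natCast_mul_eq_smul (2 * k + l + 1) (R2 ^ k * pderiv i (harm l))
  push_cast at h1 h2
  simp only [Pi.sub_apply, Pi.smul_apply, smul_eq_mul, xvec, pgrad, ← h1, ← h2, pf]

lemma pf_zero (l : ℕ) : pf l 0 = -(((l : ℝ) + 1) • pgrad (harm l)) := by
  ext1 i
  have := natCast_mul_eq_smul (l + 1) (pderiv i (harm l))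
  push_cast at this
  simp [pf, pgrad, ← this]

/-- The coefficient `2k (2k + 2l + 1)` by which the Laplacian lowers the radial degree. -/
def lamk (l k : ℕ) : ℝ := 2 * k * (2 * k + 2 * l + 1)

lemma lap_pf (l k : ℕ) : lap (pf l k) = lamk l k • pf l (k - 1) := by
  ext1 i
  rw [lap_apply, pf_apply, plap_sub, plap_natCast_mul, plap_natCast_mul, Pi.smul_apply]
  rcases k with _ | k
  · simp [lamk, plap_pderiv_harm]
  · have hl : lamk l (k + 1) = ((2 * (k + 1) * (2 * (k + 1) + 2 * l + 1) : ℕ) : ℝ) := by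
      simp [lamk]
    rw [hl, ← natCast_mul_eq_smul, plap_R2_pow_succ_mul (peul_pderiv_harm l i),
      plap_pderiv_harm, Nat.add_sub_cancel, pf]
    rcases k with _ | k
    · simp only [pow_zero, one_mul, plap_harm_mul_X]
      push_cast; ring
    · rw [plap_R2_pow_succ_mul (peul_harm_mul_X l i), plap_harm_mul_X]
      push_cast
      ring

lemma eul_pf (l k : ℕ) : eul (pf l k) = (2 * k + l - 1 : ℝ) • pf l k := by
  ext1 i
  rw [eul_apply, pf_apply, peul_sub, peul_natCast_mul, peul_natCast_mul,
    peul_R2_pow_mul (peul_pderiv_harm l i), peul_R2_pow_mul (peul_harm_mul_X l i), Pi.smul_apply,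
    sub_smul, one_smul]
  have h := natCast_mul_eq_smul (2 * k + l) (pf l k i)
  push_cast at h
  rw [← h, pf]
  rcases k with _ | k
  · push_cast; ring
  · push_cast; ring

lemma div_pf (l k : ℕ) : ∑ i, pderiv i (pf l k i) = 0 := by
  have hx (n : ℕ) : ∑ i, pderiv i (R2 ^ n * (harm l * X i))
      = (2 * n + l + 3 : Poly) * (R2 ^ n * harm l) := by
    have e : ∑ i, pderiv i (R2 ^ n * (harm l * X i))
        = peul (R2 ^ n * harm l) + 3 * (R2 ^ n * harm l) := by
      have (i : Fin 3) : pderiv i (R2 ^ n * (harm l * X i))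
          = X i * pderiv i (R2 ^ n * harm l) + R2 ^ n * harm l := by
        rw [← mul_assoc, Derivation.leibniz, MvPolynomial.pderiv_X_self]
        simp [mul_comm, add_comm]
      simp only [this, Finset.sum_add_distrib]
      simp [peul]
    rw [e, peul_R2_pow_mul (peul_harm l)]; ring
  have hg (n : ℕ) : ∑ i, pderiv i (R2 ^ (n + 1) * pderiv i (harm l))
      = (2 * (n + 1) * l : Poly) * (R2 ^ n * harm l) := by
    have h (i : Fin 3) : pderiv i (R2 ^ (n + 1) * pderiv i (harm l))
        = 2 * ((n : Poly) + 1) * R2 ^ n * (X i * pderiv i (harm l))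
          + R2 ^ (n + 1) * pderiv i (pderiv i (harm l)) := by
      rw [Derivation.leibniz, pderiv_R2_pow_succ]
      simp only [smul_eq_mul]; ring
    have h0 : ∑ i, pderiv i (pderiv i (harm l)) = 0 := plap_harm l
    simp only [h, Finset.sum_add_distrib, ← Finset.mul_sum, X_mul_pderiv_harm, h0]
    ring
  have hc (n : ℕ) (p : Poly) (i : Fin 3) : pderiv i ((n : Poly) * p) = n * pderiv i p := by
    rw [Derivation.leibniz, Derivation.map_natCast]; simp
  simp only [pf_apply, map_sub, hc, Finset.sum_sub_distrib, ← Finset.mul_sum]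
  rcases k with _ | k
  · have h0 : ∑ i, pderiv i (pderiv i (harm l)) = 0 := plap_harm l
    simp [h0]
  · rw [Nat.add_sub_cancel, hx, hg]; push_cast; ring

lemma crossf_zero (l : ℕ) :
    crossf l 0 = X 1 * pderiv 2 (harm l) - X 2 * pderiv 1 (harm l) := by
  rw [pderiv_harm_one, pderiv_harm_two]; simp [crossf]; ring

lemma crossf_one (l : ℕ) :
    crossf l 1 = X 2 * pderiv 0 (harm l) - X 0 * pderiv 2 (harm l) := by
  rw [pderiv_harm_zero, pderiv_harm_two]; simp [crossf]; ring

lemma crossf_two (l : ℕ) : crossf l 2 = 0 := rfl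

lemma plap_X_mul (i : Fin 3) (p : Poly) : plap (X i * p) = 2 * pderiv i p + X i * plap p := by
  rw [plap_mul, plap_X, Finset.sum_eq_single i]
  · simp
  · intro j _ hj; simp [MvPolynomial.pderiv_X, hj.symm]
  · simp

lemma plap_crossf (l : ℕ) (i : Fin 3) : plap (crossf l i) = 0 := by
  fin_cases i
  · change plap (crossf l 0) = 0
    rw [crossf_zero, plap_sub, plap_X_mul, plap_X_mul, plap_pderiv_harm, plap_pderiv_harm,
      pderiv_pderiv_comm]
    ring
  · change plap (crossf l 1) = 0
    rw [crossf_one, plap_sub, plap_X_mul, plap_X_mul, plap_pderiv_harm, plap_pderiv_harm,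
      pderiv_pderiv_comm]
    ring
  · change plap (crossf l 2) = 0
    rw [crossf_two]; simp [plap]

lemma peul_crossf (l : ℕ) (i : Fin 3) : peul (crossf l i) = l * crossf l i := by
  fin_cases i
  · change peul (crossf l 0) = l * crossf l 0
    rw [crossf_zero, peul_sub, peul_mul, peul_mul, peul_X, peul_X, peul_pderiv_harm,
      peul_pderiv_harm]
    ring
  · change peul (crossf l 1) = l * crossf l 1
    rw [crossf_one, peul_sub, peul_mul, peul_mul, peul_X, peul_X, peul_pderiv_harm,
      peul_pderiv_harm]
    ring
  · change peul (crossf l 2) = l * crossf l 2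
    rw [crossf_two]; simp [peul]

lemma lap_qf (l k : ℕ) : lap (qf l k) = lamk l k • qf l (k - 1) := by
  ext1 i
  rw [lap_apply, qf, Pi.smul_apply]
  rcases k with _ | k
  · simp [lamk, plap_crossf]
  · have hl : lamk l (k + 1) = ((2 * (k + 1) * (2 * (k + 1) + 2 * l + 1) : ℕ) : ℝ) := by
      simp [lamk]
    rw [hl, ← natCast_mul_eq_smul, plap_R2_pow_succ_mul (peul_crossf l i), plap_crossf,
      Nat.add_sub_cancel, qf]
    push_cast; ring

lemma eul_qf (l k : ℕ) : eul (qf l k) = (2 * k + l : ℝ) • qf l k := by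
  ext1 i
  have h := natCast_mul_eq_smul (2 * k + l) (qf l k i)
  push_cast at h
  rw [eul_apply, Pi.smul_apply, ← h, qf, peul_R2_pow_mul (peul_crossf l i)]

lemma qf_eq_smul (l k : ℕ) : qf l k = R2 ^ k • qf l 0 := by
  ext1 i; simp [qf]

/-! ### Values and rotational symmetry -/

lemma pev_harm_congr (l : ℕ) {x y : E3} (h2 : x 2 = y 2) (hn : ‖x‖ = ‖y‖) :
    pev (harm l) x = pev (harm l) y ∧ pev (harmZ l) x = pev (harmZ l) y
      ∧ pev (harmR l) x = pev (harmR l) y := by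
  simp [harm, harmZ, harmR, h2, hn]

lemma norm_rotZ (t : ℝ) (x : E3) : ‖rotZ t x‖ = ‖x‖ := (rotE t).norm_map x

lemma vev_pf_rotZ (l k : ℕ) (t : ℝ) (x : E3) : vev (pf l k) (rotZ t x) = rotZ t (vev (pf l k) x) := by
  obtain ⟨h1, h2, h3⟩ := pev_harm_congr l (rotZ_two_apply t x) (norm_rotZ t x)
  refine E3_ext ?_ ?_ ?_
  all_goals
    simp only [vev_apply, pf, rotZ_zero_apply, rotZ_one_apply, rotZ_two_apply, pderiv_harm_zero,
      pderiv_harm_one, pderiv_harm_two, pev_sub, pev_mul, pev_add, pev_pow, pev_X, pev_R2,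
      pev_natCast, pev_ofNat, pev_one, h1, h2, h3, norm_rotZ]
  all_goals ring

lemma vev_qf_rotZ (l k : ℕ) (t : ℝ) (x : E3) : vev (qf l k) (rotZ t x) = rotZ t (vev (qf l k) x) := by
  obtain ⟨h1, h2, h3⟩ := pev_harm_congr l (rotZ_two_apply t x) (norm_rotZ t x)
  refine E3_ext ?_ ?_ ?_
  all_goals
    simp [qf, crossf, h2, norm_rotZ] <;> ring

lemma div_crossf (l : ℕ) : ∑ i, pderiv i (crossf l i) = 0 := by
  have h : X 1 * pderiv 0 (harm l) = X 0 * pderiv 1 (harm l) := by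
    rw [pderiv_harm_zero, pderiv_harm_one]; ring
  have h2 := congrArg (pderiv 2) h
  simp only [Derivation.leibniz, smul_eq_mul, MvPolynomial.pderiv_X_of_ne (show (1 : Fin 3) ≠ 2 by decide),
    MvPolynomial.pderiv_X_of_ne (show (0 : Fin 3) ≠ 2 by decide), mul_zero, add_zero] at h2
  rw [Fin.sum_univ_three, crossf_zero, crossf_one, crossf_two]
  simp only [map_sub, Derivation.leibniz, smul_eq_mul, map_zero,
    MvPolynomial.pderiv_X_of_ne (show (1 : Fin 3) ≠ 0 by decide),
    MvPolynomial.pderiv_X_of_ne (show (2 : Fin 3) ≠ 0 by decide),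
    MvPolynomial.pderiv_X_of_ne (show (2 : Fin 3) ≠ 1 by decide),
    MvPolynomial.pderiv_X_of_ne (show (0 : Fin 3) ≠ 1 by decide), mul_zero, add_zero]
  rw [pderiv_pderiv_comm 0 2, pderiv_pderiv_comm 1 2, pderiv_pderiv_comm 1 0]
  linear_combination h2

lemma div_qf (l k : ℕ) : ∑ i, pderiv i (qf l k i) = 0 := by
  rcases k with _ | k
  · simpa [qf] using div_crossf l
  · have h0 := div_crossf l
    have h1 : ∑ i, X i * crossf l i = 0 := by
      simp [Fin.sum_univ_three, crossf]; ring
    have h (i : Fin 3) : pderiv i (qf l (k + 1) i)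
        = 2 * ((k : Poly) + 1) * R2 ^ k * (X i * crossf l i)
          + R2 ^ (k + 1) * pderiv i (crossf l i) := by
      rw [qf, Derivation.leibniz, pderiv_R2_pow_succ]
      simp only [smul_eq_mul]; ring
    simp only [h, Finset.sum_add_distrib, ← Finset.mul_sum, h0, h1, mul_zero, add_zero]

lemma jet_pf_mem (l k : ℕ) : jet (pf l k) ∈ HV := jet_mem_HV (div_pf l k) (vev_pf_rotZ l k)

lemma jet_qf_mem (l k : ℕ) : jet (qf l k) ∈ HV := jet_mem_HV (div_qf l k) (vev_qf_rotZ l k)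

/-! ### Green's formula for the polynomial fields -/

lemma green_pf {w : Jet} (hw : ∀ j : Fin 3, IsWeakPartial j (w 0) (w j.succ)) (l k : ℕ) :
    ∑ j, inner ℝ (fld (dv j (pf l k))) (w j.succ)
      = (2 * k + l - 1) * (2 * k * l * tr w (harm l • xvec)
          - (2 * k + l + 1) * tr w (pgrad (harm l)))
        - lamk l k * inner ℝ (fld (pf l (k - 1))) (w 0) := by
  have hp : tr w (pf l k) = 2 * k * l * tr w (harm l • xvec)
      - (2 * k + l + 1) * tr w (pgrad (harm l)) := by
    rw [pf_eq, map_sub, LinearMap.map_smul (tr w), LinearMap.map_smul (tr w), tr_R2_pow_smul hw,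
      tr_R2_pow_smul hw, smul_eq_mul,
      smul_eq_mul]
  rw [sum_inner_dv hw, eul_pf, lap_pf, LinearMap.map_smul (tr w), LinearMap.map_smul fld,
    inner_smul_left, hp]
  simp

lemma green_qf {w : Jet} (hw : ∀ j : Fin 3, IsWeakPartial j (w 0) (w j.succ)) (l k : ℕ) :
    ∑ j, inner ℝ (fld (dv j (qf l k))) (w j.succ)
      = (2 * k + l) * tr w (qf l 0) - lamk l k * inner ℝ (fld (qf l (k - 1))) (w 0) := by
  rw [sum_inner_dv hw, eul_qf, lap_qf, LinearMap.map_smul (tr w), LinearMap.map_smul fld,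
    inner_smul_left, qf_eq_smul l k,
    tr_R2_pow_smul hw]
  simp

/-! ### Orthogonality of different angular momenta -/

lemma sint_smul (a : ℝ) (p : Poly) : sint (a • p) = a * sint p := by
  have : (Pi.single 2 (a • p) : VP) = a • Pi.single 2 p := by rw [← Pi.single_smul]
  rw [sint, this, map_smul]; rfl

lemma pint_R2_pow_mul_eq_zero {p : Poly} {d : ℕ} (h : peul p = d * p) (hs : sint p = 0) (n : ℕ) :
    pint (R2 ^ n * p) = 0 := by
  have h1 := peul_R2_pow_mul h n
  have h2 := natCast_mul_eq_smul (2 * n + d) (R2 ^ n * p)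
  push_cast at h2
  rw [h2] at h1
  have h3 := sint_of_peul h1
  rw [sint_R2_pow_mul, hs] at h3
  have : (3 + (2 * (n : ℝ) + d)) ≠ 0 := by positivity
  exact (mul_eq_zero.1 h3.symm).resolve_left this

/-- The scalar product of the gradients of two zonal harmonics. -/
def gradProd (l l' : ℕ) : Poly := ∑ i, pderiv i (harm l) * pderiv i (harm l')

lemma sint_harm_mul_harm {l l' : ℕ} (h : l ≠ l') : sint (harm l * harm l') = 0 := by
  have h1 := pint_div fun j => harm l * pderiv j (harm l') - harm l' * pderiv j (harm l)
  have e1 : ∑ j, pderiv j (harm l * pderiv j (harm l') - harm l' * pderiv j (harm l))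
      = harm l * plap (harm l') - harm l' * plap (harm l) := by
    simp only [plap, Fin.sum_univ_three, map_sub, Derivation.leibniz, smul_eq_mul]; ring
  have e2 : ∑ j, X j * (harm l * pderiv j (harm l') - harm l' * pderiv j (harm l))
      = ((l' : ℝ) - l) • (harm l * harm l') := by
    have : ∑ j, X j * (harm l * pderiv j (harm l') - harm l' * pderiv j (harm l))
        = harm l * peul (harm l') - harm l' * peul (harm l) := by
      simp only [peul, Fin.sum_univ_three]; ring
    rw [this, peul_harm, peul_harm, sub_smul, ← natCast_mul_eq_smul, ← natCast_mul_eq_smul]; ring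
  rw [e1, e2, plap_harm, plap_harm, sint_smul] at h1
  have : (l' : ℝ) - l ≠ 0 := sub_ne_zero.2 (by exact_mod_cast h.symm)
  simpa [this] using h1.symm

lemma pint_R2_pow_harm {l l' : ℕ} (h : l ≠ l') (n : ℕ) :
    pint (R2 ^ n * (harm l * harm l')) = 0 := by
  refine pint_R2_pow_mul_eq_zero (d := l + l') ?_ (sint_harm_mul_harm h) n
  rw [peul_mul, peul_harm, peul_harm]; push_cast; ring

lemma pint_R2_pow_gradProd {l l' : ℕ} (hl : 1 ≤ l) (hl' : 1 ≤ l') (h : l ≠ l') (n : ℕ) :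
    pint (R2 ^ n * gradProd l l') = 0 := by
  have hd : peul (gradProd l l') = ((l + l' - 2 : ℕ) : Poly) * gradProd l l' := by
    have : ((l + l' - 2 : ℕ) : Poly) = l + l' - 2 := by
      rw [Nat.cast_sub (by omega)]; push_cast; ring
    rw [this]
    simp only [gradProd, Fin.sum_univ_three, peul_add, peul_mul, peul_pderiv_harm]; ring
  have hp : pint (gradProd l l') = 0 := by
    have h1 := pint_div fun j => harm l * pderiv j (harm l')
    have e1 : ∑ j, pderiv j (harm l * pderiv j (harm l')) = gradProd l l' := by
      have : ∑ j, pderiv j (harm l * pderiv j (harm l'))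
          = harm l * plap (harm l') + gradProd l l' := by
        simp only [plap, gradProd, Fin.sum_univ_three, Derivation.leibniz, smul_eq_mul]; ring
      rw [this, plap_harm]; ring
    have e2 : ∑ j, X j * (harm l * pderiv j (harm l')) = (l' : ℝ) • (harm l * harm l') := by
      have : ∑ j, X j * (harm l * pderiv j (harm l')) = harm l * peul (harm l') := by
        simp only [peul, Fin.sum_univ_three]; ring
      rw [this, peul_harm, ← natCast_mul_eq_smul]; ring
    rw [e1, e2, sint_smul, sint_harm_mul_harm h, mul_zero] at h1
    exact h1
  refine pint_R2_pow_mul_eq_zero hd ?_ n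
  rw [natCast_mul_eq_smul] at hd
  rw [sint_of_peul hd, hp, mul_zero]

lemma pint_natCast_mul (n : ℕ) (p : Poly) : pint ((n : Poly) * p) = n * pint p := by
  rw [natCast_mul_eq_smul, map_smul, smul_eq_mul]

lemma inner_pf_pf {l l' : ℕ} (hl : 1 ≤ l) (hl' : 1 ≤ l') (h : l ≠ l') (k k' : ℕ) :
    inner ℝ (fld (pf l k)) (fld (pf l' k')) = 0 := by
  have e : ∑ i, pf l k i * pf l' k' i
      = ((2 * k * l * (2 * k' * l') : ℕ) : Poly)
          * (R2 ^ ((k - 1) + (k' - 1) + 1) * (harm l * harm l'))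
        - ((2 * k * l * (2 * k' + l' + 1) * l' : ℕ) : Poly)
          * (R2 ^ ((k - 1) + k') * (harm l * harm l'))
        - ((2 * k' * l' * (2 * k + l + 1) * l : ℕ) : Poly)
          * (R2 ^ (k + (k' - 1)) * (harm l * harm l'))
        + (((2 * k + l + 1) * (2 * k' + l' + 1) : ℕ) : Poly)
          * (R2 ^ (k + k') * gradProd l l') := by
    have h1 := X_mul_pderiv_harm l
    have h2 := X_mul_pderiv_harm l'
    rw [Fin.sum_univ_three] at h1 h2
    simp only [pf, gradProd, Fin.sum_univ_three]
    push_cast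
    rw [pow_add, pow_add, pow_add, pow_add, pow_add, pow_one]
    have h5 : R2 = (X 0 ^ 2 + X 1 ^ 2 + X 2 ^ 2 : Poly) := rfl
    linear_combination
      -(4 * k * l * k' * l' : Poly) * R2 ^ (k - 1) * R2 ^ (k' - 1) * harm l * harm l' * h5
      -(2 * k * l * (2 * k' + l' + 1) : Poly) * R2 ^ (k - 1) * R2 ^ k' * harm l * h2
      - (2 * k' * l' * (2 * k + l + 1) : Poly) * R2 ^ k * R2 ^ (k' - 1) * harm l' * h1
  rw [inner_fld_fld, e, map_add, map_sub, map_sub]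
  simp only [pint_natCast_mul, pint_R2_pow_harm h, pint_R2_pow_gradProd hl hl' h]
  ring

lemma inner_qf_qf {l l' : ℕ} (hl : 1 ≤ l) (hl' : 1 ≤ l') (h : l ≠ l') (k k' : ℕ) :
    inner ℝ (fld (qf l k)) (fld (qf l' k')) = 0 := by
  have e : ∑ i, qf l k i * qf l' k' i
      = R2 ^ (k + k' + 1) * gradProd l l'
        - ((l * l' : ℕ) : Poly) * (R2 ^ (k + k') * (harm l * harm l')) := by
    have h1 := X_mul_pderiv_harm l
    have h2 := X_mul_pderiv_harm l'
    have h3 : ((l * l' : ℕ) : Poly) * (R2 ^ (k + k') * (harm l * harm l'))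
        = R2 ^ (k + k') * ((l * harm l) * (l' * harm l')) := by push_cast; ring
    rw [h3, ← h1, ← h2, pow_succ R2 (k + k'), pow_add]
    simp only [qf, gradProd, Fin.sum_univ_three, crossf_zero, crossf_one, crossf_two]
    have h4 : X 0 * pderiv 1 (harm l) - X 1 * pderiv 0 (harm l) = 0 := by
      rw [pderiv_harm_zero, pderiv_harm_one]; ring
    have h5 : R2 = (X 0 ^ 2 + X 1 ^ 2 + X 2 ^ 2 : Poly) := rfl
    linear_combination (-(R2 ^ k * R2 ^ k' * (X 0 ^ 1 * pderiv 1 (harm l') - X 1 * pderiv 0 (harm l')))) * h4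
     - (R2 ^ k * R2 ^ k' * (pderiv 0 (harm l) * pderiv 0 (harm l') + pderiv 1 (harm l) * pderiv 1 (harm l') + pderiv 2 (harm l) * pderiv 2 (harm l'))) * h5
  rw [inner_fld_fld, e, map_sub, pint_natCast_mul, pint_R2_pow_harm h,
    pint_R2_pow_gradProd hl hl' h]
  ring

lemma inner_pf_qf (l l' k k' : ℕ) : inner ℝ (fld (pf l k)) (fld (qf l' k')) = 0 := by
  have e : ∑ i, pf l k i * qf l' k' i = 0 := by
    simp only [pf, qf, Fin.sum_univ_three, pderiv_harm_zero, pderiv_harm_one, crossf]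
    simp
    ring
  rw [inner_fld_fld, e, map_zero]

/-! ### Completeness of the polynomial fields -/

/-- The moments `p ↦ ⟨p Q, u⟩` of a field `u` in the direction of a polynomial field `Q`. -/
def mom (Q : VP) (u : L2Field) : Poly →ₗ[ℝ] ℝ where
  toFun p := inner ℝ (fld (p • Q)) u
  map_add' p q := by rw [add_smul, map_add, inner_add_left]
  map_smul' a p := by
    rw [smul_assoc, LinearMap.map_smul fld, inner_smul_left]; rfl

lemma mom_apply (Q : VP) (u : L2Field) (p : Poly) : mom Q u p = inner ℝ (fld (p • Q)) u := rfl

lemma map_C_mul_eq (L : Poly →ₗ[ℝ] ℝ) (a : ℝ) (p : Poly) : L (C a * p) = a * L p := by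
  rw [← MvPolynomial.smul_eq_C_mul, map_smul, smul_eq_mul]

/-- Moments against `r^(2k) H_l` determine all moments against `z^j r^(2k)`. -/
lemma moments_of_harm (L : Poly →ₗ[ℝ] ℝ) (h : ∀ l k, L (R2 ^ k * harm l) = 0) (j k : ℕ) :
    L (R2 ^ k * X 2 ^ j) = 0 := by
  induction j using Nat.strong_induction_on generalizing k with
  | _ j ih =>
    have e : R2 ^ k * harm j = ∑ i ∈ Finset.range (j + 1),
        C (legc j i) * (R2 ^ (k + (j - i) / 2) * X 2 ^ i) := by
      rw [harm, Finset.mul_sum]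
      refine Finset.sum_congr rfl fun i _ => ?_
      rw [pow_add]; ring
    have h1 := h j k
    rw [e, map_sum, Finset.sum_range_succ, Finset.sum_eq_zero, zero_add, map_C_mul_eq] at h1
    · simpa [(legc_self_pos j).ne'] using h1
    · intro i hi
      rw [map_C_mul_eq, ih i (Finset.mem_range.1 hi), mul_zero]

lemma moments_of_harmZ (L : Poly →ₗ[ℝ] ℝ) (h : ∀ l k, L (R2 ^ k * harmZ l) = 0) (j k : ℕ) :
    L (R2 ^ k * X 2 ^ j) = 0 := by
  induction j using Nat.strong_induction_on generalizing k with
  | _ j ih =>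
    have e : R2 ^ k * harmZ (j + 1) = ∑ i ∈ Finset.range (j + 1 + 1),
        C (i * legc (j + 1) i) * (R2 ^ (k + (j + 1 - i) / 2) * X 2 ^ (i - 1)) := by
      rw [harmZ, Finset.mul_sum]
      refine Finset.sum_congr rfl fun i _ => ?_
      rw [pow_add]; ring
    have h1 := h (j + 1) k
    rw [e, map_sum, Finset.sum_range_succ, Finset.sum_eq_zero, zero_add, map_C_mul_eq] at h1
    · have : ((j : ℝ) + 1) * legc (j + 1) (j + 1) ≠ 0 :=
        mul_ne_zero (by positivity) (legc_self_pos _).ne'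
      simpa [(legc_self_pos (j + 1)).ne', Nat.cast_add_one_ne_zero j] using h1
    · intro i hi
      rcases i with _ | i
      · simp
      · rw [map_C_mul_eq, Nat.add_sub_cancel, ih i (by simpa using hi), mul_zero]

lemma harm_zero : pderiv 2 (harm 0) = 0 ∧ pgrad (harm 0) = 0 := by
  have : pgrad (harm 0) = 0 := by
    ext1 i; fin_cases i <;> simp [pgrad, pderiv_harm, harmZ, harmR]
  exact ⟨congrFun this 2, this⟩

lemma pgrad_R2_pow_mul (k : ℕ) (p : Poly) : pgrad (R2 ^ (k + 1) * p)
    = (2 * (k + 1) : ℝ) • ((R2 ^ k * p) • xvec) + R2 ^ (k + 1) • pgrad p := by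
  ext1 i
  have h := natCast_mul_eq_smul (2 * (k + 1)) (R2 ^ k * p * X i)
  push_cast at h
  simp only [pgrad, Pi.add_apply, Pi.smul_apply, xvec, smul_eq_mul, ← h, Derivation.leibniz,
    pderiv_R2_pow_succ]
  ring

/-- If all poloidal moments of an admissible field vanish, then so do its moments against
`r^(2k) H x` and against `r^(2k) ∇H` separately. -/
lemma moments_of_pf {w : Jet} (hw : w ∈ HV)
    (h : ∀ l k, 1 ≤ l → inner ℝ (fld (pf l k)) (w 0) = 0) (l k : ℕ) :
    mom xvec (w 0) (R2 ^ k * harm l) = 0 ∧ mom (pgrad (harm l)) (w 0) (R2 ^ k) = 0 := by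
  set a : ℕ → ℝ := fun k => mom xvec (w 0) (R2 ^ k * harm l) with ha
  set b : ℕ → ℝ := fun k => mom (pgrad (harm l)) (w 0) (R2 ^ k) with hb
  have hpf (k : ℕ) : 2 * k * l * a (k - 1) - (2 * k + l + 1) * b k = 0 := by
    rcases Nat.eq_zero_or_pos l with rfl | hl
    · simp [hb, mom_apply, harm_zero.2]
    · rw [← h l k hl, pf_eq, map_sub, LinearMap.map_smul fld, LinearMap.map_smul fld,
        inner_sub_left, inner_smul_left, inner_smul_left, smul_smul]
      rfl
  have hb0 : b 0 = 0 := by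
    have := hpf 0
    simp only [Nat.cast_zero, mul_zero, zero_mul, zero_sub, zero_add, neg_eq_zero] at this
    exact (mul_eq_zero.1 this).resolve_left (by positivity)
  have hg (k : ℕ) : 2 * (k + 1) * a k + b (k + 1) = 0 := by
    have h1 := inner_pgrad hw.1 hw.2.1 (R2 ^ (k + 1) * harm l)
    have h2 := inner_pgrad hw.1 hw.2.1 (harm l)
    rw [mul_smul, tr_R2_pow_smul hw.1, ← h2, pgrad_R2_pow_mul, LinearMap.map_add fld,
      inner_add_left] at h1
    have h4 : inner ℝ (fld ((2 * (k + 1) : ℝ) • ((R2 ^ k * harm l) • xvec))) (w 0)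
        = 2 * (k + 1) * a k := by
      rw [LinearMap.map_smul fld, inner_smul_left]; rfl
    have h3 : b 0 = inner ℝ (fld (pgrad (harm l))) (w 0) := by
      rw [hb]; beta_reduce; rw [mom_apply, pow_zero, one_smul]
    rw [← h3, hb0, h4] at h1
    exact h1
  have hbs (k : ℕ) : b (k + 1) = 0 := by
    have h1 := hpf (k + 1)
    have h2 := hg k
    rw [Nat.add_sub_cancel] at h1
    push_cast at h1
    have h3 : ((2 : ℝ) * k + 2 * l + 3) * b (k + 1) = 0 := by linear_combination l * h2 - h1
    exact (mul_eq_zero.1 h3).resolve_left (by positivity)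
  refine ⟨?_, ?_⟩
  · have := hg k
    rw [hbs, add_zero] at this
    exact (mul_eq_zero.1 this).resolve_left (by positivity)
  · rcases k with _ | k
    · exact hb0
    · exact hbs k

/-- A rotation-invariant combination `∑ Qᵢ uᵢ` with vanishing moments is zero. -/
lemma sum_mul_ae_eq_zero {u : L2Field} (hu : IsAxisymmetric u) (Q : VP)
    (hQ : ∀ t x, vev Q (rotZ t x) = rotZ t (vev Q x))
    (h : ∀ j k, mom Q u (R2 ^ k * X 2 ^ j) = 0) :
    ∀ᵐ x ∂ballMeasure, ∑ i, pev (Q i) x * u x i = 0 := by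
  refine ae_eq_zero_of_axisymmetric ?_ ?_ ?_
  · exact integrable_finsetSum _ fun i _ => integrable_mul_comp (continuous_pev _) u i
  · intro t
    filter_upwards [hu t] with x hx
    have h2 := hQ t x
    have e (i : Fin 3) : pev (Q i) (rotZ t x) = rotZ t (vev Q x) i := by rw [← h2]; rfl
    simp only [hx, e, Fin.sum_univ_three, rotZ_zero_apply, rotZ_one_apply, rotZ_two_apply,
      vev_apply]
    linear_combination (pev (Q 0) x * u x 0 + pev (Q 1) x * u x 1) * Real.sin_sq_add_cos_sq t
  · intro j k
    rw [← h j k, mom_apply, inner_fld]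
    congr 1; ext x
    simp only [Pi.smul_apply, smul_eq_mul, pev_mul, pev_pow, pev_R2, pev_X, Finset.mul_sum]
    exact Finset.sum_congr rfl fun i _ => by ring

lemma ae_coord_ne_zero : ∀ᵐ x : E3 ∂ballMeasure, x 0 ≠ 0 := by
  refine ae_restrict_of_ae ?_
  have h := Measure.addHaar_submodule (volume : Measure E3)
    (LinearMap.ker (EuclideanSpace.proj (0 : Fin 3) : E3 →L[ℝ] ℝ).toLinearMap) (by
      intro h
      have : EuclideanSpace.single (0 : Fin 3) (1 : ℝ) ∈
          LinearMap.ker (EuclideanSpace.proj (0 : Fin 3) : E3 →L[ℝ] ℝ).toLinearMap := by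
        rw [h]; trivial
      simp at this)
  rw [ae_iff]
  convert h using 2
  ext x
  simp

lemma moments_z {w : Jet} (hw : w ∈ HV)
    (hp : ∀ l k, 1 ≤ l → inner ℝ (fld (pf l k)) (w 0) = 0) (l k : ℕ) :
    mom (Pi.single 2 1) (w 0) (R2 ^ k * harmZ l) = 0 := by
  have h1 := moments_of_harm _ fun l k => (moments_of_pf hw hp l k).1
  have h2 := (moments_of_pf hw hp l k).2
  have h3 : mom xvec (w 0) (R2 ^ k * harmR l) = 0 := by
    rw [harmR, Finset.mul_sum, map_sum]
    refine Finset.sum_eq_zero fun i _ => ?_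
    have : R2 ^ k * (C (((l : ℝ) - i) * legc l i) * (R2 ^ ((l - i) / 2 - 1) * X 2 ^ i))
        = C (((l : ℝ) - i) * legc l i) * (R2 ^ (k + ((l - i) / 2 - 1)) * X 2 ^ i) := by
      rw [pow_add]; ring
    rw [this, map_C_mul_eq, h1, mul_zero]
  have e : R2 ^ k • pgrad (harm l)
      = (R2 ^ k * harmZ l) • (Pi.single 2 1 : VP) + (R2 ^ k * harmR l) • xvec := by
    ext1 i
    simp only [pgrad, pderiv_harm, Pi.smul_apply, Pi.add_apply, smul_eq_mul, xvec,
      Pi.single_apply]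
    split_ifs <;> ring
  rw [mom_apply] at h2 h3 ⊢
  rw [e, map_add, inner_add_left, h3, add_zero] at h2
  exact h2

lemma moments_y {u : L2Field} (hq : ∀ l k, 1 ≤ l → inner ℝ (fld (qf l k)) u = 0) (l k : ℕ) :
    mom ![X 1, -X 0, 0] u (R2 ^ k * harmZ l) = 0 := by
  have e : (R2 ^ k * harmZ l) • (![X 1, -X 0, 0] : VP) = qf l k := by
    ext1 i
    fin_cases i
    · simp [qf, crossf]; ring
    · simp [qf, crossf]; ring
    · simp [qf, crossf]
  rw [mom_apply, e]
  rcases Nat.eq_zero_or_pos l with rfl | hl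
  · have : qf 0 k = 0 := by
      ext1 i
      fin_cases i <;> simp [qf, crossf, harmZ]
    rw [this, map_zero, inner_zero_left]
  · exact hq l k hl

/-- **Completeness of the polynomial fields**: an admissible field orthogonal to all of them
vanishes. -/
theorem eq_zero_of_moments {w : Jet} (hw : w ∈ HV)
    (hp : ∀ l k, 1 ≤ l → inner ℝ (fld (pf l k)) (w 0) = 0)
    (hq : ∀ l k, 1 ≤ l → inner ℝ (fld (qf l k)) (w 0) = 0) : w 0 = 0 := by
  have h1 := moments_of_harm _ fun l k => (moments_of_pf hw hp l k).1
  have hx := sum_mul_ae_eq_zero hw.2.2 xvec (fun t x => by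
    refine E3_ext ?_ ?_ ?_ <;> simp [xvec]) h1
  have hz := sum_mul_ae_eq_zero hw.2.2 (Pi.single 2 1) (fun t x => by
    refine E3_ext ?_ ?_ ?_ <;> simp) (moments_of_harmZ _ (moments_z hw hp))
  have hy := sum_mul_ae_eq_zero hw.2.2 ![X 1, -X 0, 0] (fun t x => by
    refine E3_ext ?_ ?_ ?_
    · simp; ring
    · simp; ring
    · simp) (moments_of_harmZ _ (moments_y hq))
  refine Lp.ext ?_
  filter_upwards [hx, hz, hy, ae_coord_ne_zero, Lp.coeFn_zero E3 2 ballMeasure] with x h1 h2 h3 h4 h5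
  rw [h5]
  simp only [Fin.sum_univ_three, xvec, pev_X, Pi.single_apply] at h1 h2 h3
  simp at h2 h3
  have hs : x 0 ^ 2 + x 1 ^ 2 ≠ 0 := by positivity
  rw [h2] at h1
  refine E3_ext ?_ ?_ ?_
  · have : (x 0 ^ 2 + x 1 ^ 2) * w 0 x 0 = 0 := by linear_combination x 0 * h1 + x 1 * h3
    simpa [hs] using this
  · have : (x 0 ^ 2 + x 1 ^ 2) * w 0 x 1 = 0 := by linear_combination x 1 * h1 - x 0 * h3
    simpa [hs] using this
  · simpa using h2

/-! ### The entire functions behind the Bessel functions -/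

/-- The coefficients of `bg`, determined by `lamk l (k + 1) * bc l (k + 1) = - bc l k`. -/
def bc (l : ℕ) : ℕ → ℝ
  | 0 => 1
  | k + 1 => -bc l k / lamk l (k + 1)

/-- The entire function `s ↦ ∑ bc l k * s ^ k`; up to a constant, `J_{l+1/2}(r)` is
`r ^ (l + 1/2) * bg l (r ^ 2)`. -/
def bg (l : ℕ) (s : ℝ) : ℝ := ∑' k, bc l k * s ^ k

lemma hasSum_of_eq {f g : ℕ → ℝ} {a b : ℝ} (h : HasSum f a) (hf : ∀ k, f k = g k) (hab : a = b) :
    HasSum g b := by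
  rw [← hab, ← funext hf]; exact h

lemma lamk_succ_pos (l k : ℕ) : 0 < lamk l (k + 1) := by
  rw [lamk]; positivity

lemma lamk_mul_bc (l k : ℕ) : lamk l (k + 1) * bc l (k + 1) = -bc l k := by
  rw [bc]; field_simp [(lamk_succ_pos l k).ne']

lemma bc_ne_zero (l k : ℕ) : bc l k ≠ 0 := by
  induction k with
  | zero => simp [bc]
  | succ k ih => exact div_ne_zero (neg_ne_zero.2 ih) (lamk_succ_pos l k).ne'

lemma abs_bc_succ_le (l k : ℕ) : |bc l (k + 1)| ≤ |bc l k| / (k + 1) / (l + 1) := by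
  have h1 := lamk_succ_pos l k
  have h2 : ((k : ℝ) + 1) * (l + 1) ≤ lamk l (k + 1) := by
    rw [lamk]; push_cast
    have : (0 : ℝ) ≤ k := k.cast_nonneg
    have : (0 : ℝ) ≤ l := l.cast_nonneg
    nlinarith
  rw [bc, abs_div, abs_neg, abs_of_pos h1, div_div]
  gcongr

lemma abs_bc_le (l k : ℕ) : |bc l k| ≤ 1 / (k.factorial : ℝ) := by
  induction k with
  | zero => simp [bc]
  | succ k ih =>
    refine (abs_bc_succ_le l k).trans ?_
    refine (div_le_self (by positivity) (by linarith [l.cast_nonneg (α := ℝ)])).trans ?_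
    rw [Nat.factorial_succ, Nat.cast_mul, mul_comm, ← div_div]
    push_cast
    gcongr

lemma summable_mul_pow_of_abs_le {a : ℕ → ℝ} (h : ∀ k, |a k| ≤ 1 / (k.factorial : ℝ)) (s : ℝ) :
    Summable fun k => a k * s ^ k := by
  refine .of_norm_bounded (Real.summable_pow_div_factorial |s|) fun k => ?_
  rw [norm_mul, norm_pow, Real.norm_eq_abs, Real.norm_eq_abs, div_eq_mul_one_div, mul_comm]
  gcongr
  exact h k

lemma hasSum_bg (l : ℕ) (s : ℝ) : HasSum (fun k => bc l k * s ^ k) (bg l s) :=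
  (summable_mul_pow_of_abs_le (abs_bc_le l) s).hasSum

lemma bg_zero (l : ℕ) : bg l 0 = 1 := by
  refine (hasSum_bg l 0).unique ?_
  refine hasSum_of_eq (hasSum_single 0 fun k hk => ?_) (fun _ => rfl) ?_
  · simp [hk]
  · simp [bc]

lemma analyticOnNhd_bg (l : ℕ) : AnalyticOnNhd ℝ (bg l) Set.univ := by
  have hr : (FormalMultilinearSeries.ofScalars ℝ (bc l)).radius = ⊤ := by
    refine FormalMultilinearSeries.ofScalars_radius_eq_top_of_tendsto _ _
      (.of_forall fun n => bc_ne_zero l n) ?_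
    refine squeeze_zero (fun n => by positivity) (fun n => ?_)
      (tendsto_one_div_add_atTop_nhds_zero_nat (𝕜 := ℝ))
    rw [div_le_iff₀ (norm_pos_iff.2 (bc_ne_zero l n)), Real.norm_eq_abs, Real.norm_eq_abs]
    refine (abs_bc_succ_le l n).trans ((div_le_self (by positivity)
      (by linarith [l.cast_nonneg (α := ℝ)])).trans (le_of_eq (by ring)))
  have h := (FormalMultilinearSeries.ofScalars ℝ (bc l)).hasFPowerSeriesOnBall (by rw [hr]; simp)
  have h2 := h.analyticOnNhd
  rw [hr] at h2
  have e : (FormalMultilinearSeries.ofScalars ℝ (bc l)).sum = bg l := by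
    funext s
    refine (FormalMultilinearSeries.ofScalars_sum_eq (bc l) s).trans ?_
    simp [bg]
  rw [e] at h2
  simpa using h2

lemma bc_succ_eq (l k : ℕ) : 2 * ((k : ℝ) + 1) * bc l (k + 1) = -bc (l + 1) k / (2 * l + 3) := by
  have hl : (2 * (l : ℝ) + 3) ≠ 0 := by positivity
  induction k with
  | zero =>
    have := lamk_mul_bc l 0
    rw [lamk] at this
    simp only [bc] at this ⊢
    simp [lamk]
    field_simp
    ring
  | succ k ih =>
    have h1 := lamk_mul_bc l (k + 1)
    have h2 := lamk_mul_bc (l + 1) k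
    rw [lamk] at h1 h2
    push_cast at h1 h2 ⊢
    have hk : (2 * ((k : ℝ) + 1 + 1) + 2 * l + 1) ≠ 0 := by positivity
    have hk1 : ((k : ℝ) + 1) ≠ 0 := by positivity
    rw [eq_div_iff hl] at ih ⊢
    refine mul_left_cancel₀ (mul_ne_zero hk hk1) ?_
    linear_combination (k + 1) * (2 * l + 3) * h1 + h2 / 2 - ih / 2

lemma hasSum_bg_deriv (l : ℕ) (s : ℝ) :
    HasSum (fun k : ℕ => ((k : ℝ) + 1) * bc l (k + 1) * s ^ k) (-bg (l + 1) s / (2 * (2 * l + 3))) := by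
  refine hasSum_of_eq ((hasSum_bg (l + 1) s).mul_left (-1 / (2 * (2 * (l : ℝ) + 3))))
    (fun k => ?_) ?_
  · have := bc_succ_eq l k
    have e : ((k : ℝ) + 1) * bc l (k + 1) = -bc (l + 1) k / (2 * l + 3) / 2 := by linarith
    rw [e]; field_simp
  · ring

lemma hasDerivAt_bg (l : ℕ) (s : ℝ) :
    HasDerivAt (bg l) (-bg (l + 1) s / (2 * (2 * l + 3))) s := by
  have hsum : Summable fun k : ℕ => (k : ℝ) * (1 / (k.factorial : ℝ)) * (|s| + 1) ^ (k - 1) := by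
    rw [← summable_nat_add_iff 1]
    refine (Real.summable_pow_div_factorial (|s| + 1)).congr fun k => ?_
    rw [Nat.factorial_succ]; push_cast
    field_simp
  have h := hasDerivAt_tsum_of_isPreconnected (t := Metric.ball 0 (|s| + 1)) (y₀ := s) (y := s)
    (g := fun k y => bc l k * y ^ k) (g' := fun k y => bc l k * (k * y ^ (k - 1))) hsum
    Metric.isOpen_ball (convex_ball _ _).isPreconnected
    (fun k y _ => (hasDerivAt_pow k y).const_mul _) (fun k y hy => ?_) (by simp)
    (hasSum_bg l s).summable (by simp)
  · refine h.congr_deriv (HasSum.tsum_eq ?_)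
    rw [← hasSum_nat_add_iff' 1]
    refine hasSum_of_eq (hasSum_bg_deriv l s) (fun k => ?_) ?_
    · push_cast; ring
    · simp
  · rw [mem_ball_zero_iff, Real.norm_eq_abs] at hy
    rw [norm_mul, norm_mul, norm_pow, Real.norm_eq_abs, Real.norm_eq_abs, Real.norm_eq_abs,
      Nat.abs_cast, mul_comm (k : ℝ) (1 / _), mul_assoc]
    gcongr
    exact abs_bc_le l k

/-- The series `∑ 2 k bc l k s^k`. -/
lemma hasSum_two_mul_bc (l : ℕ) (s : ℝ) :
    HasSum (fun k : ℕ => 2 * k * bc l k * s ^ k) (-s * bg (l + 1) s / (2 * l + 3)) := by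
  rw [← hasSum_nat_add_iff' 1]
  refine hasSum_of_eq ((hasSum_bg_deriv l s).mul_left (2 * s)) (fun k => ?_) ?_
  · push_cast; ring
  · simp; field_simp

/-- The contiguous relation `g_{l} = g_{l+1} - s g_{l+2} / ((2l+3)(2l+5))`. -/
lemma bg_recurrence (l : ℕ) (s : ℝ) :
    bg l s = bg (l + 1) s - s * bg (l + 2) s / ((2 * l + 3) * (2 * l + 5)) := by
  have h1 := (hasSum_bg (l + 1) s).add ((hasSum_two_mul_bc (l + 1) s).mul_left (1 / (2 * l + 3 : ℝ)))
  refine (hasSum_bg l s).unique ?_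
  refine hasSum_of_eq h1 (fun k => ?_) ?_
  · have h2 : bc l k = bc (l + 1) k * (1 + 2 * k / (2 * l + 3)) := by
      have hl : (2 * (l : ℝ) + 3) ≠ 0 := by positivity
      have h3 := lamk_mul_bc l k
      have h4 := bc_succ_eq l k
      rw [lamk] at h3
      push_cast at h3
      rw [eq_div_iff hl] at h4
      field_simp
      linear_combination (2 * l + 3) * h3 - (2 * k + 2 * l + 3) * h4
    rw [h2]; ring
  · push_cast; field_simp; ring

lemma abs_bg_sub_one_le (l : ℕ) (s : ℝ) : |bg l s - 1| ≤ |s| * Real.exp |s| / (l + 1) := by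
  have h1 : HasSum (fun k => bc l (k + 1) * s ^ (k + 1)) (bg l s - 1) := by
    have := (hasSum_nat_add_iff' (f := fun k => bc l k * s ^ k) 1).2 (hasSum_bg l s)
    simpa [bc] using this
  have h2 : HasSum (fun k : ℕ => |s| / (l + 1) * (|s| ^ k / k.factorial))
      (|s| / (l + 1) * Real.exp |s|) := by
    rw [Real.exp_eq_exp_ℝ]
    exact (NormedSpace.expSeries_div_hasSum_exp |s|).mul_left _
  rw [← h1.tsum_eq, ← Real.norm_eq_abs]
  refine (tsum_of_norm_bounded h2 fun k => ?_).trans (le_of_eq (by ring))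
  rw [norm_mul, norm_pow, Real.norm_eq_abs, Real.norm_eq_abs, pow_succ]
  have h3 := (abs_bc_succ_le l k).trans (div_le_div_of_nonneg_right (div_le_self (abs_nonneg _)
    (by linarith [k.cast_nonneg (α := ℝ)])) (by positivity))
  calc |bc l (k + 1)| * (|s| ^ k * |s|) ≤ (|bc l k| / (l + 1)) * (|s| ^ k * |s|) := by gcongr
    _ ≤ (1 / (k.factorial : ℝ) / (l + 1)) * (|s| ^ k * |s|) := by gcongr; exact abs_bc_le l k
    _ = _ := by ring

/-! ### Bessel functions of half-integer order -/

/-- The normalisation constant of `J_{l+1/2}`. -/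
def Cb (l : ℕ) : ℝ := 1 / ((2 : ℝ) ^ ((l : ℝ) + 1 / 2) * Real.Gamma (l + 1 / 2 + 1))

lemma Cb_pos (l : ℕ) : 0 < Cb l := by
  have : 0 < Real.Gamma ((l : ℝ) + 1 / 2 + 1) := Real.Gamma_pos_of_pos (by positivity)
  rw [Cb]; positivity

lemma Jhalf_eq (l : ℕ) {r : ℝ} (hr : 0 < r) :
    Jhalf l r = Cb l * r ^ ((l : ℝ) + 1 / 2) * bg l (r ^ 2) := by
  rw [Jhalf, besselJ, bg, ← tsum_mul_left]
  refine tsum_congr fun k => ?_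
  have hG (k : ℕ) : 0 < Real.Gamma ((k : ℝ) + (l + 1 / 2) + 1) :=
    Real.Gamma_pos_of_pos (by positivity)
  have hc : (-1 : ℝ) ^ k / (k.factorial * Real.Gamma (k + (l + 1 / 2) + 1)) / 4 ^ k
      = bc l k / Real.Gamma (l + 1 / 2 + 1) := by
    induction k with
    | zero => simp [bc]
    | succ k ih =>
      have h1 : Real.Gamma ((k + 1 : ℕ) + ((l : ℝ) + 1 / 2) + 1)
          = (k + (l + 1 / 2) + 1) * Real.Gamma (k + (l + 1 / 2) + 1) := by
        rw [← Real.Gamma_add_one (by positivity)]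
        congr 1; push_cast; ring
      have h2 : bc l (k + 1) / Real.Gamma (l + 1 / 2 + 1)
          = -(1 / lamk l (k + 1)) * (bc l k / Real.Gamma (l + 1 / 2 + 1)) := by
        rw [bc]; ring
      rw [h2, ← ih, h1, Nat.factorial_succ, pow_succ, pow_succ, lamk]
      have := (hG k).ne'
      push_cast
      field_simp
      ring
  have h4 : (r / 2) ^ (2 * (k : ℝ) + ((l : ℝ) + 1 / 2))
      = (r ^ 2) ^ k / 4 ^ k * (r ^ ((l : ℝ) + 1 / 2) / 2 ^ ((l : ℝ) + 1 / 2)) := by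
    rw [Real.rpow_add (by positivity), Real.div_rpow hr.le (by norm_num),
      Real.div_rpow hr.le (by norm_num)]
    congr 2
    · rw [← pow_mul, ← Real.rpow_natCast]; push_cast; rfl
    · rw [show (4 : ℝ) = 2 ^ 2 by norm_num, ← pow_mul, ← Real.rpow_natCast]; push_cast; rfl
  rw [h4, Cb]
  calc _ = ((-1 : ℝ) ^ k / (k.factorial * Real.Gamma (k + (l + 1 / 2) + 1)) / 4 ^ k)
        * ((r ^ 2) ^ k * (r ^ ((l : ℝ) + 1 / 2) / 2 ^ ((l : ℝ) + 1 / 2))) := by ring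
    _ = _ := by rw [hc]; ring

lemma Jhalf_div_sqrt (l : ℕ) {r : ℝ} (hr : 0 < r) :
    Jhalf l r / Real.sqrt r = Cb l * r ^ l * bg l (r ^ 2) := by
  rw [Jhalf_eq l hr, Real.rpow_add hr, Real.rpow_natCast, Real.sqrt_eq_rpow]
  have : r ^ (1 / 2 : ℝ) ≠ 0 := by positivity
  field_simp

lemma jt_eq {l : ℕ} (hl : 1 ≤ l) {r : ℝ} (hr : 0 < r) :
    jt l r = Cb l * r ^ (l - 1) * bg l (r ^ 2) := by
  obtain ⟨l, rfl⟩ := Nat.exists_eq_add_of_le' hl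
  have h : r ^ (3 / 2 : ℝ) = r * r ^ (1 / 2 : ℝ) := by
    rw [← Real.rpow_one_add' hr.le (by norm_num)]; norm_num
  rw [jt, Jhalf_eq _ hr, Real.rpow_add hr, Real.rpow_natCast, h, Nat.add_sub_cancel, pow_succ]
  have : r ^ (1 / 2 : ℝ) ≠ 0 := by positivity
  field_simp

lemma hasDerivAt_bg_sq (l : ℕ) (r : ℝ) :
    HasDerivAt (fun r => bg l (r ^ 2)) (-r * bg (l + 1) (r ^ 2) / (2 * l + 3)) r := by
  have := (hasDerivAt_bg l (r ^ 2)).comp r (hasDerivAt_pow 2 r)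
  refine this.congr_deriv ?_
  simp; field_simp

lemma mul_deriv_jt {l : ℕ} (hl : 1 ≤ l) {r : ℝ} (hr : 0 < r) :
    r * deriv (jt l) r = Cb l * r ^ (l - 1) *
      ((l - 1) * bg l (r ^ 2) - r ^ 2 * bg (l + 1) (r ^ 2) / (2 * l + 3)) := by
  have h1 : jt l =ᶠ[nhds r] fun r => Cb l * r ^ (l - 1) * bg l (r ^ 2) := by
    filter_upwards [lt_mem_nhds hr] with y hy using jt_eq hl hy
  have h2 : HasDerivAt (fun r => Cb l * r ^ (l - 1) * bg l (r ^ 2)) _ r :=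
    ((hasDerivAt_pow (l - 1) r).const_mul (Cb l)).mul (hasDerivAt_bg_sq l r)
  rw [h1.deriv_eq, h2.deriv]
  obtain ⟨l, rfl⟩ := Nat.exists_eq_add_of_le' hl
  rcases l with _ | l
  · simp; field_simp
  · simp [pow_succ]; field_simp; ring

lemma charZ_eq (l : ℕ) {r : ℝ} (hr : 0 < r) : charZ l r = Cb l * r ^ ((l : ℝ) + 1 / 2) *
      (l * bg l (r ^ 2) - r ^ 2 * bg (l + 1) (r ^ 2) / (2 * l + 3)) := by
  have h1 : Jhalf l =ᶠ[nhds r] fun r => Cb l * r ^ ((l : ℝ) + 1 / 2) * bg l (r ^ 2) := by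
    filter_upwards [lt_mem_nhds hr] with y hy using Jhalf_eq l hy
  have h2 : HasDerivAt (fun r => Cb l * r ^ ((l : ℝ) + 1 / 2) * bg l (r ^ 2)) _ r :=
    ((Real.hasDerivAt_rpow_const (p := (l : ℝ) + 1 / 2) (Or.inl hr.ne')).const_mul (Cb l)).mul
      (hasDerivAt_bg_sq l r)
  rw [charZ, h1.deriv_eq, Jhalf_eq l hr, h2.deriv, Real.rpow_sub_one hr.ne']
  field_simp
  ring

/-- The entire function whose zeros are the squares of the zeros of `charY l`. -/
def entY (l : ℕ) (κ : ℝ) : ℝ := (κ - (l - 1) * (2 * l + 1)) * bg l κ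
  - (κ - l * (l - 1) * (l + 2)) * (bg (l + 1) κ / (2 * l + 3))

/-- The entire function whose zeros are the squares of the zeros of `charZ l`. -/
def entZ (l : ℕ) (κ : ℝ) : ℝ := l * bg l κ - κ * (bg (l + 1) κ / (2 * l + 3))

lemma charZ_eq_zero_iff (l : ℕ) {r : ℝ} (hr : 0 < r) : charZ l r = 0 ↔ entZ l (r ^ 2) = 0 := by
  rw [charZ_eq l hr, mul_eq_zero, or_iff_right (mul_pos (Cb_pos l) (by positivity)).ne', entZ,
    mul_div_assoc]

lemma charY_eq {l : ℕ} (hl : 1 ≤ l) {r : ℝ} (hr : 0 < r) :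
    charY l r = Cb l * r ^ (l - 1) * r ^ 2 * entY l (r ^ 2) := by
  rw [charY, mul_assoc (r ^ 2 - _) r, mul_deriv_jt hl hr, jt_eq hl hr, entY]
  ring

lemma charY_eq_zero_iff {l : ℕ} (hl : 1 ≤ l) {r : ℝ} (hr : 0 < r) :
    charY l r = 0 ↔ entY l (r ^ 2) = 0 := by
  have := Cb_pos l
  rw [charY_eq hl hr, mul_eq_zero, or_iff_right (by positivity)]

/-! ### Zeros of the characteristic equations -/

open Filter Topology

/-- The odd double factorial `(2l+1)!!`. -/
def oddFact (l : ℕ) : ℝ := ((2 * l + 1).doubleFactorial : ℝ)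

lemma oddFact_pos (l : ℕ) : 0 < oddFact l := by
  rw [oddFact]; exact_mod_cast Nat.doubleFactorial_pos _

lemma oddFact_succ (l : ℕ) : oddFact (l + 1) = (2 * l + 3) * oddFact l := by
  rw [oddFact, oddFact, show 2 * (l + 1) + 1 = (2 * l + 1) + 2 by ring,
    Nat.doubleFactorial_add_two]
  push_cast; ring

/-- The Riccati–Bessel function `x j_l(x)`, where `j_l` is the spherical Bessel function. -/
def rb (l : ℕ) (x : ℝ) : ℝ := x ^ (l + 1) * bg l (x ^ 2) / oddFact l

lemma continuous_bg (l : ℕ) : Continuous (bg l) :=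
  continuous_iff_continuousAt.2 fun s => (hasDerivAt_bg l s).continuousAt

lemma continuous_rb (l : ℕ) : Continuous (rb l) := by
  unfold rb
  exact ((continuous_pow _).mul ((continuous_bg l).comp (continuous_pow 2))).div_const _

lemma rb_zero (x : ℝ) : rb 0 x = Real.sin x := by
  have hc (k : ℕ) : bc 0 k = (-1) ^ k / ((2 * k + 1).factorial : ℝ) := by
    induction k with
    | zero => simp [bc]
    | succ k ih =>
      rw [bc, ih, lamk, show 2 * (k + 1) + 1 = (2 * k + 1) + 1 + 1 by ring, Nat.factorial_succ (2 * k + 1 + 1),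
        Nat.factorial_succ (2 * k + 1), pow_succ]
      push_cast
      field_simp
      ring
  refine HasSum.unique ?_ (Real.hasSum_sin x)
  refine hasSum_of_eq ((hasSum_bg 0 (x ^ 2)).mul_left x) (fun k => ?_) ?_
  · rw [hc]; ring
  · simp [rb, oddFact]

lemma rb_one {x : ℝ} (hx : x ≠ 0) : rb 1 x = Real.sin x / x - Real.cos x := by
  have h0 (x : ℝ) : x * bg 0 (x ^ 2) = Real.sin x := by rw [← rb_zero]; simp [rb, oddFact]
  have h1 : HasDerivAt (fun x => x * bg 0 (x ^ 2)) _ x := (hasDerivAt_id x).mul (hasDerivAt_bg_sq 0 x)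
  rw [funext h0] at h1
  have h2 := h1.unique (Real.hasDerivAt_sin x)
  have h3 : oddFact 1 = 3 := by norm_num [oddFact, Nat.doubleFactorial]
  have h4 := h0 x
  rw [rb, h3, ← h4, ← h2]
  simp
  field_simp
  ring

lemma rb_recurrence (l : ℕ) {x : ℝ} (hx : x ≠ 0) :
    rb (l + 2) x = (2 * l + 3) / x * rb (l + 1) x - rb l x := by
  have h := bg_recurrence l (x ^ 2)
  have := oddFact_pos l
  rw [rb, rb, rb, oddFact_succ (l + 1), oddFact_succ l, h]
  push_cast
  field_simp
  ring

lemma tendsto_div_of_tendsto_sub_sin {h : ℝ → ℝ} {φ : ℝ}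
    (ht : Tendsto (fun x => h x - Real.sin (x - φ)) atTop (𝓝 0)) :
    Tendsto (fun x => h x / x) atTop (𝓝 0) := by
  have h1 : ∀ᶠ x in atTop, |h x / x| ≤ 2 * x⁻¹ := by
    filter_upwards [ht.eventually (Metric.ball_mem_nhds 0 one_pos), eventually_gt_atTop 0]
      with x hx h0
    rw [dist_zero_right, Real.norm_eq_abs] at hx
    have : |h x| ≤ 2 := by
      have := abs_add_le (h x - Real.sin (x - φ)) (Real.sin (x - φ))
      rw [sub_add_cancel] at this
      linarith [Real.abs_sin_le_one (x - φ)]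
    rw [abs_div, abs_of_pos h0, div_eq_mul_inv]
    gcongr
  exact squeeze_zero_norm' h1 (by simpa using tendsto_inv_atTop_zero.const_mul (2 : ℝ))

/-- `x j_l(x)` is asymptotic to `sin (x - l π / 2)`. -/
lemma tendsto_rb_sub_sin (l : ℕ) :
    Tendsto (fun x => rb l x - Real.sin (x - l * (Real.pi / 2))) atTop (𝓝 0) := by
  induction l using Nat.twoStepInduction with
  | zero => simp [rb_zero]
  | one =>
    have h : Tendsto (fun x => Real.sin x / x) atTop (𝓝 0) :=
      tendsto_div_of_tendsto_sub_sin (φ := 0) (by simp)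
    refine h.congr' ?_
    filter_upwards [eventually_ne_atTop 0] with x hx
    rw [rb_one hx, Nat.cast_one, one_mul, Real.sin_sub_pi_div_two]; ring
  | more l h0 h1 =>
    have h2 := ((tendsto_div_of_tendsto_sub_sin h1).const_mul (2 * (l : ℝ) + 3)).sub h0
    rw [mul_zero, sub_zero] at h2
    refine h2.congr' ?_
    filter_upwards [eventually_ne_atTop 0] with x hx
    rw [rb_recurrence l hx]
    have : x - ((l + 2 : ℕ) : ℝ) * (Real.pi / 2) = x - l * (Real.pi / 2) - Real.pi := by
      push_cast; ring
    rw [this, Real.sin_sub_pi]; ring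

lemma exists_zero_of_tendsto_sub_sin {h : ℝ → ℝ} {φ : ℝ} (hc : ContinuousOn h (Set.Ioi 0))
    (ht : Tendsto (fun x => h x - Real.sin (x - φ)) atTop (𝓝 0)) (R : ℝ) :
    ∃ a b, max R 0 < a ∧ 0 < h a ∧ a < b ∧ h b = 0 := by
  obtain ⟨M, hM⟩ := eventually_atTop.1 (ht.eventually (Metric.ball_mem_nhds 0 one_pos))
  obtain ⟨n, hn⟩ := exists_nat_gt ((max (max R 0) M - φ))
  set a : ℝ := φ + Real.pi / 2 + n * (2 * Real.pi) with ha
  have hpi := Real.pi_gt_three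
  have hna : max (max R 0) M < a := by
    have : (n : ℝ) ≤ n * (2 * Real.pi) := le_mul_of_one_le_right n.cast_nonneg (by linarith)
    linarith
  have hRa := (le_max_left (max R 0) M).trans_lt hna
  have h0a := (le_max_right R 0).trans_lt hRa
  have hMa := (le_max_right (max R 0) M).trans_lt hna
  have hsa : Real.sin (a - φ) = 1 := by
    rw [ha, show φ + Real.pi / 2 + n * (2 * Real.pi) - φ = Real.pi / 2 + n * (2 * Real.pi) by ring,
      Real.sin_add_nat_mul_two_pi, Real.sin_pi_div_two]
  have hsb : Real.sin (a + Real.pi - φ) = -1 := by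
    rw [show a + Real.pi - φ = a - φ + Real.pi by ring, Real.sin_add_pi, hsa]
  have h1 := hM a hMa.le
  have h2 := hM (a + Real.pi) (by linarith)
  rw [dist_zero_right, Real.norm_eq_abs, abs_lt] at h1 h2
  rw [hsa] at h1
  rw [hsb] at h2
  have hha : 0 < h a := by linarith [h1.1]
  have hhb : h (a + Real.pi) < 0 := by linarith [h2.2]
  obtain ⟨b, hb, hb0⟩ := intermediate_value_Icc' (by linarith : a ≤ a + Real.pi)
    (hc.mono fun x hx => h0a.trans_le hx.1) ⟨hhb.le, hha.le⟩
  refine ⟨a, b, hRa, hha, lt_of_le_of_ne hb.1 ?_, hb0⟩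
  rintro rfl
  exact hha.ne' hb0

/-- A function whose positive zeros are unbounded and locally finite down to `0` has its positive
zeros listed by `posZero`. -/
lemma posZerosListed_of_finite {f : ℝ → ℝ} (hfin : ∀ R, {r : ℝ | 0 < r ∧ r ≤ R ∧ f r = 0}.Finite)
    (hinf : ∀ R, ∃ r, R < r ∧ f r = 0) : PosZerosListed f := by
  have hmin (a : ℝ) (ha : 0 ≤ a) : IsLeast {r : ℝ | a < r ∧ f r = 0} (sInf {r : ℝ | a < r ∧ f r = 0}) := by
    obtain ⟨r, hr, hr0⟩ := hinf a
    have hF : {x : ℝ | a < x ∧ x ≤ r ∧ f x = 0}.Finite :=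
      (hfin r).subset fun x hx => ⟨ha.trans_lt hx.1, hx.2⟩
    obtain ⟨m, hm, hm2⟩ := hF.exists_minimalFor id _ ⟨r, hr, le_rfl, hr0⟩
    have hl : IsLeast {r : ℝ | a < r ∧ f r = 0} m := by
      refine ⟨⟨hm.1, hm.2.2⟩, fun x hx => ?_⟩
      by_contra! hlt
      exact absurd (hm2 ⟨hx.1, hlt.le.trans hm.2.1, hx.2⟩ hlt.le) (not_le.2 hlt)
    rwa [hl.csInf_eq]
  have hnn (m : ℕ) : 0 ≤ posZero f m ∧ IsLeast {r : ℝ | posZero f m < r ∧ f r = 0} (posZero f (m + 1)) := by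
    induction m with
    | zero => exact ⟨le_rfl, hmin _ le_rfl⟩
    | succ m ih =>
      have h := ih.1.trans ih.2.1.1.le
      exact ⟨h, hmin _ h⟩
  have hmono : StrictMono (posZero f) := strictMono_nat_of_lt_succ fun m => (hnn m).2.1.1
  refine ⟨hmono, Set.Subset.antisymm ?_ ?_⟩
  · rintro r ⟨hr, hr0⟩
    by_contra hne
    have hlt (m : ℕ) : posZero f m < r := by
      induction m with
      | zero => exact hr
      | succ m ih =>
        refine lt_of_le_of_ne ((hnn m).2.2 ⟨ih, hr0⟩) fun h => hne ⟨m + 1, by omega, h⟩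
    refine (Set.infinite_of_injective_forall_mem (f := fun m => posZero f (m + 1))
      (fun a b h => by simpa using hmono.injective h) fun m => ?_) (hfin r)
    exact ⟨(hnn m).1.trans_lt (hnn m).2.1.1, (hlt _).le, (hnn m).2.1.2⟩
  · rintro r ⟨m, hm, rfl⟩
    obtain ⟨m, rfl⟩ := Nat.exists_eq_add_of_le' hm
    exact ⟨(hnn m).1.trans_lt (hnn m).2.1.1, (hnn m).2.1.2⟩

lemma posZerosListed_of_asymptotic {f F h : ℝ → ℝ} {φ : ℝ} (hF : AnalyticOnNhd ℝ F Set.univ)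
    (hfF : ∀ r, 0 < r → (f r = 0 ↔ F (r ^ 2) = 0))
    (hhF : ∀ r, 0 < r → (h r = 0 ↔ F (r ^ 2) = 0)) (hc : ContinuousOn h (Set.Ioi 0))
    (ht : Tendsto (fun x => h x - Real.sin (x - φ)) atTop (𝓝 0)) : PosZerosListed f := by
  refine posZerosListed_of_finite (fun R => ?_) fun R => ?_
  · obtain ⟨a, -, ha, ha0, -, -⟩ := exists_zero_of_tendsto_sub_sin hc ht 0
    rw [max_self] at ha
    have hA : AnalyticOnNhd ℝ (fun r => F (r ^ 2)) Set.univ :=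
      hF.comp (g := F) (f := fun r : ℝ => r ^ 2) (t := Set.univ)
        (fun x _ => analyticAt_id.pow 2) (fun _ _ => trivial)
    have h1 := hA.preimage_zero_mem_codiscrete (x := a)
      (fun h0 => ha0.ne' ((hhF a ha).2 h0))
    have h2 := (isCompact_Icc (a := (0 : ℝ)) (b := R)).finite_sdiff_of_mem_codiscreteWithin
      (Filter.codiscreteWithin_mono (Set.subset_univ _) h1)
    refine h2.subset fun r hr => ⟨⟨hr.1.le, hr.2.1⟩, fun hr2 => hr2 ((hfF r hr.1).1 hr.2.2)⟩
  · obtain ⟨a, b, ha, -, hab, hb⟩ := exists_zero_of_tendsto_sub_sin hc ht R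
    have h0 : 0 < b := ((le_max_right R 0).trans_lt ha).trans hab
    exact ⟨b, ((le_max_left R 0).trans_lt ha).trans hab, (hfF b h0).2 ((hhF b h0).1 hb)⟩

theorem posZerosListed_charZ (l : ℕ) : PosZerosListed (charZ l) := by
  refine posZerosListed_of_asymptotic (F := entZ l) (h := fun r => l * (rb l r / r) - rb (l + 1) r)
    (φ := ((l : ℝ) + 1) * (Real.pi / 2) - Real.pi) ?_ (fun r hr => charZ_eq_zero_iff l hr) ?_ ?_ ?_
  · exact (analyticOnNhd_const.mul (analyticOnNhd_bg l)).sub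
      (analyticOnNhd_id.mul ((analyticOnNhd_bg (l + 1)).mul analyticOnNhd_const))
  · intro r hr
    have h := oddFact_pos l
    have : l * (rb l r / r) - rb (l + 1) r = r ^ l / oddFact l * entZ l (r ^ 2) := by
      rw [rb, rb, oddFact_succ, entZ]; field_simp; ring
    rw [this, mul_eq_zero, or_iff_right (by positivity)]
  · exact (continuousOn_const.mul ((continuous_rb l).continuousOn.div continuousOn_id
      fun x hx => ne_of_gt hx)).sub (continuous_rb _).continuousOn
  · have h := ((tendsto_div_of_tendsto_sub_sin (tendsto_rb_sub_sin l)).const_mul (l : ℝ)).sub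
      (tendsto_rb_sub_sin (l + 1))
    rw [mul_zero, sub_zero] at h
    refine h.congr fun x => ?_
    rw [show x - (((l : ℝ) + 1) * (Real.pi / 2) - Real.pi)
      = x - ((l + 1 : ℕ) : ℝ) * (Real.pi / 2) + Real.pi by push_cast; ring, Real.sin_add_pi]
    ring

theorem posZerosListed_charY {l : ℕ} (hl : 1 ≤ l) : PosZerosListed (charY l) := by
  refine posZerosListed_of_asymptotic (F := entY l)
    (h := fun r => (1 - (l - 1) * (2 * l + 1) * (r⁻¹ * r⁻¹)) * rb l r
      - (1 - l * (l - 1) * (l + 2) * (r⁻¹ * r⁻¹)) * (rb (l + 1) r / r))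
    (φ := (l : ℝ) * (Real.pi / 2)) ?_ (fun r hr => charY_eq_zero_iff hl hr) ?_ ?_ ?_
  · exact ((analyticOnNhd_id.sub analyticOnNhd_const).mul (analyticOnNhd_bg l)).sub
      ((analyticOnNhd_id.sub analyticOnNhd_const).mul
        ((analyticOnNhd_bg (l + 1)).mul analyticOnNhd_const))
  · intro r hr
    have h := oddFact_pos l
    have : (1 - (l - 1) * (2 * l + 1) * (r⁻¹ * r⁻¹)) * rb l r
      - (1 - l * (l - 1) * (l + 2) * (r⁻¹ * r⁻¹)) * (rb (l + 1) r / r)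
        = r ^ (l + 1) / oddFact l / r ^ 2 * entY l (r ^ 2) := by
      rw [rb, rb, oddFact_succ, entY]; field_simp; ring
    rw [this, mul_eq_zero, or_iff_right (by positivity)]
  · have hi : ContinuousOn (fun r : ℝ => r⁻¹) (Set.Ioi 0) :=
      continuousOn_inv₀.mono fun x hx => ne_of_gt hx
    exact ((continuousOn_const.sub (continuousOn_const.mul (hi.mul hi))).mul
      (continuous_rb l).continuousOn).sub ((continuousOn_const.sub
        (continuousOn_const.mul (hi.mul hi))).mul
          ((continuous_rb _).continuousOn.div continuousOn_id fun x hx => ne_of_gt hx))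
  · have hi := tendsto_inv_atTop_zero (𝕜 := ℝ)
    have h0 := tendsto_rb_sub_sin l
    have h1 := tendsto_div_of_tendsto_sub_sin h0
    have h2 := tendsto_div_of_tendsto_sub_sin (tendsto_rb_sub_sin (l + 1))
    have h3 := (h0.sub ((h1.mul hi).const_mul (((l : ℝ) - 1) * (2 * l + 1)))).sub
      ((((hi.mul hi).const_mul ((l : ℝ) * (l - 1) * (l + 2))).const_sub 1).mul h2)
    simp only [mul_zero, sub_zero] at h3
    refine h3.congr fun x => ?_
    ring

/-! ### A nonvanishing coefficient -/

/-- The spherical Bessel functions do not vanish at square roots of positive integers. By the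
recurrence, a zero at `√N` would make `N^k g_{l+k+1}(N) / (2l+2k+3)!!` an integral multiple of a
fixed number for all `k`; but these numbers tend to zero and are eventually positive. -/
lemma bg_natCast_ne_zero {N : ℕ} (hN : 0 < N) (l : ℕ) : bg l (N : ℝ) ≠ 0 := by
  intro hl
  have hN' : (0 : ℝ) < N := by exact_mod_cast hN
  -- `e k` is an integral multiple of `c`, up to a power of `N`
  set e : ℕ → ℝ := fun k => bg k N / oddFact k with he
  have hrec (k : ℕ) : N * e (k + 2) = (2 * k + 3) * e (k + 1) - e k := by
    have h := bg_recurrence k N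
    have := oddFact_pos k
    simp only [he]
    rw [oddFact_succ (k + 1), oddFact_succ k, h]
    push_cast
    field_simp
    ring
  have hint (k : ℕ) : (∃ a : ℤ, N ^ k * e (l + k) = a * e (l + 1)) ∧
      ∃ a : ℤ, N ^ k * e (l + k + 1) = a * e (l + 1) := by
    induction k with
    | zero => exact ⟨⟨0, by simp [he, hl]⟩, 1, by simp⟩
    | succ k ih =>
      obtain ⟨⟨a, ha⟩, b, hb⟩ := ih
      refine ⟨⟨N * b, ?_⟩, (2 * (l + k : ℕ) + 3) * b - a, ?_⟩
      · rw [← add_assoc, pow_succ]; push_cast; linear_combination (N : ℝ) * hb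
      · have := hrec (l + k)
        rw [show l + (k + 1) + 1 = l + k + 2 by ring, pow_succ]
        push_cast at this ⊢
        linear_combination (N : ℝ) ^ k * this + (2 * ((l : ℝ) + k) + 3) * hb - ha
  -- the values `g_k(N)` tend to one
  have hone : Tendsto (fun k => bg k (N : ℝ)) atTop (𝓝 1) := by
    have h1 : Tendsto (fun k : ℕ => |(N : ℝ)| * Real.exp |(N : ℝ)| * (1 / ((k : ℝ) + 1))) atTop
        (𝓝 0) := by
      simpa using (tendsto_one_div_add_atTop_nhds_zero_nat (𝕜 := ℝ)).const_mul
        (|(N : ℝ)| * Real.exp |(N : ℝ)|)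
    have h2 : Tendsto (fun k => bg k (N : ℝ) - 1) atTop (𝓝 0) := squeeze_zero_norm
      (fun k => (abs_bg_sub_one_le k (N : ℝ)).trans (le_of_eq (by ring))) h1
    simpa using h2.add_const 1
  have hsmall : Tendsto (fun k => (N : ℝ) ^ k * e (l + k + 1)) atTop (𝓝 0) := by
    have h1 : Tendsto (fun k => bg (l + k + 1) (N : ℝ)) atTop (𝓝 1) :=
      hone.comp (tendsto_atTop_mono (fun k => (by simp only [id]; omega : id k ≤ l + k + 1)) tendsto_id)
    have h2 : Tendsto (fun k => (N : ℝ) ^ k / oddFact (l + k + 1)) atTop (𝓝 0) := by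
      refine squeeze_zero (fun k => div_nonneg (by positivity) (oddFact_pos _).le) (fun k => ?_)
        (FloorSemiring.tendsto_pow_div_factorial_atTop (N : ℝ))
      have : ((k.factorial : ℕ) : ℝ) ≤ oddFact (l + k + 1) := by
        induction k with
        | zero =>
          rw [oddFact]; exact_mod_cast Nat.doubleFactorial_pos _
        | succ k ih =>
          rw [Nat.factorial_succ, ← add_assoc, oddFact_succ]
          push_cast
          have := oddFact_pos (l + k + 1)
          refine mul_le_mul ?_ ih (by positivity) (by positivity)
          have : (0 : ℝ) ≤ l := l.cast_nonneg
          have : (0 : ℝ) ≤ k := k.cast_nonneg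
          linarith
      gcongr
    have h3 := h1.mul h2
    rw [one_mul] at h3
    refine h3.congr fun k => ?_
    simp only [he]; ring
  have hc0 : e (l + 1) ≠ 0 := by
    intro h0
    have hz (k : ℕ) : bg (l + k + 1) (N : ℝ) = 0 := by
      obtain ⟨a, ha⟩ := (hint k).2
      rw [h0, mul_zero] at ha
      have := (mul_eq_zero.1 ha).resolve_left (by positivity)
      exact (div_eq_zero_iff.1 this).resolve_right (oddFact_pos _).ne'
    have h1 : Tendsto (fun k => bg (l + k + 1) (N : ℝ)) atTop (𝓝 1) :=
      hone.comp (tendsto_atTop_mono (fun k => (by simp only [id]; omega : id k ≤ l + k + 1)) tendsto_id)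
    simp only [hz] at h1
    exact zero_ne_one (tendsto_nhds_unique tendsto_const_nhds h1)
  have h1 : ∀ᶠ k in atTop, |(N : ℝ) ^ k * e (l + k + 1)| < |e (l + 1)| := by
    have := hsmall.eventually (Metric.ball_mem_nhds 0 (abs_pos.2 hc0))
    simpa using this
  have h2 : ∀ᶠ k in atTop, 0 < bg (l + k + 1) (N : ℝ) :=
    (hone.comp (tendsto_atTop_mono (fun k => (by simp only [id]; omega : id k ≤ l + k + 1)) tendsto_id :
      Tendsto (fun k => l + k + 1) atTop atTop)).eventually (lt_mem_nhds one_pos)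
  obtain ⟨k, hk1, hk2⟩ := (h1.and h2).exists
  obtain ⟨a, ha⟩ := (hint k).2
  rw [ha, abs_mul, mul_lt_iff_lt_one_left (abs_pos.2 hc0)] at hk1
  have ha0 : a = 0 := by
    rw [← Int.abs_lt_one_iff]; exact_mod_cast hk1
  rw [ha0, Int.cast_zero, zero_mul] at ha
  have := (mul_eq_zero.1 ha).resolve_left (by positivity)
  exact hk2.ne' ((div_eq_zero_iff.1 this).resolve_right (oddFact_pos _).ne')

/-! ### Series of polynomial fields -/

lemma norm_fld_R2_pow_smul_le (k : ℕ) (P : VP) : ‖fld (R2 ^ k • P)‖ ≤ ‖fld P‖ := by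
  refine Lp.norm_le_norm_of_ae_le ?_
  filter_upwards [fld_ae (R2 ^ k • P), fld_ae P, ae_norm_lt_one] with x h1 h2 hx
  rw [h1, h2]
  have : vev (R2 ^ k • P) x = (‖x‖ ^ 2) ^ k • vev P x := by
    ext i; simp
  rw [this, norm_smul, norm_pow, norm_pow, norm_norm]
  exact mul_le_of_le_one_left (norm_nonneg _)
    (pow_le_one₀ (by positivity) (pow_le_one₀ (norm_nonneg _) hx.le))

lemma norm_jet_le (w : Jet) : ‖w‖ ≤ ∑ i, ‖w i‖ := by
  refine abs_le_of_sq_le_sq' ?_ (by positivity) |>.2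
  rw [PiLp.norm_sq_eq_of_L2]
  exact Finset.sum_sq_le_sq_sum_of_nonneg fun _ _ => norm_nonneg _

lemma exists_norm_jet_R2_pow_smul_le (P : VP) :
    ∃ M, 0 ≤ M ∧ ∀ k : ℕ, ‖jet (R2 ^ k • P)‖ ≤ (2 * k + 1) * M := by
  refine ⟨‖fld P‖ + ∑ j, (‖fld (dv j P)‖ + ‖fld ((X j : Poly) • P)‖), by positivity,
    fun k => (norm_jet_le _).trans ?_⟩
  rw [Fin.sum_univ_succ (n := 3), mul_add, Finset.mul_sum]
  have hk : (0 : ℝ) ≤ k := k.cast_nonneg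
  refine add_le_add ?_ (Finset.sum_le_sum fun j _ => ?_)
  · rw [jet_zero_apply]
    refine (norm_fld_R2_pow_smul_le k P).trans (le_mul_of_one_le_left (norm_nonneg _) (by linarith))
  · rw [jet_succ_apply]
    rcases k with _ | k
    · rw [pow_zero, one_smul, Nat.cast_zero, mul_zero, zero_add, one_mul]
      exact le_add_of_nonneg_right (norm_nonneg _)
    · have e : dv j (R2 ^ (k + 1) • P) = (2 * ((k : ℝ) + 1)) • (R2 ^ k • ((X j : Poly) • P))
          + R2 ^ (k + 1) • dv j P := by
        rw [dv_smul, pderiv_R2_pow_succ]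
        ext1 i
        have := natCast_mul_eq_smul (2 * (k + 1)) (R2 ^ k * (X j * P i))
        push_cast at this
        simp only [Pi.add_apply, Pi.smul_apply, smul_eq_mul, ← this]
        ring
      have h1 := norm_fld_R2_pow_smul_le k ((X j : Poly) • P)
      have h2 := norm_fld_R2_pow_smul_le (k + 1) (dv j P)
      rw [e, LinearMap.map_add fld, LinearMap.map_smul fld (2 * ((k : ℝ) + 1))]
      refine (norm_add_le _ _).trans ?_
      rw [norm_smul, Real.norm_of_nonneg (by positivity)]
      push_cast
      have := norm_nonneg (fld (dv j P))
      have := norm_nonneg (fld ((X j : Poly) • P))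
      have hk : (0 : ℝ) ≤ k := k.cast_nonneg
      nlinarith [mul_le_mul_of_nonneg_left h1 (by positivity : 0 ≤ 2 * ((k : ℝ) + 1))]

/-- The poloidal polynomial fields as admissible fields. -/
def jpf (l k : ℕ) : HV := ⟨jet (pf l k), jet_pf_mem l k⟩

/-- The toroidal polynomial fields as admissible fields. -/
def jqf (l k : ℕ) : HV := ⟨jet (qf l k), jet_qf_mem l k⟩

lemma embV_jpf (l k : ℕ) : embV (jpf l k) = fld (pf l k) := rfl
lemma embV_jqf (l k : ℕ) : embV (jqf l k) = fld (qf l k) := rfl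

lemma two_mul_add_one_le (k : ℕ) : (2 * k + 1 : ℝ) ≤ 2 * 2 ^ k := by
  have : k + 1 ≤ 2 ^ k := Nat.lt_two_pow_self
  have h : (k + 1 : ℝ) ≤ 2 ^ k := by exact_mod_cast this
  linarith

lemma exists_norm_jpf_le (l : ℕ) : ∃ M, ∀ k, ‖jpf l k‖ ≤ M * 4 ^ k := by
  obtain ⟨M1, hM1, h1⟩ := exists_norm_jet_R2_pow_smul_le (harm l • xvec)
  obtain ⟨M2, hM2, h2⟩ := exists_norm_jet_R2_pow_smul_le (pgrad (harm l))
  refine ⟨4 * l * M1 + 4 * (l + 1) * M2, fun k => ?_⟩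
  change ‖jet (pf l k)‖ ≤ _
  have hk : (0 : ℝ) ≤ k := k.cast_nonneg
  have hl : (0 : ℝ) ≤ l := l.cast_nonneg
  have h4 : (4 : ℝ) ^ k = 2 ^ k * 2 ^ k := by rw [← mul_pow]; norm_num
  have hb := two_mul_add_one_le k
  have hb2 : (2 * k + 1 : ℝ) * (2 * k + 1) ≤ 4 * 4 ^ k := by
    rw [h4, show (4 : ℝ) * (2 ^ k * 2 ^ k) = (2 * 2 ^ k) * (2 * 2 ^ k) by ring]
    gcongr
  have e1 : ‖jet (R2 ^ (k - 1) • (harm l • xvec))‖ ≤ (2 * k + 1) * M1 := by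
    refine (h1 _).trans ?_
    have : ((k - 1 : ℕ) : ℝ) ≤ k := by exact_mod_cast Nat.sub_le k 1
    gcongr
  rw [pf_eq, map_sub, LinearMap.map_smul jet, LinearMap.map_smul jet]
  refine (norm_sub_le _ _).trans ?_
  rw [norm_smul, norm_smul, Real.norm_of_nonneg (by positivity),
    Real.norm_of_nonneg (by positivity)]
  calc _ ≤ (2 * k + 1 : ℝ) * l * ((2 * k + 1) * M1)
        + (2 * k + 1) * (l + 1) * ((2 * k + 1) * M2) := by
        refine add_le_add (mul_le_mul ?_ e1 (norm_nonneg _) (by positivity))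
          (mul_le_mul ?_ (h2 k) (norm_nonneg _) (by positivity))
        · nlinarith
        · nlinarith
    _ = (2 * k + 1 : ℝ) * (2 * k + 1) * (l * M1 + (l + 1) * M2) := by ring
    _ ≤ 4 * 4 ^ k * (l * M1 + (l + 1) * M2) := by gcongr
    _ = _ := by ring

lemma exists_norm_jqf_le (l : ℕ) : ∃ M, ∀ k, ‖jqf l k‖ ≤ M * 4 ^ k := by
  obtain ⟨M1, hM1, h1⟩ := exists_norm_jet_R2_pow_smul_le (qf l 0)
  refine ⟨2 * M1, fun k => ?_⟩
  change ‖jet (qf l k)‖ ≤ _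
  rw [qf_eq_smul]
  refine (h1 k).trans ?_
  have h2 : (2 : ℝ) ^ k ≤ 4 ^ k := by gcongr; norm_num
  have h3 := two_mul_add_one_le k
  calc _ ≤ (2 * 4 ^ k) * M1 := by gcongr; linarith
    _ = _ := by ring

lemma summable_bc_smul (l : ℕ) (κ : ℝ) {J : ℕ → HV} (h : ∃ M, ∀ k, ‖J k‖ ≤ M * 4 ^ k) :
    Summable fun k => (bc l k * κ ^ k) • J k := by
  obtain ⟨M, hM⟩ := h
  refine .of_norm_bounded ((Real.summable_pow_div_factorial (|κ| * 4)).mul_left M) fun k => ?_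
  rw [norm_smul, norm_mul, norm_pow, Real.norm_eq_abs, Real.norm_eq_abs]
  calc |bc l k| * |κ| ^ k * ‖J k‖ ≤ (1 / (k.factorial : ℝ)) * |κ| ^ k * (M * 4 ^ k) := by
        gcongr
        · exact abs_bc_le l k
        · exact hM k
    _ = _ := by rw [mul_pow]; ring

/-- The solution of `Δ u = -κ u` of poloidal type that is regular at the origin. -/
def yser (l : ℕ) (κ : ℝ) : HV := ∑' k, (bc l k * κ ^ k) • jpf l k

/-- The solution of `Δ u = -κ u` of toroidal type that is regular at the origin. -/
def zser (l : ℕ) (κ : ℝ) : HV := ∑' k, (bc l k * κ ^ k) • jqf l k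

lemma hasSum_yser (l : ℕ) (κ : ℝ) : HasSum (fun k => (bc l k * κ ^ k) • jpf l k) (yser l κ) :=
  (summable_bc_smul l κ (exists_norm_jpf_le l)).hasSum

lemma hasSum_zser (l : ℕ) (κ : ℝ) : HasSum (fun k => (bc l k * κ ^ k) • jqf l k) (zser l κ) :=
  (summable_bc_smul l κ (exists_norm_jqf_le l)).hasSum

/-! ### Pointwise values of the series -/

lemma ae_eq_of_hasSum {F : ℕ → VP} {a : ℕ → ℝ} {u : L2Field} {f : E3 → E3}
    (h : HasSum (fun k => a k • fld (F k)) u)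
    (hf : ∀ x i, HasSum (fun k => a k * pev (F k i) x) (f x i)) : u =ᵐ[ballMeasure] f := by
  have h1 := h.tendsto_sum_nat
  have e (n : ℕ) : ∑ k ∈ Finset.range n, a k • fld (F k)
      = fld (∑ k ∈ Finset.range n, a k • F k) := by
    rw [map_sum]; exact Finset.sum_congr rfl fun k _ => (LinearMap.map_smul fld _ _).symm
  simp only [e] at h1
  obtain ⟨ns, hns, hae⟩ := (tendstoInMeasure_of_tendsto_Lp h1).exists_seq_tendsto_ae
  have h2 : ∀ᵐ x ∂ballMeasure, ∀ n : ℕ, fld (∑ k ∈ Finset.range n, a k • F k) x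
      = vev (∑ k ∈ Finset.range n, a k • F k) x := ae_all_iff.2 fun n => fld_ae _
  filter_upwards [hae, h2] with x hx h2
  refine PiLp.ext fun i => ?_
  have h3 : Tendsto (fun n => vev (∑ k ∈ Finset.range (ns n), a k • F k) x i) atTop (𝓝 (u x i)) := by
    simp only [h2] at hx
    exact ((EuclideanSpace.proj (𝕜 := ℝ) i).continuous.tendsto (u x)).comp hx
  have h4 := (hf x i).tendsto_sum_nat.comp hns.tendsto_atTop
  refine tendsto_nhds_unique h3 (h4.congr fun n => ?_)
  simp

/-- The pointwise value of `yser`. -/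
lemma yser_ae (l : ℕ) (κ : ℝ) : embV (yser l κ) =ᵐ[ballMeasure] fun x =>
    WithLp.toLp 2 fun i => -(l * κ * bg (l + 1) (κ * ‖x‖ ^ 2) / (2 * l + 3)) * (pev (harm l) x * x i)
      - ((l + 1) * bg l (κ * ‖x‖ ^ 2)
          - κ * ‖x‖ ^ 2 * bg (l + 1) (κ * ‖x‖ ^ 2) / (2 * l + 3)) * pev (pderiv i (harm l)) x := by
  refine ae_eq_of_hasSum (F := pf l) (a := fun k => bc l k * κ ^ k) ?_ fun x i => ?_
  · simpa only [Function.comp_def, map_smul, embV_jpf] using (hasSum_yser l κ).mapL embV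
  · set ρ : ℝ := κ * ‖x‖ ^ 2 with hρ
    have h0 := (hasSum_bg l ρ).mul_left ((l + 1) * pev (pderiv i (harm l)) x)
    have h1 := (hasSum_two_mul_bc l ρ).mul_left (pev (pderiv i (harm l)) x)
    have h2 : HasSum (fun k : ℕ => 2 * k * l * bc l k * κ ^ k * (‖x‖ ^ 2) ^ (k - 1)
        * (pev (harm l) x * x i))
        (-(l * κ * bg (l + 1) ρ / (2 * l + 3)) * (pev (harm l) x * x i)) := by
      refine HasSum.mul_right _ ?_
      rw [← hasSum_nat_add_iff' 1]
      refine hasSum_of_eq ((hasSum_bg_deriv l ρ).mul_left (2 * l * κ)) (fun k => ?_) ?_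
      · rw [hρ, mul_pow, Nat.add_sub_cancel]; push_cast; ring
      · simp; field_simp
    refine hasSum_of_eq (h2.sub (h0.add h1)) (fun k => ?_) ?_
    · simp only [pf, pev_sub, pev_mul, pev_pow, pev_R2, pev_X, pev_add, pev_natCast, pev_ofNat,
        pev_one, hρ, mul_pow]
      ring
    · ring

lemma zser_ae (l : ℕ) (κ : ℝ) : embV (zser l κ) =ᵐ[ballMeasure] fun x =>
    bg l (κ * ‖x‖ ^ 2) • vev (crossf l) x := by
  refine ae_eq_of_hasSum (F := qf l) (a := fun k => bc l k * κ ^ k) ?_ fun x i => ?_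
  · simpa only [Function.comp_def, map_smul, embV_jqf] using (hasSum_zser l κ).mapL embV
  · refine hasSum_of_eq ((hasSum_bg l (κ * ‖x‖ ^ 2)).mul_right (pev (crossf l i) x))
      (fun k => ?_) ?_
    · simp [qf, mul_pow, mul_assoc]
    · simp

/-! ### The weak form of the series -/

/-- The scalar product of `u` with `∇H_l`. -/
def sv (l : ℕ) (u : HV) : ℝ := inner ℝ (fld (pgrad (harm l))) (embV u)

/-- The boundary pairing of `u` with `∇H_l`. -/
def tv (l : ℕ) (u : HV) : ℝ := tr u (pgrad (harm l))

/-- The boundary pairing of `u` with `x × ∇H_l`. -/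
def qv (l : ℕ) (u : HV) : ℝ := tr u (qf l 0)

lemma gradInner_jet {P : VP} (hP : jet P ∈ HV) (v : HV) :
    gradInner (embV ⟨jet P, hP⟩) (embV v) = ∑ j, inner ℝ (fld (dv j P)) ((v : Jet) j.succ) := by
  unfold gradInner
  simp only [HV.weakPartial_eq]
  rfl

lemma gradInner_jpf (l k : ℕ) (v : HV) : gradInner (embV (jpf l k)) (embV v)
    = (2 * k + l - 1) * (2 * k * l * sv l v - (2 * k + l + 1) * tv l v)
      - lamk l k * inner ℝ (fld (pf l (k - 1))) (embV v) := by
  rw [jpf, gradInner_jet, green_pf v.2.1, ← inner_pgrad v.2.1 v.2.2.1]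
  rfl

lemma gradInner_jqf (l k : ℕ) (v : HV) : gradInner (embV (jqf l k)) (embV v)
    = (2 * k + l) * qv l v - lamk l k * inner ℝ (fld (qf l (k - 1))) (embV v) := by
  rw [jqf, gradInner_jet, green_qf v.2.1]
  rfl

lemma inner_jpf_zero (l : ℕ) (v : HV) :
    inner ℝ (fld (pf l 0)) (embV v) = -((l + 1) * sv l v) := by
  rw [pf_zero, map_neg, LinearMap.map_smul fld, inner_neg_left, inner_smul_left]
  rfl

lemma hasSum_inner {J : ℕ → HV} {w : HV} (h : HasSum J w) (v : HV) :
    HasSum (fun k => inner ℝ (embV (J k)) (embV v)) (inner ℝ (embV w) (embV v)) := by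
  have h1 := (h.mapL embV).mapL (innerSL ℝ (embV v))
  simp only [innerSL_apply_apply] at h1
  simpa only [real_inner_comm] using h1

lemma hasSum_gradInner {J : ℕ → HV} {w : HV} (h : HasSum J w) (v : HV) :
    HasSum (fun k => gradInner (embV (J k)) (embV v)) (gradInner (embV w) (embV v)) := by
  simp only [gradInner_embV]
  refine HasSum.sub ?_ (hasSum_inner h v)
  have h1 := h.mapL (innerSL ℝ v)
  simp only [innerSL_apply_apply] at h1
  simpa only [real_inner_comm] using h1

lemma gradInner_smul_left (a : ℝ) (u v : HV) :
    gradInner (embV (a • u)) (embV v) = a * gradInner (embV u) (embV v) := by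
  have h : inner ℝ (a • u) v = a * inner ℝ u v := by
    rw [Submodule.coe_inner, Submodule.coe_inner, Submodule.coe_smul, real_inner_smul_left]
  rw [gradInner_embV, gradInner_embV, map_smul, real_inner_smul_left, h]
  ring

lemma gradInner_add_left (u u' v : HV) : gradInner (embV (u + u')) (embV v)
    = gradInner (embV u) (embV v) + gradInner (embV u') (embV v) := by
  rw [gradInner_embV, gradInner_embV, gradInner_embV, map_add, inner_add_left, inner_add_left]
  ring

lemma gradInner_comm (u v : HV) : gradInner (embV u) (embV v) = gradInner (embV v) (embV u) := by
  rw [gradInner_embV, gradInner_embV, real_inner_comm, real_inner_comm (embV u)]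

/-- The shift in `∑ bc l k κ^k lamk l k m (k - 1)`. -/
lemma hasSum_shift {l : ℕ} {κ M : ℝ} {m : ℕ → ℝ} (h : HasSum (fun k => bc l k * κ ^ k * m k) M) :
    HasSum (fun k => bc l k * κ ^ k * (lamk l k * m (k - 1))) (-κ * M) := by
  rw [← hasSum_nat_add_iff' 1]
  refine hasSum_of_eq (h.mul_left (-κ)) (fun k => ?_) ?_
  · rw [Nat.add_sub_cancel, pow_succ]
    linear_combination -(κ ^ k * κ * m k) * lamk_mul_bc l k
  · simp [lamk]

/-- The series `∑ (2k)² bc l k κ^k`. -/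
lemma hasSum_sq_bc (l : ℕ) (κ : ℝ) : HasSum (fun k : ℕ => (2 * k) ^ 2 * bc l k * κ ^ k)
    (-κ * bg l κ + (2 * l + 1) * (κ * bg (l + 1) κ / (2 * l + 3))) := by
  have h1 : HasSum (fun k => bc l k * κ ^ k * (lamk l k * 1)) (-κ * bg l κ) :=
    hasSum_shift (m := fun _ => 1) (by simpa using hasSum_bg l κ)
  refine hasSum_of_eq (h1.sub ((hasSum_two_mul_bc l κ).mul_left (2 * l + 1 : ℝ))) (fun k => ?_) ?_
  · rw [lamk]; ring
  · ring

/-- Green's formula for `yser`. -/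
lemma gradInner_yser (l : ℕ) (κ : ℝ) (v : HV) : gradInner (embV (yser l κ)) (embV v)
    = κ * inner ℝ (embV (yser l κ)) (embV v)
      + l * (-κ * bg l κ + (l + 2) * (κ * bg (l + 1) κ / (2 * l + 3))) * sv l v
      - (((l : ℝ) ^ 2 - 1 - κ) * bg l κ + κ * bg (l + 1) κ / (2 * l + 3)) * tv l v := by
  have h1 := hasSum_gradInner (hasSum_yser l κ) v
  have h2 := hasSum_inner (hasSum_yser l κ) v
  simp only [map_smul, inner_smul_left, conj_trivial, embV_jpf] at h2
  simp only [gradInner_smul_left, gradInner_jpf] at h1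
  have h3 := hasSum_shift h2
  have a0 := hasSum_bg l κ
  have a1 := hasSum_two_mul_bc l κ
  have a2 := hasSum_sq_bc l κ
  refine h1.unique ?_
  refine hasSum_of_eq ((((a2.add (a1.mul_left (l - 1 : ℝ))).mul_left (l * sv l v)).sub
    (((a2.add (a1.mul_left (2 * l : ℝ))).add (a0.mul_left ((l : ℝ) ^ 2 - 1))).mul_left
      (tv l v))).sub h3) (fun k => ?_) ?_
  · ring
  · ring

lemma gradInner_zser (l : ℕ) (κ : ℝ) (v : HV) : gradInner (embV (zser l κ)) (embV v)
    = κ * inner ℝ (embV (zser l κ)) (embV v) + entZ l κ * qv l v := by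
  have h1 := hasSum_gradInner (hasSum_zser l κ) v
  have h2 := hasSum_inner (hasSum_zser l κ) v
  simp only [map_smul, inner_smul_left, conj_trivial, embV_jqf] at h2
  simp only [gradInner_smul_left, gradInner_jqf] at h1
  have h3 := hasSum_shift h2
  refine h1.unique ?_
  refine hasSum_of_eq ((((hasSum_two_mul_bc l κ).add ((hasSum_bg l κ).mul_left (l : ℝ))).mul_left
    (qv l v)).sub h3) (fun k => ?_) ?_
  · ring
  · rw [entZ]; ring

/-! ### Spherical coordinates -/

lemma norm_pos_of_coord {x : E3} (hx : x 0 ≠ 0) : 0 < ‖x‖ :=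
  norm_pos_iff.2 fun h => hx (by rw [h]; rfl)

lemma cos_polar (x : E3) : Real.cos (polar x) = x 2 / ‖x‖ := by
  have h := EuclideanSpace.norm_eq x
  have h2 : |x 2 / ‖x‖| ≤ 1 := by
    rw [abs_div, abs_norm]
    exact div_le_one_of_le₀ (PiLp.norm_apply_le x 2) (norm_nonneg _)
  rw [abs_le] at h2
  exact Real.cos_arccos h2.1 h2.2

lemma sin_polar {x : E3} (hx : x 0 ≠ 0) :
    Real.sin (polar x) = ‖(⟨x 0, x 1⟩ : ℂ)‖ / ‖x‖ := by
  have hr := norm_pos_of_coord hx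
  have h1 := norm_sq_eq x
  have h2 : ‖(⟨x 0, x 1⟩ : ℂ)‖ ^ 2 = x 0 ^ 2 + x 1 ^ 2 := by
    rw [Complex.sq_norm, Complex.normSq_mk]; ring
  have h3 : 0 ≤ Real.sin (polar x) :=
    Real.sin_nonneg_of_nonneg_of_le_pi (Real.arccos_nonneg _) (Real.arccos_le_pi _)
  rw [← sq_eq_sq₀ h3 (by positivity), Real.sin_sq, cos_polar, div_pow, div_pow, h2]
  field_simp
  rw [h1]; ring

lemma eR_apply {x : E3} (hx : x 0 ≠ 0) (i : Fin 3) : eR x i = x i / ‖x‖ := by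
  have hc : (⟨x 0, x 1⟩ : ℂ) ≠ 0 := fun h => hx (congrArg Complex.re h)
  have hn := norm_pos_iff.2 hc
  have hr := norm_pos_of_coord hx
  fin_cases i
  · change Real.sin (polar x) * Real.cos (azimuth x) = _
    rw [sin_polar hx, azimuth, Complex.cos_arg hc]
    simp only [Fin.zero_eta]; field_simp
  · change Real.sin (polar x) * Real.sin (azimuth x) = _
    rw [sin_polar hx, azimuth, Complex.sin_arg]
    simp only [Fin.mk_one]; field_simp
  · exact cos_polar x

lemma sin_mul_eTheta {x : E3} (hx : x 0 ≠ 0) (i : Fin 3) : Real.sin (polar x) * eTheta x i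
    = x 2 / ‖x‖ * (x i / ‖x‖) - if i = 2 then 1 else 0 := by
  rw [← cos_polar, ← eR_apply hx]
  fin_cases i
  · simp [eTheta, eR]; ring
  · simp [eTheta, eR]; ring
  · simp [eTheta, eR]; linear_combination -Real.sin_sq_add_cos_sq (polar x)

lemma sin_mul_ePhi {x : E3} (hx : x 0 ≠ 0) (i : Fin 3) : Real.sin (polar x) * ePhi x i
    = -(![x 1, -x 0, 0] i / ‖x‖) := by
  have h0 := eR_apply hx 0
  have h1 := eR_apply hx 1
  simp [eR] at h0 h1
  fin_cases i
  · simp [ePhi, h1]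
  · simp [ePhi, h0]; ring
  · simp [ePhi]

lemma deriv_S (l : ℕ) (θ : ℝ) :
    deriv (S l) θ = -(Real.sin θ * (Polynomial.derivative (legendreP l)).eval (Real.cos θ)) := by
  have := ((legendreP l).hasDerivAt (Real.cos θ)).comp θ (Real.hasDerivAt_cos θ)
  have h2 : HasDerivAt (S l) _ θ := this
  rw [h2.deriv]; ring

lemma vshY_apply (l : ℕ) {x : E3} (hx : x 0 ≠ 0) (i : Fin 3) :
    vshY l x i = (legendreP l).eval (x 2 / ‖x‖) * (x i / ‖x‖) := by
  rw [← cos_polar, ← eR_apply hx]; rfl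

lemma vshX_apply (l : ℕ) {x : E3} (hx : x 0 ≠ 0) (i : Fin 3) :
    vshX l x i = (Polynomial.derivative (legendreP l)).eval (x 2 / ‖x‖)
      * ((if i = 2 then 1 else 0) - x 2 / ‖x‖ * (x i / ‖x‖)) := by
  have h := sin_mul_eTheta hx i
  have : vshX l x i = deriv (S l) (polar x) * eTheta x i := rfl
  rw [this, deriv_S, cos_polar]
  linear_combination -(Polynomial.derivative (legendreP l)).eval (x 2 / ‖x‖) * h

lemma vshZ_apply (l : ℕ) {x : E3} (hx : x 0 ≠ 0) (i : Fin 3) :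
    vshZ l x i = (Polynomial.derivative (legendreP l)).eval (x 2 / ‖x‖)
      * (![x 1, -x 0, 0] i / ‖x‖) := by
  have h := sin_mul_ePhi hx i
  have : vshZ l x i = deriv (S l) (polar x) * ePhi x i := rfl
  rw [this, deriv_S, cos_polar]
  linear_combination -(Polynomial.derivative (legendreP l)).eval (x 2 / ‖x‖) * h

lemma pev_harm (l : ℕ) {x : E3} (hx : 0 < ‖x‖) :
    pev (harm l) x = ‖x‖ ^ l * (legendreP l).eval (x 2 / ‖x‖) := by
  rw [legendreP_eval, harm, pev_sum, Finset.mul_sum]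
  refine Finset.sum_congr rfl fun j hj => ?_
  by_cases h0 : legc l j = 0
  · simp [h0]
  · obtain ⟨k, hk, hk2⟩ := exists_two_mul_of_legc_ne_zero
      (Nat.lt_succ_iff.1 (Finset.mem_range.1 hj)) h0
    rw [hk2, div_pow, show ‖x‖ ^ l = ‖x‖ ^ (j + 2 * k) by rw [← hk]]
    simp only [pev_mul, pev_C, pev_pow, pev_R2, pev_X]
    field_simp
    ring

lemma pev_harmZ {l : ℕ} (hl : 1 ≤ l) {x : E3} (hx : 0 < ‖x‖) :
    pev (harmZ l) x = ‖x‖ ^ (l - 1) * (Polynomial.derivative (legendreP l)).eval (x 2 / ‖x‖) := by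
  rw [legendreP_derivative_eval, harmZ, pev_sum, Finset.mul_sum]
  refine Finset.sum_congr rfl fun j hj => ?_
  rcases j with _ | j
  · simp
  by_cases h0 : legc l (j + 1) = 0
  · simp [h0]
  · obtain ⟨k, hk, hk2⟩ := exists_two_mul_of_legc_ne_zero
      (Nat.lt_succ_iff.1 (Finset.mem_range.1 hj)) h0
    have hk3 : l - 1 = j + 2 * k := by omega
    rw [hk2, div_pow, Nat.add_sub_cancel, hk3]
    simp only [pev_mul, pev_C, pev_pow, pev_R2, pev_X]
    field_simp
    ring

lemma pev_pderiv_harm {l : ℕ} (hl : 1 ≤ l) {x : E3} (hx : x 0 ≠ 0) (i : Fin 3) :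
    pev (pderiv i (harm l)) x = ‖x‖ ^ (l - 1) * (l * vshY l x i + vshX l x i) := by
  have hr := norm_pos_of_coord hx
  have h1 := congrArg (pev · x) (X_mul_pderiv_harm l)
  have h2 := norm_sq_eq x
  simp only [Fin.sum_univ_three, pderiv_harm_zero, pderiv_harm_one, pderiv_harm_two, pev_add,
    pev_mul, pev_X, pev_natCast] at h1
  have h3 : ‖x‖ ^ 2 * pev (harmR l) x = l * pev (harm l) x - x 2 * pev (harmZ l) x := by
    rw [h2]; linear_combination h1
  have h4 : pev (pderiv i (harm l)) x
      = (if i = 2 then 1 else 0) * pev (harmZ l) x + x i * pev (harmR l) x := by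
    rw [pderiv_harm]; split_ifs <;> simp
  rw [h4, vshY_apply l hx, vshX_apply l hx]
  rw [pev_harm l hr, pev_harmZ hl hr] at h3
  rw [pev_harmZ hl hr]
  obtain ⟨n, rfl⟩ := Nat.exists_eq_add_of_le' hl
  refine mul_left_cancel₀ (pow_ne_zero 2 hr.ne') ?_
  rw [Nat.add_sub_cancel] at h3 ⊢
  rw [pow_succ] at h3
  field_simp
  linear_combination x i * h3

/-! ### The eigenfunctions as admissible fields -/

lemma alphaZ_spec (l : ℕ) {m : ℕ} (hm : 1 ≤ m) :
    0 < alphaZ l m ∧ entZ l (alphaZ l m ^ 2) = 0 := by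
  have h : alphaZ l m ∈ {r : ℝ | 0 < r ∧ charZ l r = 0} := by
    rw [(posZerosListed_charZ l).2]; exact ⟨m, hm, rfl⟩
  exact ⟨h.1, (charZ_eq_zero_iff l h.1).1 h.2⟩

lemma alphaY_spec {l m : ℕ} (hl : 1 ≤ l) (hm : 1 ≤ m) :
    0 < alphaY l m ∧ entY l (alphaY l m ^ 2) = 0 := by
  have h : alphaY l m ∈ {r : ℝ | 0 < r ∧ charY l r = 0} := by
    rw [(posZerosListed_charY hl).2]; exact ⟨m, hm, rfl⟩
  exact ⟨h.1, (charY_eq_zero_iff hl h.1).1 h.2⟩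

/-- If `B = 0`, then `α²` is a positive integer at which `entY` reduces to a nonzero multiple of
`bg l`. -/
lemma coefB_ne_zero {l m : ℕ} (hl : 1 ≤ l) (hm : 1 ≤ m) : coefB l m ≠ 0 := by
  obtain ⟨hpos, hent⟩ := alphaY_spec hl hm
  intro hB
  rw [coefB, sub_eq_zero] at hB
  have hκ : 0 < alphaY l m ^ 2 := by positivity
  rw [entY, hB, sub_self, zero_mul, sub_zero] at hent
  rw [hB] at hκ
  obtain ⟨n, rfl⟩ := Nat.exists_eq_add_of_le' hl
  rcases n with _ | n
  · simp at hκ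
  have hN := bg_natCast_ne_zero (N := (n + 2) * (n + 1) * (n + 4)) (by positivity) (n + 1 + 1)
  have e : ((n + 1 + 1 : ℕ) : ℝ) * (((n + 1 + 1 : ℕ) : ℝ) - 1) * (((n + 1 + 1 : ℕ) : ℝ) + 2)
      = (((n + 2) * (n + 1) * (n + 4) : ℕ) : ℝ) := by push_cast; ring
  have hne : ((n + 1 + 1 : ℕ) : ℝ) * (((n + 1 + 1 : ℕ) : ℝ) - 1) * (((n + 1 + 1 : ℕ) : ℝ) + 2)
      - (((n + 1 + 1 : ℕ) : ℝ) - 1) * (2 * ((n + 1 + 1 : ℕ) : ℝ) + 1) ≠ 0 := by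
    have : (((n : ℝ) + 1) * (n + 1) * (n + 3)) ≠ 0 := by positivity
    convert this using 1
    push_cast; ring
  rw [mul_eq_zero, or_iff_right hne, e] at hent
  exact hN hent

/-- The gradient of the zonal harmonic as an admissible field. -/
def jgrad (l : ℕ) : HV := (-((l : ℝ) + 1)⁻¹) • jpf l 0

lemma embV_jgrad (l : ℕ) : embV (jgrad l) = fld (pgrad (harm l)) := by
  have : (l : ℝ) + 1 ≠ 0 := by positivity
  rw [jgrad, map_smul, embV_jpf, pf_zero, map_neg, LinearMap.map_smul fld, smul_neg, neg_smul,
    neg_neg, inv_smul_smul₀ this]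

lemma gradInner_jgrad (l : ℕ) (v : HV) :
    gradInner (embV (jgrad l)) (embV v) = (l - 1) * tv l v := by
  have : (l : ℝ) + 1 ≠ 0 := by positivity
  rw [jgrad, gradInner_smul_left, gradInner_jpf, lamk]
  simp
  field_simp

/-- The factor of `yser` in a poloidal mode. -/
def coefY (l m : ℕ) : ℝ := -(coefB l m * (Cb l * alphaY l m ^ (l - 1)) / (l * (l + 1)))

/-- The factor of `zser` in a toroidal mode. -/
def coefZ (l m : ℕ) : ℝ := Real.sqrt (alphaZ l m) * Cb l * alphaZ l m ^ l

/-- The eigenfunction of a mode as an admissible field. -/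
def modeHV : Mode → HV
  | .const => jgrad 1
  | .Y l m => coefY l m • yser l (alphaY l m ^ 2) + coefA l m • jgrad l
  | .Z l m => coefZ l m • zser l (alphaZ l m ^ 2)

lemma coefY_ne_zero {l m : ℕ} (hl : 1 ≤ l) (hm : 1 ≤ m) : coefY l m ≠ 0 := by
  have h1 := coefB_ne_zero hl hm
  have h2 := Cb_pos l
  have h3 := (alphaY_spec hl hm).1
  rw [coefY]
  have : (l : ℝ) * (l + 1) ≠ 0 := by positivity
  exact neg_ne_zero.2 (div_ne_zero (mul_ne_zero h1 (by positivity)) this)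

lemma coefZ_ne_zero (l : ℕ) {m : ℕ} (hm : 1 ≤ m) : coefZ l m ≠ 0 := by
  have h2 := Cb_pos l
  have h3 := (alphaZ_spec l hm).1
  rw [coefZ]
  positivity

lemma harm_one_ae (x : E3) (i : Fin 3) :
    pev (pderiv i (harm 1)) x = if i = 2 then 1 else 0 := by
  have h0 : legc 1 0 = 0 := legc_odd (by decide)
  have h1 : legc 1 1 = 1 := by
    simp [legc, legendreP]; norm_num
  rw [pderiv_harm]
  split_ifs <;> simp [harmZ, harmR, Finset.sum_range_succ, h0, h1]

lemma modeY_ae (l m : ℕ) :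
    embV (coefY l m • yser l (alphaY l m ^ 2) + coefA l m • jgrad l)
      =ᵐ[ballMeasure] fun x => WithLp.toLp 2 fun i =>
        coefY l m * (-(l * alphaY l m ^ 2 * bg (l + 1) (alphaY l m ^ 2 * ‖x‖ ^ 2) / (2 * l + 3))
            * (pev (harm l) x * x i)
          - ((l + 1) * bg l (alphaY l m ^ 2 * ‖x‖ ^ 2)
            - alphaY l m ^ 2 * ‖x‖ ^ 2 * bg (l + 1) (alphaY l m ^ 2 * ‖x‖ ^ 2) / (2 * l + 3))
              * pev (pderiv i (harm l)) x)
        + coefA l m * pev (pderiv i (harm l)) x := by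
  rw [map_add, map_smul, map_smul, embV_jgrad]
  filter_upwards [Lp.coeFn_add (coefY l m • embV (yser l (alphaY l m ^ 2)))
    (coefA l m • fld (pgrad (harm l))), Lp.coeFn_smul (coefY l m) (embV (yser l (alphaY l m ^ 2))),
    Lp.coeFn_smul (coefA l m) (fld (pgrad (harm l))), yser_ae l (alphaY l m ^ 2),
    fld_ae (pgrad (harm l))] with x h1 h2 h3 h4 h5
  rw [h1, Pi.add_apply, h2, h3, Pi.smul_apply, Pi.smul_apply, h4, h5]
  rfl

lemma modeZ_ae (l m : ℕ) : embV (coefZ l m • zser l (alphaZ l m ^ 2))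
    =ᵐ[ballMeasure] fun x =>
      (coefZ l m * bg l (alphaZ l m ^ 2 * ‖x‖ ^ 2)) • vev (crossf l) x := by
  rw [map_smul]
  filter_upwards [Lp.coeFn_smul (coefZ l m) (embV (zser l (alphaZ l m ^ 2))),
    zser_ae l (alphaZ l m ^ 2)] with x h1 h2
  rw [h1, Pi.smul_apply, h2, smul_smul]

lemma modeHV_const_ae : embV (modeHV .const) =ᵐ[ballMeasure] constField := by
  rw [modeHV, embV_jgrad]
  filter_upwards [fld_ae (pgrad (harm 1)), ae_coord_ne_zero] with x h1 hx
  rw [h1]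
  refine PiLp.ext fun i => ?_
  have h2 := sin_mul_eTheta hx i
  have h3 : constField x i = Real.cos (polar x) * eR x i + -Real.sin (polar x) * eTheta x i := rfl
  rw [h3, neg_mul, h2, eR_apply hx, cos_polar, vev_apply]
  have h4 := harm_one_ae x i
  rw [pgrad, h4]; ring

lemma modeHV_Y_ae {l m : ℕ} (hl : 1 ≤ l) (hm : 1 ≤ m) :
    embV (coefY l m • yser l (alphaY l m ^ 2) + coefA l m • jgrad l)
      =ᵐ[ballMeasure] fieldY l m := by
  filter_upwards [modeY_ae l m, ae_coord_ne_zero] with x h1 hx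
  rw [h1]
  refine PiLp.ext fun i => ?_
  have hr := norm_pos_of_coord hx
  have hα := (alphaY_spec hl hm).1
  have h3 : fieldY l m x i =
    (coefB l m * jt l (alphaY l m * ‖x‖) + (l : ℝ) * coefA l m * ‖x‖ ^ (l - 1)) * vshY l x i
    + (coefB l m / ((l : ℝ) * ((l : ℝ) + 1))
        * (‖x‖ * alphaY l m * deriv (jt l) (alphaY l m * ‖x‖) + 2 * jt l (alphaY l m * ‖x‖))
      + coefA l m * ‖x‖ ^ (l - 1)) * vshX l x i := rfl
  have h4 := mul_deriv_jt hl (mul_pos hα hr)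
  have h6 : pev (harm l) x * x i = ‖x‖ ^ (l - 1) * ‖x‖ ^ 2 * vshY l x i := by
    rw [pev_harm l hr, vshY_apply l hx]
    obtain ⟨n, rfl⟩ := Nat.exists_eq_add_of_le' hl
    rw [Nat.add_sub_cancel, pow_succ]
    field_simp
  change coefY l m * _ + coefA l m * _ = _
  rw [h3, mul_comm ‖x‖, h4, jt_eq hl (mul_pos hα hr), h6, pev_pderiv_harm hl hx, coefY, mul_pow,
    mul_pow]
  have hl0 : (l : ℝ) ≠ 0 := by positivity
  generalize bg l _ = G0
  generalize bg (l + 1) _ = G1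
  generalize vshX l x i = a
  generalize vshY l x i = b
  generalize coefA l m = A
  generalize coefB l m = B
  field_simp
  ring

lemma modeHV_Z_ae {l m : ℕ} (hl : 1 ≤ l) (hm : 1 ≤ m) :
    embV (coefZ l m • zser l (alphaZ l m ^ 2)) =ᵐ[ballMeasure] fieldZ l m := by
  filter_upwards [modeZ_ae l m, ae_coord_ne_zero] with x h1 hx
  rw [h1]
  refine PiLp.ext fun i => ?_
  have hr := norm_pos_of_coord hx
  have hα := (alphaZ_spec l hm).1
  have h3 : fieldZ l m x i = Jhalf l (alphaZ l m * ‖x‖) / Real.sqrt ‖x‖ * vshZ l x i := rfl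
  have h4 := Jhalf_div_sqrt l (mul_pos hα hr)
  rw [div_eq_iff (Real.sqrt_ne_zero'.2 (mul_pos hα hr)), Real.sqrt_mul hα.le] at h4
  have h5 : Real.sqrt ‖x‖ ≠ 0 := Real.sqrt_ne_zero'.2 hr
  have h6 : vev (crossf l) x i = pev (harmZ l) x * ![x 1, -x 0, 0] i := by
    rw [vev_apply]
    fin_cases i <;> simp [crossf]
  change _ * vev (crossf l) x i = _
  rw [h3, h4, h6, vshZ_apply l hx, pev_harmZ hl hr, coefZ, mul_pow, mul_pow]
  obtain ⟨n, rfl⟩ := Nat.exists_eq_add_of_le' hl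
  rw [Nat.add_sub_cancel, pow_succ ‖x‖ n]
  field_simp

/-- The fields of the modes represent the elements `modeHV`. -/
theorem modeHV_ae (i : Mode) : embV (modeHV i) =ᵐ[ballMeasure] i.field := by
  rcases i with _ | ⟨l, m⟩ | ⟨l, m⟩
  · exact modeHV_const_ae
  · exact modeHV_Y_ae l.pos m.pos
  · exact modeHV_Z_ae l.pos m.pos

/-! ### The eigenfunctions do not vanish -/

lemma exists_bg_ne_zero (l : ℕ) {κ : ℝ} (hκ : 0 < κ) : ∃ s ∈ Set.Ioo 0 κ, bg l s ≠ 0 := by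
  by_contra! h
  have h1 : Tendsto (bg l) (𝓝[>] 0) (𝓝 1) := by
    rw [← bg_zero l]
    exact (continuous_bg l).continuousAt.tendsto.mono_left nhdsWithin_le_nhds
  have h2 : Tendsto (bg l) (𝓝[>] 0) (𝓝 0) := by
    refine tendsto_const_nhds.congr' ?_
    filter_upwards [Ioo_mem_nhdsGT hκ] with s hs using (h s hs).symm
  exact one_ne_zero (tendsto_nhds_unique h1 h2)

lemma exists_bg_ne (l : ℕ) {κ : ℝ} (hκ : 0 < κ) (d : ℝ) : ∃ s ∈ Set.Ioo 0 κ, bg l s ≠ d := by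
  by_contra! h
  obtain ⟨s, hs, hs0⟩ := exists_bg_ne_zero (l + 1) hκ
  have h1 : bg l =ᶠ[𝓝 s] fun _ => d := by
    filter_upwards [Ioo_mem_nhds hs.1 hs.2] with t ht using h t ht
  have h2 := ((hasDerivAt_bg l s).congr_of_eventuallyEq h1.symm).unique (hasDerivAt_const s d)
  have : (2 * (2 * (l : ℝ) + 3)) ≠ 0 := by positivity
  exact hs0 (by simpa [this] using h2)

lemma legendreP_derivative_ne_zero {l : ℕ} (hl : 1 ≤ l) :
    Polynomial.derivative (legendreP l) ≠ 0 := by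
  intro h
  have h1 := Polynomial.coeff_derivative (legendreP l) (l - 1)
  rw [h, Polynomial.coeff_zero, Nat.sub_add_cancel hl] at h1
  rcases mul_eq_zero.1 h1.symm with h2 | h2
  · exact (legc_self_pos l).ne' h2
  · exact (by positivity : (((l - 1 : ℕ) : ℝ) + 1) ≠ 0) h2

/-- A half-line on which neither zonal polynomial vanishes. -/
lemma exists_direction {l : ℕ} (hl : 1 ≤ l) : ∃ a c : ℝ, a ≠ 0 ∧ ∀ r, 0 < r →
    ‖(!₂[r * a, 0, r * c] : E3)‖ = r ∧ pev (harm l) !₂[r * a, 0, r * c] ≠ 0 ∧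
      pev (harmZ l) !₂[r * a, 0, r * c] ≠ 0 := by
  have hd := legendreP_derivative_ne_zero hl
  have hp : legendreP l ≠ 0 := by
    rintro h; rw [h] at hd; simp at hd
  obtain ⟨c, hc, hroot⟩ : ∃ c ∈ Set.Ioo (0 : ℝ) 1,
      ¬ (legendreP l * Polynomial.derivative (legendreP l)).IsRoot c := by
    by_contra! h
    exact mul_ne_zero hp hd (Polynomial.eq_zero_of_infinite_isRoot _
      ((Set.Ioo_infinite one_pos).mono fun c hc => h c hc))
  rw [Polynomial.IsRoot, Polynomial.eval_mul, mul_eq_zero, not_or] at hroot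
  have h1 : 0 < 1 - c ^ 2 := by nlinarith [hc.1, hc.2]
  refine ⟨Real.sqrt (1 - c ^ 2), c, Real.sqrt_ne_zero'.2 h1, fun r hr => ?_⟩
  have hn : ‖(!₂[r * Real.sqrt (1 - c ^ 2), 0, r * c] : E3)‖ = r := by
    rw [← sq_eq_sq₀ (norm_nonneg _) hr.le, norm_sq_eq]
    simp only [Matrix.cons_val_zero, Matrix.cons_val_one, Matrix.cons_val]
    rw [mul_pow, Real.sq_sqrt h1.le]; ring
  have hq : (!₂[r * Real.sqrt (1 - c ^ 2), 0, r * c] : E3) 2 / r = c := by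
    simp [hr.ne']
  have hpos : 0 < ‖(!₂[r * Real.sqrt (1 - c ^ 2), 0, r * c] : E3)‖ := by rw [hn]; exact hr
  refine ⟨hn, ?_, ?_⟩
  · rw [pev_harm l hpos, hn, hq]
    exact mul_ne_zero (by positivity) hroot.1
  · rw [pev_harmZ hl hpos, hn, hq]
    exact mul_ne_zero (by positivity) hroot.2

lemma eq_zero_on_ball {f : E3 → ℝ} (hf : Continuous f) (h : f =ᵐ[ballMeasure] 0) {x : E3}
    (hx : ‖x‖ < 1) : f x = 0 :=
  Measure.eqOn_open_of_ae_eq (f := f) (g := fun _ => 0) h Metric.isOpen_ball hf.continuousOn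
    continuousOn_const (mem_ball_zero_iff.2 hx)

lemma modeY_ne_zero {l m : ℕ} (hl : 1 ≤ l) (hm : 1 ≤ m) :
    embV (coefY l m • yser l (alphaY l m ^ 2) + coefA l m • jgrad l) ≠ 0 := by
  intro h
  have hα := (alphaY_spec hl hm).1
  set κ := alphaY l m ^ 2 with hκ
  have hκ0 : 0 < κ := by positivity
  have hcont : Continuous fun x : E3 =>
      pev (harm l) x * (coefA l m - coefY l m * (l + 1) * bg l (κ * ‖x‖ ^ 2)) :=
    (continuous_pev _).mul (continuous_const.sub (continuous_const.mul
      ((continuous_bg l).comp (continuous_const.mul (continuous_norm.pow 2)))))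
  have hae : (fun x : E3 => pev (harm l) x
      * (coefA l m - coefY l m * (l + 1) * bg l (κ * ‖x‖ ^ 2))) =ᵐ[ballMeasure] 0 := by
    have h1 := modeY_ae l m
    rw [h] at h1
    filter_upwards [h1, Lp.coeFn_zero E3 2 ballMeasure] with x h2 h3
    rw [h3] at h2
    have h4 (i : Fin 3) := congrFun (congrArg WithLp.ofLp h2) i
    have h5 := congrArg (pev · x) (X_mul_pderiv_harm l)
    have h6 := norm_sq_eq x
    have a0 := h4 0
    have a1 := h4 1
    have a2 := h4 2
    simp only [Pi.zero_apply, PiLp.zero_apply] at a0 a1 a2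
    simp only [Fin.sum_univ_three, pev_add, pev_mul, pev_X, pev_natCast] at h5
    have hl0 : (l : ℝ) ≠ 0 := by positivity
    refine (mul_eq_zero.1 (?_ : (l : ℝ) * _ = 0)).resolve_left hl0
    rw [← hκ, mul_div_assoc, mul_div_assoc (κ * ‖x‖ ^ 2)] at a0 a1 a2
    generalize bg l (κ * ‖x‖ ^ 2) = G at *
    generalize bg (l + 1) (κ * ‖x‖ ^ 2) / (2 * (l : ℝ) + 3) = D at *
    linear_combination -x 0 * a0 - x 1 * a1 - x 2 * a2
      - (coefA l m - coefY l m * ((l + 1) * G - κ * ‖x‖ ^ 2 * D)) * h5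
      - coefY l m * l * κ * D * pev (harm l) x * h6
  obtain ⟨s, hs, hne⟩ := exists_bg_ne l hκ0 (coefA l m / (coefY l m * (l + 1)))
  obtain ⟨a, c, -, hdir⟩ := exists_direction hl
  have hs0 : 0 < s / κ := div_pos hs.1 hκ0
  obtain ⟨hn, hh, -⟩ := hdir (Real.sqrt (s / κ)) (Real.sqrt_pos.2 hs0)
  have h1 := eq_zero_on_ball hcont hae (x := !₂[Real.sqrt (s / κ) * a, 0, Real.sqrt (s / κ) * c])
    (by rw [hn, Real.sqrt_lt' one_pos, one_pow, div_lt_one hκ0]; exact hs.2)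
  rw [hn, Real.sq_sqrt hs0.le, mul_div_cancel₀ _ hκ0.ne'] at h1
  have h2 := (mul_eq_zero.1 h1).resolve_left hh
  have h3 : coefY l m * ((l : ℝ) + 1) ≠ 0 := mul_ne_zero (coefY_ne_zero hl hm) (by positivity)
  refine hne ?_
  rw [eq_div_iff h3]; linarith

lemma modeZ_ne_zero {l m : ℕ} (hl : 1 ≤ l) (hm : 1 ≤ m) :
    embV (coefZ l m • zser l (alphaZ l m ^ 2)) ≠ 0 := by
  intro h
  have hα := (alphaZ_spec l hm).1
  set κ := alphaZ l m ^ 2 with hκ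
  have hκ0 : 0 < κ := by positivity
  have hcont : Continuous fun x : E3 =>
      coefZ l m * bg l (κ * ‖x‖ ^ 2) * pev (crossf l 1) x :=
    (continuous_const.mul ((continuous_bg l).comp (continuous_const.mul
      (continuous_norm.pow 2)))).mul (continuous_pev _)
  have hae : (fun x : E3 => coefZ l m * bg l (κ * ‖x‖ ^ 2) * pev (crossf l 1) x)
      =ᵐ[ballMeasure] 0 := by
    have h1 := modeZ_ae l m
    rw [← hκ, h] at h1
    filter_upwards [h1, Lp.coeFn_zero E3 2 ballMeasure] with x h2 h3
    rw [h3] at h2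
    exact (congrFun (congrArg WithLp.ofLp h2) 1).symm
  obtain ⟨s, hs, hne⟩ := exists_bg_ne_zero l hκ0
  obtain ⟨a, c, ha, hdir⟩ := exists_direction hl
  have hs0 : 0 < s / κ := div_pos hs.1 hκ0
  have hq := Real.sqrt_pos.2 hs0
  obtain ⟨hn, -, hh⟩ := hdir (Real.sqrt (s / κ)) hq
  have h1 := eq_zero_on_ball hcont hae (x := !₂[Real.sqrt (s / κ) * a, 0, Real.sqrt (s / κ) * c])
    (by rw [hn, Real.sqrt_lt' one_pos, one_pow, div_lt_one hκ0]; exact hs.2)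
  rw [hn, Real.sq_sqrt hs0.le, mul_div_cancel₀ _ hκ0.ne'] at h1
  refine mul_ne_zero (mul_ne_zero (coefZ_ne_zero l hm) hne) ?_ h1
  have h2 (y : E3) : pev (crossf l 1) y = -(pev (harmZ l) y * y 0) := by simp [crossf]
  rw [h2]
  exact neg_ne_zero.2 (mul_ne_zero hh (mul_ne_zero hq.ne' ha))

lemma modeConst_ne_zero : embV (modeHV .const) ≠ 0 := by
  intro h
  have hae : (fun _ : E3 => (1 : ℝ)) =ᵐ[ballMeasure] 0 := by
    have h1 := fld_ae (pgrad (harm 1))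
    rw [← embV_jgrad, show jgrad 1 = modeHV .const from rfl, h] at h1
    filter_upwards [h1, Lp.coeFn_zero E3 2 ballMeasure] with x h2 h3
    rw [h3] at h2
    have h4 := congrFun (congrArg WithLp.ofLp h2) 2
    have h5 := harm_one_ae x 2
    rw [if_pos rfl] at h5
    exact (h4.trans h5).symm
  exact one_ne_zero (eq_zero_on_ball continuous_const hae (x := 0) (by simp))

theorem modeHV_ne_zero (i : Mode) : embV (modeHV i) ≠ 0 := by
  rcases i with _ | ⟨l, m⟩ | ⟨l, m⟩
  · exact modeConst_ne_zero
  · exact modeY_ne_zero l.pos m.pos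
  · exact modeZ_ne_zero l.pos m.pos

/-! ### The eigenvalue equation -/

lemma gradInner_modeHV_Y {l m : ℕ} (hl : 1 ≤ l) (hm : 1 ≤ m) (v : HV) :
    gradInner (embV (coefY l m • yser l (alphaY l m ^ 2) + coefA l m • jgrad l)) (embV v)
      = alphaY l m ^ 2 * inner ℝ
        (embV (coefY l m • yser l (alphaY l m ^ 2) + coefA l m • jgrad l)) (embV v) := by
  obtain ⟨hα, hent⟩ := alphaY_spec hl hm
  have hs : inner ℝ (embV (jgrad l)) (embV v) = sv l v := by rw [embV_jgrad]; rfl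
  rw [gradInner_add_left, gradInner_smul_left, gradInner_smul_left, gradInner_yser,
    gradInner_jgrad, map_add, map_smul, map_smul, inner_add_left, real_inner_smul_left,
    real_inner_smul_left, hs, coefY, coefA, jt_eq hl hα]
  have hB : coefB l m = alphaY l m ^ 2 - l * (l - 1) * (l + 2) := rfl
  rw [entY, ← hB] at hent
  have hl0 : (l : ℝ) ≠ 0 := by positivity
  set K := Cb l * alphaY l m ^ (l - 1)
  generalize inner ℝ (embV (yser l _)) (embV v) = I
  generalize sv l v = s
  generalize tv l v = t
  set κ := alphaY l m ^ 2
  rw [mul_div_assoc κ (bg (l + 1) κ)]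
  generalize bg (l + 1) κ / (2 * (l : ℝ) + 3) = D at *
  generalize bg l κ = G at *
  linear_combination (norm := skip)
    (s * ((l + 2) * κ * K / (l + 1)) - t * (κ * K / (l * (l + 1)))) * hent
      + (s * (κ * K * G / (l + 1)) + t * (K / (l * (l + 1)) * ((l : ℝ) ^ 2 - 1 - κ) * G)) * hB
  field_simp
  ring

lemma gradInner_modeHV (i : Mode) (v : HV) : gradInner (embV (modeHV i)) (embV v)
    = i.eigenvalue * inner ℝ (embV (modeHV i)) (embV v) := by
  rcases i with _ | ⟨l, m⟩ | ⟨l, m⟩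
  · rw [modeHV, gradInner_jgrad]; simp [Mode.eigenvalue]
  · exact gradInner_modeHV_Y l.pos m.pos v
  · rw [modeHV, gradInner_smul_left, gradInner_zser, (alphaZ_spec l m.pos).2, map_smul,
      real_inner_smul_left, Mode.eigenvalue]
    ring

theorem isEigen_modeHV (i : Mode) : IsEigen i.eigenvalue (embV (modeHV i)) := by
  refine ⟨embV_mem _, fun v hv => ?_⟩
  obtain ⟨v, rfl⟩ := exists_embV hv
  exact gradInner_modeHV i v

/-! ### Orthogonality of the eigenfunctions -/

/-- The polynomial fields of the angular momentum and the type of a mode. -/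
def sectorField : Mode → ℕ → HV
  | .const => jpf 1
  | .Y l _ => jpf l
  | .Z l _ => jqf l

/-- A mode is a series of polynomial fields of its own sector. -/
lemma inner_modeHV_eq_zero (i : Mode) (v : HV)
    (h : ∀ k, inner ℝ (embV (sectorField i k)) (embV v) = 0) :
    inner ℝ (embV (modeHV i)) (embV v) = 0 := by
  have hj (l : ℕ) (h0 : inner ℝ (embV (jpf l 0)) (embV v) = 0) :
      inner ℝ (embV (jgrad l)) (embV v) = 0 := by
    rw [jgrad, map_smul, real_inner_smul_left, h0, mul_zero]
  rcases i with _ | ⟨l, m⟩ | ⟨l, m⟩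
  · exact hj 1 (h 0)
  · have h1 := hasSum_inner (hasSum_yser l (alphaY l m ^ 2)) v
    simp only [map_smul, real_inner_smul_left] at h1
    have h2 : inner ℝ (embV (yser l (alphaY l m ^ 2))) (embV v) = 0 := by
      refine h1.unique ?_
      convert! hasSum_zero with k
      rw [show inner ℝ (embV (jpf l k)) (embV v) = 0 from h k, mul_zero]
    rw [modeHV, map_add, map_smul, map_smul, inner_add_left, real_inner_smul_left,
      real_inner_smul_left, h2, hj l (h 0)]
    ring
  · have h1 := hasSum_inner (hasSum_zser l (alphaZ l m ^ 2)) v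
    simp only [map_smul, real_inner_smul_left] at h1
    have h2 : inner ℝ (embV (zser l (alphaZ l m ^ 2))) (embV v) = 0 := by
      refine h1.unique ?_
      convert! hasSum_zero with k
      rw [show inner ℝ (embV (jqf l k)) (embV v) = 0 from h k, mul_zero]
    rw [modeHV, map_smul, real_inner_smul_left, h2, mul_zero]

lemma inner_eq_zero_of_eigenvalue_ne {i j : Mode} (h : i.eigenvalue ≠ j.eigenvalue) :
    inner ℝ (embV (modeHV i)) (embV (modeHV j)) = 0 := by
  have h1 := gradInner_modeHV i (modeHV j)
  have h2 := gradInner_modeHV j (modeHV i)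
  rw [gradInner_comm, real_inner_comm] at h2
  have h3 : (i.eigenvalue - j.eigenvalue) * inner ℝ (embV (modeHV i)) (embV (modeHV j)) = 0 := by
    linear_combination h2 - h1
  exact (mul_eq_zero.1 h3).resolve_left (sub_ne_zero.2 h)

lemma inner_eq_zero_of_sector {i j : Mode}
    (h : ∀ k k', inner ℝ (embV (sectorField i k)) (embV (sectorField j k')) = 0) :
    inner ℝ (embV (modeHV i)) (embV (modeHV j)) = 0 := by
  refine inner_modeHV_eq_zero i _ fun k => ?_
  rw [real_inner_comm]
  refine inner_modeHV_eq_zero j _ fun k' => ?_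
  rw [real_inner_comm]
  exact h k k'

lemma eigenvalue_Y_pos (l m : ℕ+) : 0 < (Mode.Y l m).eigenvalue :=
  pow_pos (alphaY_spec l.pos m.pos).1 2

lemma eigenvalue_Z_pos (l m : ℕ+) : 0 < (Mode.Z l m).eigenvalue :=
  pow_pos (alphaZ_spec l m.pos).1 2

lemma eigenvalue_nonneg (i : Mode) : 0 ≤ i.eigenvalue := by
  rcases i with _ | ⟨l, m⟩ | ⟨l, m⟩
  · exact le_rfl
  · exact (eigenvalue_Y_pos l m).le
  · exact (eigenvalue_Z_pos l m).le

theorem inner_modeHV {i j : Mode} (hij : i ≠ j) :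
    inner ℝ (embV (modeHV i)) (embV (modeHV j)) = 0 := by
  by_cases h : i.eigenvalue = j.eigenvalue
  swap
  · exact inner_eq_zero_of_eigenvalue_ne h
  rcases i with _ | ⟨l, m⟩ | ⟨l, m⟩ <;> rcases j with _ | ⟨l', m'⟩ | ⟨l', m'⟩
  · exact absurd rfl hij
  · exact absurd h (eigenvalue_Y_pos l' m').ne
  · exact absurd h (eigenvalue_Z_pos l' m').ne
  · exact absurd h (eigenvalue_Y_pos l m).ne'
  · by_cases hl : l = l'
    · subst hl
      have h1 := (sq_eq_sq₀ (alphaY_spec l.pos m.pos).1.le (alphaY_spec l.pos m'.pos).1.le).1 h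
      have h2 := (posZerosListed_charY l.pos).1.injective h1
      exact absurd (by rw [PNat.coe_inj.1 h2]) hij
    · exact inner_eq_zero_of_sector fun k k' =>
        inner_pf_pf l.pos l'.pos (fun h => hl (PNat.coe_inj.1 h)) k k'
  · exact inner_eq_zero_of_sector fun k k' => inner_pf_qf l l' k k'
  · exact absurd h (eigenvalue_Z_pos l m).ne'
  · refine inner_eq_zero_of_sector fun k k' => ?_
    rw [real_inner_comm]
    exact inner_pf_qf l' l k' k
  · by_cases hl : l = l'
    · subst hl
      have h1 := (sq_eq_sq₀ (alphaZ_spec l m.pos).1.le (alphaZ_spec l m'.pos).1.le).1 h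
      have h2 := (posZerosListed_charZ l).1.injective h1
      exact absurd (by rw [PNat.coe_inj.1 h2]) hij
    · exact inner_eq_zero_of_sector fun k k' =>
        inner_qf_qf l.pos l'.pos (fun h => hl (PNat.coe_inj.1 h)) k k'

/-! ### The moments of an eigenfunction -/

/-- The space of solutions of the eigenvalue equation. -/
def eigSub (κ : ℝ) : Submodule ℝ HV where
  carrier := {u | ∀ v, gradInner (embV u) (embV v) = κ * inner ℝ (embV u) (embV v)}
  zero_mem' v := by
    have := gradInner_smul_left 0 0 v
    rw [zero_smul, zero_mul] at this
    rw [this, map_zero, inner_zero_left, mul_zero]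
  add_mem' {a b} ha hb v := by
    rw [gradInner_add_left, ha v, hb v, map_add, inner_add_left]; ring
  smul_mem' c a ha v := by
    rw [gradInner_smul_left, ha v, map_smul, real_inner_smul_left]; ring

lemma isEigen_embV_iff {κ : ℝ} {u : HV} : IsEigen κ (embV u) ↔ u ∈ eigSub κ := by
  refine ⟨fun h v => h.2 _ (embV_mem v), fun h => ⟨embV_mem u, fun v hv => ?_⟩⟩
  obtain ⟨v, rfl⟩ := exists_embV hv
  exact h v

lemma modeHV_mem_eigSub (i : Mode) : modeHV i ∈ eigSub i.eigenvalue := gradInner_modeHV i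

variable {κ : ℝ} {u : HV}

lemma moment_pf_eq (hu : u ∈ eigSub κ) (l k : ℕ) : κ * inner ℝ (fld (pf l k)) (embV u)
    = (2 * k + l - 1) * (2 * k * l * sv l u - (2 * k + l + 1) * tv l u)
      - lamk l k * inner ℝ (fld (pf l (k - 1))) (embV u) := by
  rw [← gradInner_jpf, gradInner_comm, hu, real_inner_comm, embV_jpf]

lemma moment_qf_eq (hu : u ∈ eigSub κ) (l k : ℕ) : κ * inner ℝ (fld (qf l k)) (embV u)
    = (2 * k + l) * qv l u - lamk l k * inner ℝ (fld (qf l (k - 1))) (embV u) := by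
  rw [← gradInner_jqf, gradInner_comm, hu, real_inner_comm, embV_jqf]

lemma mul_sv_eq (hu : u ∈ eigSub κ) (l : ℕ) : κ * sv l u = (l - 1) * tv l u := by
  have h := moment_pf_eq hu l 0
  rw [inner_jpf_zero, lamk] at h
  have : (l : ℝ) + 1 ≠ 0 := by positivity
  refine mul_left_cancel₀ this ?_
  simp only [Nat.cast_zero] at h
  linear_combination -h

/-- Unless `κ` is a zero of the characteristic function, the boundary pairing vanishes. -/
lemma entY_mul_tv (hu : u ∈ eigSub κ) (l : ℕ) : entY l κ * tv l u = 0 := by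
  have h1 := gradInner_yser l κ u
  rw [gradInner_comm, hu, real_inner_comm] at h1
  have h2 := mul_sv_eq hu l
  rw [mul_div_assoc κ (bg (l + 1) κ)] at h1
  rw [entY]
  generalize bg (l + 1) κ / (2 * (l : ℝ) + 3) = D at *
  linear_combination -h1 + (l : ℝ) * (bg l κ - (l + 2) * D) * h2

lemma entZ_mul_qv (hu : u ∈ eigSub κ) (l : ℕ) : entZ l κ * qv l u = 0 := by
  have h1 := gradInner_zser l κ u
  rw [gradInner_comm, hu, real_inner_comm] at h1
  linarith

/-- A two-term recursion without source has only the zero solution. -/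
lemma eq_zero_of_recursion {l : ℕ} {m : ℕ → ℝ} (h : ∀ k, κ * m k = -(lamk l k * m (k - 1)))
    (k : ℕ) : m k = 0 := by
  by_cases hκ : κ = 0
  · have h1 := h (k + 1)
    rw [hκ, zero_mul, Nat.add_sub_cancel, eq_comm, neg_eq_zero] at h1
    exact (mul_eq_zero.1 h1).resolve_left (lamk_succ_pos l k).ne'
  · induction k with
    | zero =>
      have h1 := h 0
      simp only [lamk, Nat.cast_zero, mul_zero, zero_mul, neg_zero] at h1
      exact (mul_eq_zero.1 h1).resolve_left hκ
    | succ k ih =>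
      have h1 := h (k + 1)
      rw [Nat.add_sub_cancel, ih, mul_zero, neg_zero] at h1
      exact (mul_eq_zero.1 h1).resolve_left hκ

lemma moment_qf_eq_zero (hu : u ∈ eigSub κ) {l : ℕ} (h : qv l u = 0) (k : ℕ) :
    inner ℝ (fld (qf l k)) (embV u) = 0 :=
  eq_zero_of_recursion (κ := κ) (l := l) (m := fun k => inner ℝ (fld (qf l k)) (embV u))
    (fun k => by rw [moment_qf_eq hu, h]; ring) k

lemma moment_pf_eq_zero (hu : u ∈ eigSub κ) {l : ℕ} (hs : sv l u = 0) (ht : tv l u = 0) (k : ℕ) :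
    inner ℝ (fld (pf l k)) (embV u) = 0 :=
  eq_zero_of_recursion (κ := κ) (l := l) (m := fun k => inner ℝ (fld (pf l k)) (embV u))
    (fun k => by rw [moment_pf_eq hu, hs, ht]; ring) k

lemma sv_eq_zero (hu : u ∈ eigSub κ) (hκ : κ ≠ 0) {l : ℕ} (ht : tv l u = 0) : sv l u = 0 := by
  have h := mul_sv_eq hu l
  rw [ht, mul_zero] at h
  exact (mul_eq_zero.1 h).resolve_left hκ

lemma tv_sub_smul (l : ℕ) (a b : ℝ) (u v : HV) :
    tv l (a • u - b • v) = a * tv l u - b * tv l v := by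
  have h (w : HV) : tv l w = ∑ j, inner ℝ (fld ((X j : Poly) • pgrad (harm l))) ((w : Jet) j.succ)
    + inner ℝ (fld (∑ j, dv j ((X j : Poly) • pgrad (harm l)))) ((w : Jet) 0) := rfl
  rw [h, h, h]
  simp only [Submodule.coe_sub, Submodule.coe_smul, PiLp.sub_apply, PiLp.smul_apply,
    inner_sub_right, real_inner_smul_right, Finset.sum_sub_distrib]
  rw [← Finset.mul_sum, ← Finset.mul_sum]
  ring

lemma qv_sub_smul (l : ℕ) (a b : ℝ) (u v : HV) :
    qv l (a • u - b • v) = a * qv l u - b * qv l v := by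
  have h (w : HV) : qv l w = ∑ j, inner ℝ (fld ((X j : Poly) • qf l 0)) ((w : Jet) j.succ)
    + inner ℝ (fld (∑ j, dv j ((X j : Poly) • qf l 0))) ((w : Jet) 0) := rfl
  rw [h, h, h]
  simp only [Submodule.coe_sub, Submodule.coe_smul, PiLp.sub_apply, PiLp.smul_apply,
    inner_sub_right, real_inner_smul_right, Finset.sum_sub_distrib]
  rw [← Finset.mul_sum, ← Finset.mul_sum]
  ring

/-- If `f` vanishes only on fields without moments in the sector of the mode `i`, then it vanishes
on the eigenfunctions orthogonal to that mode. -/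
lemma eq_zero_of_inner_mode {i : Mode} {f : HV → ℝ} (hf : ∀ a b u v, f (a • u - b • v) = a * f u - b * f v)
    (h0 : ∀ v ∈ eigSub i.eigenvalue, f v = 0 →
      ∀ k, inner ℝ (embV (sectorField i k)) (embV v) = 0)
    (hu : u ∈ eigSub i.eigenvalue) (hi : inner ℝ (embV (modeHV i)) (embV u) = 0) : f u = 0 := by
  have h1 := inner_modeHV_eq_zero i _ (h0 (f u • modeHV i - f (modeHV i) • u)
    (sub_mem (Submodule.smul_mem _ _ (modeHV_mem_eigSub i)) (Submodule.smul_mem _ _ hu))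
    (by rw [hf]; ring))
  rw [map_sub, map_smul, map_smul, inner_sub_right, real_inner_smul_right, real_inner_smul_right,
    hi, mul_zero, sub_zero, mul_eq_zero] at h1
  exact h1.resolve_right (inner_self_ne_zero.2 (modeHV_ne_zero i))

lemma tv_eq_zero (hu : u ∈ eigSub κ) (hκ : 0 < κ)
    (h : ∀ i : Mode, i.eigenvalue = κ → inner ℝ (embV (modeHV i)) (embV u) = 0) {l : ℕ}
    (hl : 1 ≤ l) : tv l u = 0 := by
  rcases mul_eq_zero.1 (entY_mul_tv hu l) with h1 | h1
  · have h2 : Real.sqrt κ ∈ {r : ℝ | 0 < r ∧ charY l r = 0} := by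
      refine ⟨Real.sqrt_pos.2 hκ, ?_⟩
      rw [charY_eq_zero_iff hl (Real.sqrt_pos.2 hκ), Real.sq_sqrt hκ.le, h1]
    rw [(posZerosListed_charY hl).2] at h2
    obtain ⟨m, hm, hm2⟩ := h2
    set i : Mode := .Y ⟨l, hl⟩ ⟨m, hm⟩ with hi
    have he : i.eigenvalue = κ := by
      change alphaY l m ^ 2 = κ
      rw [alphaY, hm2, Real.sq_sqrt hκ.le]
    rw [← he] at hu
    refine eq_zero_of_inner_mode (tv_sub_smul l) (fun v hv hv0 k => ?_) hu (h i he)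
    rw [he] at hv
    exact moment_pf_eq_zero hv (sv_eq_zero hv hκ.ne' hv0) hv0 k
  · exact h1

lemma qv_eq_zero (hu : u ∈ eigSub κ) (hκ : 0 ≤ κ)
    (h : ∀ i : Mode, i.eigenvalue = κ → inner ℝ (embV (modeHV i)) (embV u) = 0) {l : ℕ}
    (hl : 1 ≤ l) : qv l u = 0 := by
  rcases mul_eq_zero.1 (entZ_mul_qv hu l) with h1 | h1
  · rcases hκ.eq_or_lt with rfl | hκ
    · rw [entZ, bg_zero, mul_one, zero_mul, sub_zero] at h1
      exact absurd h1 (by positivity)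
    have h2 : Real.sqrt κ ∈ {r : ℝ | 0 < r ∧ charZ l r = 0} := by
      refine ⟨Real.sqrt_pos.2 hκ, ?_⟩
      rw [charZ_eq_zero_iff l (Real.sqrt_pos.2 hκ), Real.sq_sqrt hκ.le, h1]
    rw [(posZerosListed_charZ l).2] at h2
    obtain ⟨m, hm, hm2⟩ := h2
    set i : Mode := .Z ⟨l, hl⟩ ⟨m, hm⟩ with hi
    have he : i.eigenvalue = κ := by
      change alphaZ l m ^ 2 = κ
      rw [alphaZ, hm2, Real.sq_sqrt hκ.le]
    rw [← he] at hu
    exact eq_zero_of_inner_mode (i := i) (qv_sub_smul l) (fun v hv hv0 k => moment_qf_eq_zero hv hv0 k) hu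
      (h i he)
  · exact h1

/-- For the eigenvalue zero, the first moments of `u` determine its boundary pairings. -/
lemma sv_tv_eq_zero (hu : u ∈ eigSub 0)
    (h : ∀ i : Mode, i.eigenvalue = 0 → inner ℝ (embV (modeHV i)) (embV u) = 0) {l : ℕ}
    (hl : 1 ≤ l) : sv l u = 0 ∧ tv l u = 0 := by
  have h1 := moment_pf_eq hu l 1
  have h2 := mul_sv_eq hu l
  rw [Nat.sub_self, inner_jpf_zero, lamk] at h1
  have h0 : sv 1 u = 0 := by
    rw [sv, ← embV_jgrad]
    exact h .const rfl
  obtain ⟨n, rfl⟩ := Nat.exists_eq_add_of_le' hl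
  rcases n with _ | n
  · rw [zero_add] at h1 ⊢
    rw [h0] at h1 ⊢
    refine ⟨rfl, ?_⟩
    push_cast at h1
    linarith
  · have ht : tv (n + 1 + 1) u = 0 := by
      rw [zero_mul, eq_comm, mul_eq_zero] at h2
      refine h2.resolve_left ?_
      have : ((n : ℝ) + 1) ≠ 0 := by positivity
      push_cast; simpa using this
    rw [ht] at h1
    refine ⟨?_, ht⟩
    push_cast at h1
    have h3 : ((n : ℝ) + 3) * (6 * n + 18) * sv (n + 1 + 1) u = 0 := by linear_combination -h1
    exact (mul_eq_zero.1 h3).resolve_left (by positivity)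

/-- An eigenfunction orthogonal to all modes of the same eigenvalue vanishes. -/
theorem eq_zero_of_eigSub (hκ : 0 ≤ κ) (hu : u ∈ eigSub κ)
    (h : ∀ i : Mode, i.eigenvalue = κ → inner ℝ (embV (modeHV i)) (embV u) = 0) : u = 0 := by
  refine embV_injective ?_
  rw [map_zero]
  refine eq_zero_of_moments u.2 (fun l k hl => ?_) fun l k hl =>
    moment_qf_eq_zero hu (qv_eq_zero hu hκ h hl) k
  rcases hκ.eq_or_lt with rfl | hκ
  · obtain ⟨h1, h2⟩ := sv_tv_eq_zero hu h hl
    exact moment_pf_eq_zero hu h1 h2 k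
  · have h2 := tv_eq_zero hu hκ h hl
    exact moment_pf_eq_zero hu (sv_eq_zero hu hκ.ne' h2) h2 k

/-! ### The eigenspaces -/

lemma inner_HV (u v : HV) : inner ℝ u v = inner ℝ (embV u) (embV v) + gradInner (embV u) (embV v) := by
  rw [gradInner_embV]; ring

lemma gradInner_self_nonneg (u : HV) : 0 ≤ gradInner (embV u) (embV u) := by
  unfold gradInner
  exact Finset.sum_nonneg fun j _ => real_inner_self_nonneg

/-- Only finitely many modes have eigenvalue at most `R`: normalised, they would be an orthonormal
family that is bounded in `H¹`. -/
theorem finite_eigenvalue_le (R : ℝ) : {i : Mode | i.eigenvalue ≤ R}.Finite := by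
  by_contra hinf
  set f := Set.Infinite.natEmbedding _ hinf with hf
  set w : ℕ → HV := fun n => ‖embV (modeHV (f n))‖⁻¹ • modeHV (f n) with hw
  have hpos (n : ℕ) : 0 < ‖embV (modeHV (f n))‖ := norm_pos_iff.2 (modeHV_ne_zero _)
  have h1 (n : ℕ) : ‖embV (w n)‖ = 1 := by
    rw [hw]; simp only [map_smul, norm_smul, norm_inv, norm_norm]
    exact inv_mul_cancel₀ (hpos n).ne'
  have horth {n m : ℕ} (hnm : n ≠ m) : inner ℝ (embV (w n)) (embV (w m)) = 0 := by
    simp only [hw, map_smul, real_inner_smul_left, real_inner_smul_right]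
    rw [inner_modeHV fun h => hnm (f.injective (Subtype.ext h))]; ring
  have h2 (n : ℕ) : ‖w n‖ ≤ Real.sqrt (1 + R) := by
    refine Real.le_sqrt_of_sq_le ?_
    have hm : w n ∈ eigSub (f n : Mode).eigenvalue :=
      Submodule.smul_mem _ _ (modeHV_mem_eigSub _)
    rw [← real_inner_self_eq_norm_sq, inner_HV, hm, real_inner_self_eq_norm_sq, h1]
    have := (f n).2
    rw [Set.mem_ofPred_eq] at this
    linarith
  have hK := isCompactOperator_embV.isCompact_closure_image_closedBall (Real.sqrt (1 + R))
  obtain ⟨a, -, φ, hφ, ha⟩ := hK.tendsto_subseq (x := fun n => embV (w n)) fun n =>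
    subset_closure ⟨w n, mem_closedBall_zero_iff.2 (h2 n), rfl⟩
  have hc := ha.cauchySeq
  rw [Metric.cauchySeq_iff'] at hc
  obtain ⟨N, hN⟩ := hc 1 one_pos
  have h3 := hN (N + 1) (Nat.le_succ N)
  rw [dist_eq_norm] at h3
  have h4 := norm_sub_sq_real (embV (w (φ (N + 1)))) (embV (w (φ N)))
  simp only [Function.comp_apply] at h3
  rw [horth (hφ (Nat.lt_succ_self N)).ne', h1, h1] at h4
  have h5 : ‖embV (w (φ (N + 1))) - embV (w (φ N))‖ ^ 2 < 1 ^ 2 :=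
    pow_lt_pow_left₀ h3 (norm_nonneg _) two_ne_zero
  linarith

/-- The eigenspaces are spanned by the modes. -/
theorem eigSub_eq_span (κ : ℝ) :
    eigSub κ = Submodule.span ℝ (modeHV '' {i | i.eigenvalue = κ}) := by
  refine le_antisymm (fun u hu => ?_) ?_
  · by_cases hκ : 0 ≤ κ
    · have hfin : {i : Mode | i.eigenvalue = κ}.Finite :=
        (finite_eigenvalue_le κ).subset fun i hi => le_of_eq hi
      set p : HV := ∑ i ∈ hfin.toFinset, (inner ℝ (embV (modeHV i)) (embV u)
        / inner ℝ (embV (modeHV i)) (embV (modeHV i))) • modeHV i with hp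
      have hps : p ∈ Submodule.span ℝ (modeHV '' {i | i.eigenvalue = κ}) :=
        Submodule.sum_mem _ fun i hi => Submodule.smul_mem _ _
          (Submodule.subset_span ⟨i, hfin.mem_toFinset.1 hi, rfl⟩)
      have hpe : p ∈ eigSub κ := Submodule.sum_mem _ fun i hi => Submodule.smul_mem _ _ (by
        have : i.eigenvalue = κ := hfin.mem_toFinset.1 hi
        rw [← this]; exact modeHV_mem_eigSub i)
      have h0 := eq_zero_of_eigSub hκ (sub_mem hu hpe) fun i hi => by
        rw [map_sub, inner_sub_right, hp, map_sum, inner_sum, Finset.sum_eq_single i]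
        · rw [map_smul, real_inner_smul_right, div_mul_cancel₀ _
            (inner_self_ne_zero.2 (modeHV_ne_zero i)), sub_self]
        · intro j _ hj
          rw [map_smul, real_inner_smul_right, inner_modeHV hj.symm, mul_zero]
        · exact fun h => absurd (hfin.mem_toFinset.2 hi) h
      rw [sub_eq_zero.1 h0]
      exact hps
    · have h1 := hu u
      have h2 := gradInner_self_nonneg u
      have h3 : u = 0 := by
        refine embV_injective ?_
        rw [map_zero]
        by_contra hne
        have := real_inner_self_pos.2 hne
        push Not at hκ
        nlinarith
      rw [h3]
      exact zero_mem _
  · rw [Submodule.span_le]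
    rintro _ ⟨i, rfl, rfl⟩
    exact modeHV_mem_eigSub i

theorem isEigen_iff (κ : ℝ) (u : L2Field) : IsEigen κ u ↔
    u ∈ Submodule.span ℝ ((fun i => embV (modeHV i)) '' {i | i.eigenvalue = κ}) := by
  have h : Submodule.span ℝ ((fun i => embV (modeHV i)) '' {i | i.eigenvalue = κ})
      = (eigSub κ).map (embV : HV →ₗ[ℝ] L2Field) := by
    rw [eigSub_eq_span, Submodule.map_span, ← Set.image_comp]
    rfl
  rw [h]
  constructor
  · intro hu
    obtain ⟨w, rfl⟩ := exists_embV hu.1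
    exact ⟨w, isEigen_embV_iff.1 hu, rfl⟩
  · rintro ⟨w, hw, rfl⟩
    exact isEigen_embV_iff.2 hw

/-! ### Completeness of the eigenfunctions -/

/-- The eigenfunctions span a dense subspace of the `H¹` space, by the spectral theorem for the
compact self-adjoint operator that represents the `L²` product. -/
theorem closure_span_modeHV :
    (Submodule.span ℝ (Set.range modeHV)).topologicalClosure = ⊤ := by
  set T : HV →L[ℝ] HV := (ContinuousLinearMap.adjoint embV).comp embV with hT
  have hTi (u v : HV) : inner ℝ (T u) v = inner ℝ (embV u) (embV v) := by
    rw [hT, ContinuousLinearMap.comp_apply, ContinuousLinearMap.adjoint_inner_left]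
  have hc : IsCompactOperator T := isCompactOperator_embV.clm_comp (ContinuousLinearMap.adjoint embV)
  have hs : (T : HV →ₗ[ℝ] HV).IsSymmetric := fun u v => by
    change inner ℝ (T u) v = inner ℝ u (T v)
    exact (hTi u v).trans ((real_inner_comm _ _).trans ((hTi v u).symm.trans
      (real_inner_comm _ _)))
  have h1 := ContinuousLinearMap.orthogonalComplement_iSup_eigenspaces_eq_bot hc hs
  rw [eq_top_iff, ← (Submodule.topologicalClosure_eq_top_iff).2 h1]
  refine Submodule.topologicalClosure_mono (iSup_le fun μ u hu => ?_)
  have hu' : T u = μ • u := Module.End.mem_eigenspace_iff.1 hu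
  by_cases hμ : μ = 0
  · have h2 := hTi u u
    rw [hu', hμ, zero_smul, inner_zero_left] at h2
    have h3 : u = 0 := embV_injective (by rw [map_zero]; exact inner_self_eq_zero.1 h2.symm)
    rw [h3]; exact zero_mem _
  · have h2 : u ∈ eigSub (μ⁻¹ - 1) := fun v => by
      have h3 := hTi u v
      have h4 : inner ℝ (μ • u) v = μ * inner ℝ u v := by
        rw [Submodule.coe_inner, Submodule.coe_inner, Submodule.coe_smul, real_inner_smul_left]
      rw [hu', h4, inner_HV] at h3
      field_simp
      linear_combination h3
    rw [eigSub_eq_span] at h2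
    exact Submodule.span_mono (Set.image_subset_range _ _) h2

theorem subset_closure_span : V ⊆ closure
    (Submodule.span ℝ (Set.range fun i => embV (modeHV i)) : Set L2Field) := by
  intro u hu
  obtain ⟨w, rfl⟩ := exists_embV hu
  have hw : w ∈ closure (Submodule.span ℝ (Set.range modeHV) : Set HV) := by
    rw [← Submodule.topologicalClosure_coe, closure_span_modeHV]; trivial
  refine closure_mono ?_ (image_closure_subset_closure_image embV.continuous ⟨w, hw, rfl⟩)
  rintro _ ⟨v, hv, rfl⟩
  have h := Submodule.mem_map_of_mem (f := (embV : HV →ₗ[ℝ] L2Field)) hv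
  rw [Submodule.map_span, ← Set.range_comp] at h
  exact h

/-! ### Enumeration of the modes -/

/-- A real function with finite sublevel sets on a countably infinite type can be listed in
nondecreasing order. -/
theorem exists_equiv_monotone {ι : Type*} [Countable ι] [Infinite ι] (f : ι → ℝ)
    (hf : ∀ R, {i | f i ≤ R}.Finite) : ∃ σ : ℕ ≃ ι, Monotone fun n => f (σ n) := by
  obtain ⟨e, he⟩ := exists_injective_nat ι
  -- ties are broken by an arbitrary enumeration
  have hkey : Function.Injective fun i => toLex (f i, e i) := fun i j h =>
    he (congrArg (fun p => (ofLex p).2) h)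
  let : LinearOrder ι := LinearOrder.lift' (fun i => toLex (f i, e i)) hkey
  have hle {i j : ι} (h : i ≤ j) : f i ≤ f j := by
    have h' : toLex (f i, e i) ≤ toLex (f j, e j) := h
    rcases Prod.Lex.toLex_le_toLex.1 h' with h1 | h1
    · exact h1.le
    · exact h1.1.le
  have hfin (i : ι) : (Set.Iic i).Finite := (hf (f i)).subset fun j hj => hle hj
  let : LocallyFiniteOrder ι := LocallyFiniteOrder.ofFiniteIcc fun a b =>
    (hfin b).subset fun _ hx => hx.2
  have : NoMaxOrder ι := ⟨fun i => by
    by_contra! h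
    exact Set.infinite_univ ((hfin i).subset fun j _ => h j)⟩
  obtain ⟨b, hb⟩ : ∃ b : ι, ∀ i, b ≤ i := by
    obtain ⟨i₀⟩ : Nonempty ι := inferInstance
    obtain ⟨b, hb, hb2⟩ := (hfin i₀).exists_minimalFor id _ ⟨i₀, Set.self_mem_Iic⟩
    refine ⟨b, fun i => ?_⟩
    by_contra! h
    exact absurd (hb2 (h.le.trans hb) h.le) (not_le.2 h)
  let : OrderBot ι := { bot := b, bot_le := hb }
  let := LinearLocallyFiniteOrder.succOrder ι
  let := LinearLocallyFiniteOrder.predOrder ι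
  refine ⟨(orderIsoNatOfLinearSuccPredArch (ι := ι)).symm.toEquiv, fun a b h => hle ?_⟩
  exact (orderIsoNatOfLinearSuccPredArch (ι := ι)).symm.monotone h

instance : Countable Mode := by
  have h : (Set.univ : Set Mode) = ⋃ n : ℕ, {i : Mode | i.eigenvalue ≤ (n : ℝ)} := by
    refine (Set.iUnion_eq_univ_iff.2 fun i => ?_).symm
    exact exists_nat_ge i.eigenvalue
  rw [← Set.countable_univ_iff, h]
  exact Set.countable_iUnion fun n => (finite_eigenvalue_le n).countable

instance : Infinite Mode :=
  Infinite.of_injective (fun m : ℕ+ => Mode.Y 1 m) fun a b h => by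
    injection h

lemma eigenvalue_eq_zero {i : Mode} (h : i.eigenvalue = 0) : i = .const := by
  rcases i with _ | ⟨l, m⟩ | ⟨l, m⟩
  · rfl
  · exact absurd h (eigenvalue_Y_pos l m).ne'
  · exact absurd h (eigenvalue_Z_pos l m).ne'

/-! ### The min-max values -/

lemma inner_sum_modeHV (F : Finset Mode) (a : Mode → ℝ) {i : Mode} (hi : i ∈ F) :
    inner ℝ (embV (modeHV i)) (embV (∑ j ∈ F, a j • modeHV j))
      = a i * inner ℝ (embV (modeHV i)) (embV (modeHV i)) := by
  rw [map_sum, inner_sum, Finset.sum_eq_single i]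
  · rw [map_smul, real_inner_smul_right]
  · intro j _ hj
    rw [map_smul, real_inner_smul_right, inner_modeHV hj.symm, mul_zero]
  · exact fun h => absurd hi h

lemma inner_self_sum (F : Finset Mode) (a : Mode → ℝ) :
    inner ℝ (embV (∑ j ∈ F, a j • modeHV j)) (embV (∑ j ∈ F, a j • modeHV j))
      = ∑ i ∈ F, a i ^ 2 * inner ℝ (embV (modeHV i)) (embV (modeHV i)) := by
  have h (v : L2Field) : inner ℝ (embV (∑ j ∈ F, a j • modeHV j)) v
      = ∑ i ∈ F, a i * inner ℝ (embV (modeHV i)) v := by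
    rw [map_sum, sum_inner]
    exact Finset.sum_congr rfl fun i _ => by rw [map_smul, real_inner_smul_left]
  rw [h]
  refine Finset.sum_congr rfl fun i hi => ?_
  rw [inner_sum_modeHV F a hi]
  ring

lemma gradInner_self_sum (F : Finset Mode) (a : Mode → ℝ) :
    gradInner (embV (∑ j ∈ F, a j • modeHV j)) (embV (∑ j ∈ F, a j • modeHV j))
      = ∑ i ∈ F, i.eigenvalue * (a i ^ 2 * inner ℝ (embV (modeHV i)) (embV (modeHV i))) := by
  have h (G : Finset Mode) (v : HV) : gradInner (embV (∑ j ∈ G, a j • modeHV j)) (embV v)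
      = ∑ i ∈ G, a i * (i.eigenvalue * inner ℝ (embV (modeHV i)) (embV v)) := by
    classical
    induction G using Finset.induction_on with
    | empty =>
      have := gradInner_smul_left 0 0 v
      rw [zero_smul, zero_mul] at this
      rw [Finset.sum_empty, Finset.sum_empty, this]
    | insert i G hi ih =>
      rw [Finset.sum_insert hi, Finset.sum_insert hi, gradInner_add_left, ih,
        gradInner_smul_left, gradInner_modeHV]
  rw [h]
  refine Finset.sum_congr rfl fun i hi => ?_
  rw [inner_sum_modeHV F a hi]
  ring

lemma mul_inner_le_gradInner {c : ℝ} {s : Set Mode} (hs : ∀ i ∈ s, c ≤ i.eigenvalue) {q : HV}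
    (hq : q ∈ Submodule.span ℝ (modeHV '' s)) :
    c * inner ℝ (embV q) (embV q) ≤ gradInner (embV q) (embV q) := by
  obtain ⟨a, ha, rfl⟩ := (Finsupp.mem_span_image_iff_linearCombination ℝ).1 hq
  rw [Finsupp.linearCombination_apply, Finsupp.sum, inner_self_sum, gradInner_self_sum,
    Finset.mul_sum]
  refine Finset.sum_le_sum fun i hi => ?_
  have := hs i (ha hi)
  have := real_inner_self_nonneg (x := embV (modeHV i))
  gcongr

lemma gradInner_le_mul_inner {c : ℝ} {s : Set Mode} (hs : ∀ i ∈ s, i.eigenvalue ≤ c) {q : HV}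
    (hq : q ∈ Submodule.span ℝ (modeHV '' s)) :
    gradInner (embV q) (embV q) ≤ c * inner ℝ (embV q) (embV q) := by
  obtain ⟨a, ha, rfl⟩ := (Finsupp.mem_span_image_iff_linearCombination ℝ).1 hq
  rw [Finsupp.linearCombination_apply, Finsupp.sum, inner_self_sum, gradInner_self_sum,
    Finset.mul_sum]
  refine Finset.sum_le_sum fun i hi => ?_
  have := hs i (ha hi)
  have := real_inner_self_nonneg (x := embV (modeHV i))
  gcongr

/-- The projection that removes the components along the modes in a finite set. -/
def removeModes (F : Finset Mode) : HV →L[ℝ] HV :=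
  ContinuousLinearMap.id ℝ HV - ∑ i ∈ F,
    ((innerSL ℝ ((inner ℝ (embV (modeHV i)) (embV (modeHV i)))⁻¹ • embV (modeHV i))).comp
      embV).smulRight (modeHV i)

lemma removeModes_apply (F : Finset Mode) (w : HV) : removeModes F w = w - ∑ i ∈ F,
    ((inner ℝ (embV (modeHV i)) (embV (modeHV i)))⁻¹ * inner ℝ (embV (modeHV i)) (embV w))
      • modeHV i := by
  simp only [removeModes, sub_apply, ContinuousLinearMap.id_apply, sum_apply,
    ContinuousLinearMap.smulRight_apply, ContinuousLinearMap.comp_apply, innerSL_apply_apply,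
    real_inner_smul_left]

lemma removeModes_of_orthogonal {F : Finset Mode} {w : HV}
    (h : ∀ i ∈ F, inner ℝ (embV (modeHV i)) (embV w) = 0) : removeModes F w = w := by
  rw [removeModes_apply, Finset.sum_eq_zero, sub_zero]
  intro i hi
  rw [h i hi, mul_zero, zero_smul]

lemma removeModes_of_mem {F : Finset Mode} {i : Mode} (hi : i ∈ F) :
    removeModes F (modeHV i) = 0 := by
  rw [removeModes_apply, Finset.sum_eq_single i]
  · rw [inv_mul_cancel₀ (inner_self_ne_zero.2 (modeHV_ne_zero i)), one_smul, sub_self]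
  · intro j _ hj
    rw [inner_modeHV hj, mul_zero, zero_smul]
  · exact fun h => absurd hi h

/-- The Rayleigh quotient is at least `c` on the fields orthogonal to all modes with eigenvalue
below `c`; by density it suffices to see this for finite combinations of modes. -/
theorem le_gradInner_of_orthogonal {F : Finset Mode} {c : ℝ} (hc : ∀ i ∉ F, c ≤ i.eigenvalue)
    {w : HV} (hw : ∀ i ∈ F, inner ℝ (embV (modeHV i)) (embV w) = 0) :
    c * inner ℝ (embV w) (embV w) ≤ gradInner (embV w) (embV w) := by
  set s : Set HV := {v | (c + 1) * inner ℝ (embV (removeModes F v)) (embV (removeModes F v))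
    ≤ inner ℝ (removeModes F v) (removeModes F v)} with hs
  have hcl : IsClosed s := by
    have h1 := (removeModes F).continuous
    have h2 := embV.continuous.comp h1
    exact isClosed_le (continuous_const.mul (h2.inner h2)) (h1.inner h1)
  have hsub : (Submodule.span ℝ (Set.range modeHV) : Set HV) ⊆ s := by
    intro v hv
    have h1 : removeModes F v ∈ Submodule.span ℝ (modeHV '' {i | i ∉ F}) := by
      refine (Submodule.map_span_le (removeModes F : HV →ₗ[ℝ] HV) _ _).2 ?_
        (Submodule.mem_map_of_mem hv)
      rintro _ ⟨i, rfl⟩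
      by_cases hi : i ∈ F
      · rw [ContinuousLinearMap.coe_coe, removeModes_of_mem hi]; exact zero_mem _
      · rw [ContinuousLinearMap.coe_coe, removeModes_of_orthogonal fun j hj =>
          inner_modeHV fun h : j = i => hi (h ▸ hj)]
        exact Submodule.subset_span ⟨i, hi, rfl⟩
    have h2 := mul_inner_le_gradInner hc h1
    rw [hs, Set.mem_ofPred_eq, inner_HV]
    linarith
  have hwm : w ∈ s := by
    refine closure_minimal hsub hcl ?_
    rw [← Submodule.topologicalClosure_coe, closure_span_modeHV]; trivial
  rw [hs, Set.mem_ofPred_eq, removeModes_of_orthogonal hw, inner_HV] at hwm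
  linarith

lemma linearIndependent_modes : LinearIndependent ℝ fun i => embV (modeHV i) :=
  linearIndependent_of_ne_zero_of_inner_eq_zero modeHV_ne_zero fun _ _ h => inner_modeHV h

lemma span_modes_subset_V (s : Set HV) : (Submodule.span ℝ (embV '' s) : Set L2Field) ⊆ V := by
  intro u hu
  have h : Submodule.span ℝ (embV '' s) = (Submodule.span ℝ s).map (embV : HV →ₗ[ℝ] L2Field) :=
    (Submodule.map_span (embV : HV →ₗ[ℝ] L2Field) s).symm
  rw [h] at hu
  obtain ⟨w, -, rfl⟩ := hu
  exact embV_mem w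

lemma le_minMax {σ : ℕ ≃ Mode} (hσ : Monotone fun n => (σ n).eigenvalue) (n : ℕ) :
    (((σ n).eigenvalue : ℝ) : EReal) ≤ minMax n := by
  set v : Fin n → L2Field := fun k => embV (modeHV (σ k)) with hv
  have hli : LinearIndependent ℝ v :=
    linearIndependent_modes.comp (fun k : Fin n => σ k) (σ.injective.comp Fin.val_injective)
  have hrank : Module.rank ℝ (Submodule.span ℝ (Set.range v)) = n := by
    have h1 := finrank_span_eq_card hli
    rw [Fintype.card_fin] at h1
    have : Module.Finite ℝ (Submodule.span ℝ (Set.range v)) :=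
      Module.Finite.span_of_finite ℝ (Set.finite_range v)
    rw [← Module.finrank_eq_rank, h1]
  have hV : (Submodule.span ℝ (Set.range v) : Set L2Field) ⊆ V := by
    have : Set.range v = embV '' Set.range fun k : Fin n => modeHV (σ k) := by
      rw [← Set.range_comp]; rfl
    rw [this]; exact span_modes_subset_V _
  refine le_iSup₂_of_le (Submodule.span ℝ (Set.range v)) ⟨hV, hrank⟩ (le_iInf₂ ?_)
  rintro u ⟨hu, hu0, horth⟩
  obtain ⟨w, rfl⟩ := exists_embV hu
  rw [EReal.coe_le_coe_iff, rayleigh, le_div_iff₀ (by positivity), ← real_inner_self_eq_norm_sq]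
  refine le_gradInner_of_orthogonal (F := (Finset.range n).map σ.toEmbedding) (fun i hi => ?_)
    fun i hi => ?_
  · have : n ≤ σ.symm i := by
      by_contra! h
      exact hi (Finset.mem_map.2 ⟨σ.symm i, Finset.mem_range.2 h, by simp⟩)
    simpa using hσ this
  · obtain ⟨k, hk, rfl⟩ := Finset.mem_map.1 hi
    rw [real_inner_comm]
    exact horth _ (Submodule.subset_span ⟨⟨k, Finset.mem_range.1 hk⟩, rfl⟩)

lemma minMax_le {σ : ℕ ≃ Mode} (hσ : Monotone fun n => (σ n).eigenvalue) (n : ℕ) :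
    minMax n ≤ (((σ n).eigenvalue : ℝ) : EReal) := by
  refine iSup₂_le ?_
  rintro W ⟨-, hrank⟩
  have : Module.Finite ℝ W := Module.finite_of_rank_eq_nat hrank
  set v : Fin (n + 1) → L2Field := fun k => embV (modeHV (σ k)) with hv
  have hli : LinearIndependent ℝ v :=
    linearIndependent_modes.comp (fun k : Fin (n + 1) => σ k) (σ.injective.comp Fin.val_injective)
  -- some combination of the first `n + 1` modes is orthogonal to `W`
  have hker := LinearMap.ker_ne_bot_of_finrank_lt
    (f := (W.orthogonalProjectionOnto : L2Field →ₗ[ℝ] W) ∘ₗ Fintype.linearCombination ℝ v) (by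
      rw [Module.finrank_eq_of_rank_eq hrank, Module.finrank_fin_fun]; exact Nat.lt_succ_self n)
  obtain ⟨a, ha, ha0⟩ := Submodule.exists_mem_ne_zero_of_ne_bot hker
  set q : HV := ∑ k, a k • modeHV (σ k) with hq
  have hqv : embV q = Fintype.linearCombination ℝ v a := by
    rw [Fintype.linearCombination_apply, hq, map_sum]
    simp only [map_smul, hv]
  have hq0 : embV q ≠ 0 := by
    intro h
    rw [hqv, Fintype.linearCombination_apply] at h
    exact ha0 (funext (Fintype.linearIndependent_iff.1 hli a h))
  have hqW : ∀ w ∈ W, inner ℝ (embV q) w = 0 := by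
    have h1 : W.orthogonalProjectionOnto (embV q) = 0 := by rw [hqv]; exact ha
    intro w hw
    rw [real_inner_comm]
    exact (Submodule.mem_orthogonal W _).1
      (Submodule.orthogonalProjectionOnto_eq_zero_iff.1 h1) w hw
  refine iInf₂_le_of_le (embV q) ⟨embV_mem q, hq0, hqW⟩ ?_
  rw [EReal.coe_le_coe_iff, rayleigh, div_le_iff₀ (by positivity), ← real_inner_self_eq_norm_sq]
  refine gradInner_le_mul_inner (s := Set.range fun k : Fin (n + 1) => σ k) ?_ ?_
  · rintro _ ⟨k, rfl⟩
    exact hσ (Nat.lt_succ_iff.1 k.2)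
  · exact Submodule.sum_mem _ fun k _ => Submodule.smul_mem _ _
      (Submodule.subset_span ⟨_, ⟨k, rfl⟩, rfl⟩)

end BallEig
end


theorem lemma6 :
    -- the positive zeros of both equations form increasing sequences indexed by `m = 1, 2, …`
    (∀ l : ℕ, 1 ≤ l → PosZerosListed (charZ l) ∧ PosZerosListed (charY l)) ∧
    -- the explicit fields, as elements of `L²`
    ∃ ψ : Mode → L2Field, (∀ i, ψ i =ᵐ[ballMeasure] i.field) ∧
      -- they are eigenfunctions with the stated eigenvalues
      (∀ i, ψ i ≠ 0 ∧ IsEigen i.eigenvalue (ψ i)) ∧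
      -- they are pairwise orthogonal and complete in the admissible space
      (∀ i j, i ≠ j → inner ℝ (ψ i) (ψ j) = 0) ∧
      V ⊆ closure (Submodule.span ℝ (Set.range ψ) : Set L2Field) ∧
      -- they span all the eigenspaces; in particular there are no other eigenvalues
      (∀ (κ : ℝ) (u : L2Field),
        IsEigen κ u ↔ u ∈ Submodule.span ℝ (ψ '' {i | i.eigenvalue = κ})) ∧
      -- the min-max values list the eigenvalues of all modes, with multiplicity, in ascending
      -- order, starting with the zero mode
      ∃ σ : ℕ ≃ Mode, σ 0 = Mode.const ∧ Monotone (fun n => (σ n).eigenvalue) ∧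
        ∀ n, minMax n = (((σ n).eigenvalue : ℝ) : EReal) := by
  refine ⟨fun l hl => ⟨posZerosListed_charZ l, posZerosListed_charY hl⟩,
    fun i => embV (modeHV i), modeHV_ae, fun i => ⟨modeHV_ne_zero i, isEigen_modeHV i⟩,
    fun i j hij => inner_modeHV hij, subset_closure_span, isEigen_iff, ?_⟩
  obtain ⟨σ, hσ⟩ := exists_equiv_monotone Mode.eigenvalue finite_eigenvalue_le
  refine ⟨σ, eigenvalue_eq_zero (le_antisymm ?_ (eigenvalue_nonneg _)), hσ,
    fun n => le_antisymm (minMax_le hσ n) (le_minMax hσ n)⟩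
  have h : (σ 0).eigenvalue ≤ (σ (σ.symm .const)).eigenvalue := hσ (Nat.zero_le _)
  rw [σ.apply_symm_apply] at h
  exact h
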